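/- Let $k\ge 2$ be an integer and let $(a_n)_{n\ge1}$ be non-negative real weights with $A(X)=\sum_{1\le n\le X}a_n\to\infty$, viewed as a weighted set $\mathcal A$. Write $e(x)=e^{2\pi i x}$, $$A(q,b;X)=\sum_{\substack{n\le X\\ n\equiv b\,(q)}}a_n,\qquad f(\alpha;X)=\sum_{x\le X}a_x e(\alpha x^k),\qquad R_{s;k}(n)=\sum_{\substack{x_1,\dots,x_s\ge 1\\ x_1^k+\dots+x_s^k=n}}a_{x_1}\cdots a_{x_s},$$ let $\mathfrak M_X(Q)=\bigcup_{1\le q\le Q}\{\alpha\in\mathbb R/\mathbb Z:\|q\alpha\|\le QX^{-k}\}$, and let $\mathfrak m_X(Q)$ be its complement in $\mathbb R/\mathbb Z$. Relations $\ll,\asymp,o$ are as $X\to\infty$. Assume that $\mathcal A$ has positive logarithmic lower density, $\liminf_{X\to\infty}\log A(X)/\log X>0$, and that, for real numbers $t_0\ge0$, $\varrho>0$, $\omega\ge0$ and functions $Q_D,Q_W,E,\Delta,L$ with $E>0$: (D) there are $\kappa(q,b)\ge0$ with $A(q,b;X)=\kappa(q,b)A(X)+O(E(X))$ uniformly for $1\le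 q\le Q_D(X)$ and $b$ mod $q$, and $E(X)=o(A(X))$; (V) for every real $t\ge t_0$, $\int_0^1|f(\alpha;X)|^{2t}\,d\alpha\ll A(X)^{2t}X^{-k}\Delta(X)$; (W) $L(X)\ll X^{\varepsilon}$ for every $\varepsilon>0$, and $\sup_{\alpha\in\mathfrak m_X(Q)}|f(\alpha;X)|\ll A(X)Q^{-\varrho}L(X)$ uniformly for $1\le Q\le Q_W(X)$; (L) $L(X)\ll Y(X)^{\varrho-\delta}$ for some $\delta>0$, where $Y(X)=\min\{Q_D(X),Q_W(X),(A(X)/E(X))^{1/5},X^{1/5}\}$. Suppose moreover that $E(X)\ll1$, $Q_D(X)\asymp Q_W(X)\asymp X$ and $\Delta(X)\ll\min(X,A(X))^{\omega}$. For an integer $s$ and a continuously differentiable non-decreasing function $\Psi$ with $\Psi(0)=0$, put, with $X=n^{1/k}$, $$S(q,b)=\sum_{\ell\bmod q}\kappa(q,\ell)e(b\ell^k/q),\qquad w_X(\gamma)=\frac1{\Psi(X)}\int_0^X e(\gamma(\xi/X)^k)\,\Psi'(\xi)\,d\xi$$ (with $w_X=0$ if $\Psi(X)=0$) and $$\mathfrak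 S(n)=\sum_{q\ge1}\ \sum_{\substack{1\le b\le q\\(b,q)=1}}S(q,b)^s e(-bn/q),\qquad \mathfrak J(n)=\int_{\mathbb R}w_X(\gamma)^s e(-\gamma)\,d\gamma .$$ Then there is such a $\Psi$, depending on $\mathcal A$ but not on $s$ or $n$, with $\Psi(X)-A(X)\ll1$, for which the following holds. For every real $\sigma_0\ge5\omega/\varrho$ and every integer $s>2t_0+\sigma_0$, $\mathfrak S(n)$ and $\mathfrak J(n)$ converge absolutely for every $n\ge1$ (indeed $\sum_q\sum_{(b,q)=1}|S(q,b)|^s<\infty$), $\mathcal C(n)=\mathfrak S(n)\mathfrak J(n)$ is a non-negative real number, and, as $n\to\infty$, $$R_{s;k}(n)=A(n^{1/k})^s\,n^{-1}\bigl(\mathcal C(n)+o(1)\bigr).$$ In particular, if $\omega<\varrho/5$ (and $2t_0$ is an integer), this holds with $s=2t_0+1$. -/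

import Mathlib

open Filter Asymptotics

noncomputable section

namespace ThinWaring

/-- The additive character `e(x) = exp(2 π i x)`. -/
def e (x : ℝ) : ℂ := Complex.exp (2 * Real.pi * Complex.I * (x : ℂ))

/-- The counting function `A(X) = ∑_{1 ≤ n ≤ X} a_n` of a weighted set `(a_n)_{n ≥ 1}`
(the value `a 0` is never used). -/
def count (a : ℕ → ℝ) (X : ℝ) : ℝ := ∑ n ∈ Finset.Icc 1 ⌊X⌋₊, a n

open Classical in
/-- `A(q, b; X)`, the weight of the `n ≤ X` in the residue class `b` modulo `q`. -/
def countMod (a : ℕ → ℝ) (q : ℕ) (b : ZMod q) (X : ℝ) : ℝ :=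
  ∑ n ∈ (Finset.Icc 1 ⌊X⌋₊).filter (fun n : ℕ => (n : ZMod q) = b), a n

/-- The logarithmic lower density `liminf log A(X) / log X`, as an extended real number. -/
def logLowerDensity (a : ℕ → ℝ) : EReal :=
  liminf (fun X : ℝ => ((Real.log (count a X) / Real.log X : ℝ) : EReal)) atTop

/-- The weighted number of solutions of `x_1^k + ⋯ + x_s^k = n` in positive integers.
For `k ≥ 1` all solutions have `1 ≤ x_i ≤ n`. -/
def repCount (a : ℕ → ℝ) (k s n : ℕ) : ℝ :=
  ∑ x ∈ (Fintype.piFinset (fun _ : Fin s => Finset.Icc 1 n)).filter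
      (fun x => ∑ i, x i ^ k = n), ∏ i, a (x i)

/-- The exponential sum `f(α; X) = ∑_{x ≤ X} a_x e(α x^k)`. -/
def expSum (a : ℕ → ℝ) (k : ℕ) (α X : ℝ) : ℂ :=
  ∑ x ∈ Finset.Icc 1 ⌊X⌋₊, (a x : ℂ) * e (α * (x : ℝ) ^ k)

/-- The mean value `I_t(X) = ∫_0^1 |f(α; X)|^{2t} dα`. -/
def meanValue (a : ℕ → ℝ) (k : ℕ) (t X : ℝ) : ℝ :=
  ∫ α in (0 : ℝ)..1, ‖expSum a k α X‖ ^ (2 * t)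

/-- The major arcs, as a 1-periodic subset of the real line. -/
def majorArcs (k : ℕ) (X Q : ℝ) : Set ℝ :=
  {α | ∃ q : ℕ, 1 ≤ q ∧ (q : ℝ) ≤ Q ∧
    |α * q - (round (α * q) : ℝ)| ≤ Q / X ^ k}

/-- The minor arcs. -/
def minorArcs (k : ℕ) (X Q : ℝ) : Set ℝ := (majorArcs k X Q)ᶜ

/-- `Q(X) ≍ X` as `X → ∞`, for positive `Q`. -/
def ComparableToId (Q : ℝ → ℝ) : Prop :=
  ∃ c C : ℝ, 0 < c ∧ ∀ᶠ X : ℝ in atTop, c * X ≤ Q X ∧ Q X ≤ C * X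

/-- The weighted set is distributed to the level `QD`, with densities `κ(q, b)` and error `E`:
`A(q, b; X) = κ(q, b) A(X) + O(E(X))` uniformly for `q ≤ QD(X)` and `b` mod `q`,
where `E = o(A)`. -/
def Distributed (a : ℕ → ℝ) (κ : (q : ℕ) → ZMod q → ℝ) (QD E : ℝ → ℝ) : Prop :=
  (∀ q : ℕ, 1 ≤ q → ∀ b : ZMod q, 0 ≤ κ q b) ∧
  E =o[atTop] count a ∧
  ∃ C : ℝ, ∀ᶠ X : ℝ in atTop, ∀ q : ℕ, 1 ≤ q → (q : ℝ) ≤ QD X → ∀ b : ZMod q,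
    |countMod a q b X - κ q b * count a X| ≤ C * E X

/-- The mean value hypothesis: `I_t(X) ≪ A(X)^{2t} X^{-k} Δ(X)` for every real `t ≥ t₀`. -/
def MeanValueHyp (a : ℕ → ℝ) (k : ℕ) (t₀ : ℝ) (Δ : ℝ → ℝ) : Prop :=
  ∀ t : ℝ, t₀ ≤ t →
    (fun X : ℝ => meanValue a k t X) =O[atTop]
      (fun X : ℝ => count a X ^ (2 * t) / X ^ k * Δ X)

/-- The hypothesis of Weyl type: `L(X) ≪ X^ε` for every `ε > 0`, and
`sup_{α ∈ m_X(Q)} |f(α; X)| ≪ A(X) Q^{-ϱ} L(X)` uniformly for `1 ≤ Q ≤ QW(X)`. -/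
def WeylHyp (a : ℕ → ℝ) (k : ℕ) (ϱ : ℝ) (QW L : ℝ → ℝ) : Prop :=
  (∀ ε : ℝ, 0 < ε → L =O[atTop] (fun X : ℝ => X ^ ε)) ∧
  ∃ C : ℝ, ∀ᶠ X : ℝ in atTop, ∀ Q : ℝ, 1 ≤ Q → Q ≤ QW X → ∀ α ∈ minorArcs k X Q,
    ‖expSum a k α X‖ ≤ C * (count a X * Q ^ (-ϱ) * L X)

/-- `Y(X) = min {QD(X), QW(X), (A(X)/E(X))^{1/5}, X^{1/5}}`. -/
def levelY (a : ℕ → ℝ) (QD QW E : ℝ → ℝ) (X : ℝ) : ℝ :=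
  min (min (QD X) (QW X)) (min ((count a X / E X) ^ (1 / 5 : ℝ)) (X ^ (1 / 5 : ℝ)))

/-- The complete sum `S(q, b) = ∑_{ℓ mod q} κ(q, ℓ) e(b ℓ^k / q)`. -/
def completeSum (κ : (q : ℕ) → ZMod q → ℝ) (k q b : ℕ) : ℂ :=
  ∑ l ∈ Finset.range q, (κ q (l : ZMod q) : ℂ) * e ((b : ℝ) * (l : ℝ) ^ k / q)

/-- The reduced residues `b` modulo `q`, represented in `1, …, q` (no residue for `q = 0`). -/
def reducedResidues (q : ℕ) : Finset ℕ := (Finset.Icc 1 q).filter (fun b => Nat.Coprime b q)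

/-- The singular series `∑_{q ≥ 1} ∑_{(b, q) = 1} S(q, b)^s e(-bn/q)`. -/
def singularSeries (κ : (q : ℕ) → ZMod q → ℝ) (k s n : ℕ) : ℂ :=
  ∑' q : ℕ, ∑ b ∈ reducedResidues q, completeSum κ k q b ^ s * e (-((b : ℝ) * n / q))

/-- `w_X(γ) = ∫_0^1 e(γ z^k) dσ_X(z)`, where `σ_X` is the image on `[0, 1]` of the measure
`dΨ / Ψ(X)` on `[0, X]` under `ξ ↦ ξ / X`. -/
def realIntegral (Ψ : ℝ → ℝ) (k : ℕ) (X γ : ℝ) : ℂ :=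
  (∫ ξ in (0 : ℝ)..X, ((deriv Ψ ξ : ℝ) : ℂ) * e (γ * (ξ / X) ^ k)) / (Ψ X : ℂ)

/-- The integrand of the singular integral, with `X = n^{1/k}`. -/
def singularIntegrand (Ψ : ℝ → ℝ) (k s n : ℕ) (γ : ℝ) : ℂ :=
  realIntegral Ψ k ((n : ℝ) ^ (1 / k : ℝ)) γ ^ s * e (-γ)

/-- The singular integral `∫_ℝ w_X(γ)^s e(-γ) dγ`, with `X = n^{1/k}`. -/
def singularIntegral (Ψ : ℝ → ℝ) (k s n : ℕ) : ℂ :=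
  ∫ γ : ℝ, singularIntegrand Ψ k s n γ

/-- `Ψ` is a continuously differentiable non-decreasing function with `Ψ(0) = 0` that
approximates `A` up to a bounded error. -/
def Approximates (Ψ : ℝ → ℝ) (a : ℕ → ℝ) : Prop :=
  ContDiff ℝ 1 Ψ ∧ Monotone Ψ ∧ Ψ 0 = 0 ∧
    (fun X : ℝ => Ψ X - count a X) =O[atTop] (fun _ : ℝ => (1 : ℝ))

/-- The expected main term without its constant, `A(n^{1/k})^s n^{-1}`. -/
def mainScale (a : ℕ → ℝ) (k s n : ℕ) : ℝ := count a ((n : ℝ) ^ (1 / k : ℝ)) ^ s / n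

/-- The asymptotic formula `R_s(n) = A(n^{1/k})^s n^{-1} (C(n) + o(1))` as `n → ∞`, where
`C(n) ≥ 0` is the product of the singular series and the singular integral, both of which
converge absolutely. -/
def AsymptoticFormula (a : ℕ → ℝ) (κ : (q : ℕ) → ZMod q → ℝ) (Ψ : ℝ → ℝ) (k s : ℕ) : Prop :=
  Summable (fun q : ℕ => ∑ b ∈ reducedResidues q, ‖completeSum κ k q b‖ ^ s) ∧
  (∀ n : ℕ, 1 ≤ n → MeasureTheory.Integrable (singularIntegrand Ψ k s n)) ∧
  ∃ C : ℕ → ℝ,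
    (∀ n : ℕ, 1 ≤ n →
      0 ≤ C n ∧ (C n : ℂ) = singularSeries κ k s n * singularIntegral Ψ k s n) ∧
    (fun n : ℕ => repCount a k s n - mainScale a k s n * C n) =o[atTop]
      (fun n : ℕ => mainScale a k s n)

end ThinWaring

end

noncomputable section

namespace ThinWaring

open MeasureTheory

/-! ### The additive character -/

/-! The circle method is run with Y = A(X)^{1/5} as the level of the major arcs. On the minor arcs
|f|^s = |f|^{s-2t₀}|f|^{2t₀}; the Weyl bound and the mean value together give A^{s+ω+ε} X^{-k}
Y^{-ϱ(s-2t₀)}, which is a power of A below the main term exactly when s > 2t₀ + 5ω/ϱ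
(`exists_minor_saving`). Convergence of the singular series and of the singular integral is
extracted from this same kind of minor arc bound.

The Weyl bound at fractions of large prime denominator forces some κ(p, ·) ≤ 1/2, and then O(1)
discrepancies force the weights to be bounded (`exists_bound_coeff`). Hence A(X) ≪ X, the
discrepancy is O(1) for every modulus, and f(b/q + β) = S(q,b) f(β) + O(q(1 + |β| X^k)).

Singular series. For m < q ≤ 2m take N with A(N) of size m². Near b/q one has |f| ≥ |S(q,b)| A/2 -
O(m), and these short disjoint neighbourhoods lie on the minor arcs of level m. The minor arc moment
therefore bounds the sum of |S(q,b)|^s over the dyadic block by a negative power of m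
(`exists_dyadic_bound`).

The function Ψ. The mass a_m at the point m^k is spread out into a Gamma distribution of mean m^k,
whose Fourier transform is ζ^{m^k} with ζ = 1/(1 - 2πiβ). As k ≥ 2, its standard deviation m^{k/2}
does not exceed the order of the spacing of k-th powers, so truncation at X disturbs only O(1) of
the mass, and the transform of dΨ on [0, X] is F(ζ) + O(|ζ|) with F(z) = ∑ a_m z^{m^k}
(`exists_norm_smoothTransform_sub_le`).

Singular integral. The point ζ runs over a circle inside the unit disc, tangent to it at 1.
Poisson's formula makes F(ζ) an average of f(y) = F(e(y)). If |β| is at least 3Y/X^k, the kernel is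
at most 4Y² on the major arcs, which are short; on the minor arcs Jensen's inequality moves the s-th
power inside, and the integral of the kernel over β in [-1, 1] is at most 6 for each fixed y. So the
tail of the singular integral is controlled by the s-th moment of f on the minor arcs
(`setIntegral_norm_powerSum_le`, `exists_tail_saving`).

On the major arcs f is replaced by S(q,b) times the transform of dΨ. Completing the sum and the
integral costs a gap near fractions with q ≤ A^{1/3}, which again lies on the minor arcs, and two
tails already bounded. Both singular factors are non-negative: the series is a limit of normalised
counts of congruence solutions, and the integral is a Fourier inversion of a non-negative measure,
taken with Gaussian damping. -/

theorem e_zero : e 0 = 1 := by simp [e]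

theorem e_add (x y : ℝ) : e (x + y) = e x * e y := by
  simp only [e, ← Complex.exp_add]; push_cast; ring_nf

theorem norm_e (x : ℝ) : ‖e x‖ = 1 := by
  have : e x = Complex.exp ((2 * Real.pi * x : ℝ) * Complex.I) := by
    simp only [e]; push_cast; ring_nf
  rw [this, Complex.norm_exp_ofReal_mul_I]

theorem e_int (m : ℤ) : e m = 1 := by
  have : e m = Complex.exp (m * (2 * Real.pi * Complex.I)) := by
    simp only [e]; push_cast; ring_nf
  rw [this, Complex.exp_int_mul_two_pi_mul_I]

theorem e_natCast (m : ℕ) : e m = 1 := by simpa using e_int m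

theorem e_nat_mul (m : ℕ) (x : ℝ) : e (m * x) = e x ^ m := by
  simp only [e, ← Complex.exp_nat_mul]; push_cast; ring_nf

theorem e_neg (x : ℝ) : e (-x) = (starRingEnd ℂ) (e x) := by
  simp only [e, ← Complex.exp_conj]
  simp [Complex.conj_ofNat]

theorem e_sum {ι : Type*} (t : Finset ι) (x : ι → ℝ) : e (∑ i ∈ t, x i) = ∏ i ∈ t, e (x i) := by
  simp only [e, ← Complex.exp_sum]
  push_cast
  rw [Finset.mul_sum]

theorem continuous_e : Continuous e := by
  unfold e; fun_prop

theorem norm_e_sub_one_le (x : ℝ) : ‖e x - 1‖ ≤ 2 * Real.pi * |x| := by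
  have : e x = Complex.exp (Complex.I * (2 * Real.pi * x : ℝ)) := by
    simp only [e]; push_cast; ring_nf
  rw [this]
  refine (Real.norm_exp_I_mul_ofReal_sub_one_le).trans ?_
  rw [Real.norm_eq_abs, abs_mul, abs_of_pos (by positivity)]

theorem norm_e_sub_e_le (x y : ℝ) : ‖e x - e y‖ ≤ 2 * Real.pi * |x - y| := by
  have h : e x - e y = e y * (e (x - y) - 1) := by
    rw [mul_sub, ← e_add]; simp
  rw [h, norm_mul, norm_e, one_mul]
  exact norm_e_sub_one_le _

theorem e_eq_of_sub_int {x y : ℝ} (m : ℤ) (h : x - y = m) : e x = e y := by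
  have : x = y + m := by linarith
  rw [this, e_add, e_int, mul_one]

theorem integral_e_int (m : ℤ) : ∫ α in (0 : ℝ)..1, e (m * α) = if m = 0 then 1 else 0 := by
  split_ifs with h
  · simp [h, e_zero]
  · have h1 : ∀ α : ℝ, e (m * α) = Complex.exp ((2 * Real.pi * Complex.I * m) * α) := by
      intro α; simp only [e]; push_cast; ring_nf
    simp only [h1]
    have hc : (2 * Real.pi * Complex.I * m : ℂ) ≠ 0 := by
      simp [h, Real.pi_ne_zero]
    rw [integral_exp_mul_complex hc]
    have : Complex.exp ((2 * Real.pi * Complex.I * m) * ((1 : ℝ) : ℂ)) = 1 := by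
      have := e_int m
      simp only [e] at this
      simpa using this
    rw [this]; simp

/-! ### The counting function and the exponential sum -/

section Basic
variable {a : ℕ → ℝ} {k : ℕ}

theorem count_nonneg (ha : ∀ n, 0 ≤ a n) (X : ℝ) : 0 ≤ count a X :=
  Finset.sum_nonneg fun n _ => ha n

theorem count_mono (ha : ∀ n, 0 ≤ a n) : Monotone (count a) := fun _ _ h =>
  Finset.sum_le_sum_of_subset_of_nonneg
    (Finset.Icc_subset_Icc le_rfl (Nat.floor_mono h)) fun n _ _ => ha n

theorem count_succ (n : ℕ) : count a ((n + 1 : ℕ) : ℝ) = count a n + a (n + 1) := by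
  simp only [count, Nat.floor_natCast]
  rw [Finset.sum_Icc_succ_top (by omega)]

theorem countMod_nonneg (ha : ∀ n, 0 ≤ a n) (q : ℕ) (b : ZMod q) (X : ℝ) :
    0 ≤ countMod a q b X := Finset.sum_nonneg fun n _ => ha n

theorem countMod_mono (ha : ∀ n, 0 ≤ a n) (q : ℕ) (b : ZMod q) : Monotone (countMod a q b) := by
  intro X Y h
  apply Finset.sum_le_sum_of_subset_of_nonneg _ fun n _ _ => ha n
  exact Finset.filter_subset_filter _ (Finset.Icc_subset_Icc le_rfl (Nat.floor_mono h))

theorem countMod_le_count (ha : ∀ n, 0 ≤ a n) (q : ℕ) (b : ZMod q) (X : ℝ) :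
    countMod a q b X ≤ count a X :=
  Finset.sum_le_sum_of_subset_of_nonneg (Finset.filter_subset _ _) fun n _ _ => ha n

theorem norm_expSum_le (ha : ∀ n, 0 ≤ a n) (α X : ℝ) : ‖expSum a k α X‖ ≤ count a X := by
  refine (norm_sum_le _ _).trans (Finset.sum_le_sum fun n _ => ?_)
  rw [norm_mul, norm_e, mul_one, Complex.norm_real, Real.norm_of_nonneg (ha n)]

theorem continuous_expSum (X : ℝ) : Continuous fun α => expSum a k α X := by
  unfold expSum
  exact continuous_finsetSum _ fun n _ => continuous_const.mul (continuous_e.comp (by fun_prop))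

theorem expSum_add_int (α X : ℝ) (m : ℤ) : expSum a k (α + m) X = expSum a k α X := by
  refine Finset.sum_congr rfl fun n _ => ?_
  congr 1
  exact e_eq_of_sub_int (m * (n : ℤ) ^ k) (by push_cast; ring)

theorem periodic_expSum (X : ℝ) : Function.Periodic (fun α => expSum a k α X) 1 := fun α => by
  simpa using expSum_add_int (a := a) (k := k) α X 1

theorem expSum_zero (X : ℝ) : expSum a k 0 X = count a X := by
  simp [expSum, count, e_zero]

theorem norm_expSum_sub_count_le (ha : ∀ n, 0 ≤ a n) (β : ℝ) {X : ℝ} (hX : 0 ≤ X) :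
    ‖expSum a k β X - count a X‖ ≤ count a X * (2 * Real.pi * (|β| * X ^ k)) := by
  rw [← expSum_zero (k := k)]
  simp only [expSum, ← Finset.sum_sub_distrib, ← mul_sub]
  refine (norm_sum_le _ _).trans ?_
  rw [count, Finset.sum_mul]
  refine Finset.sum_le_sum fun n hn => ?_
  have hn' : (n : ℝ) ≤ X := (Nat.le_floor_iff hX).1 (Finset.mem_Icc.1 hn).2
  rw [norm_mul, Complex.norm_real, Real.norm_of_nonneg (ha n)]
  refine mul_le_mul_of_nonneg_left ((norm_e_sub_e_le _ _).trans ?_) (ha n)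
  rw [zero_mul, sub_zero, abs_mul, abs_of_nonneg (by positivity : (0 : ℝ) ≤ (n : ℝ) ^ k)]
  gcongr

theorem expSum_pow (s : ℕ) (α X : ℝ) : expSum a k α X ^ s =
    ∑ x ∈ Fintype.piFinset (fun _ : Fin s => Finset.Icc 1 ⌊X⌋₊),
      ((∏ i, a (x i) : ℝ) : ℂ) * e (α * ((∑ i, x i ^ k : ℕ) : ℝ)) := by
  rw [expSum, Finset.sum_pow']
  refine Finset.sum_congr rfl fun x _ => ?_
  rw [Finset.prod_mul_distrib, Complex.ofReal_prod, ← e_sum]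
  congr 2
  push_cast
  rw [Finset.mul_sum]

/-- The coefficients of a power of the exponential sum. -/
theorem integral_expSum_pow (s n : ℕ) (X : ℝ) :
    ∫ α in (0 : ℝ)..1, expSum a k α X ^ s * e (-(α * n)) =
    ((∑ x ∈ (Fintype.piFinset (fun _ : Fin s => Finset.Icc 1 ⌊X⌋₊)).filter
      (fun x => ∑ i, x i ^ k = n), ∏ i, a (x i) : ℝ) : ℂ) := by
  simp only [expSum_pow, Finset.sum_mul, mul_assoc, ← e_add]
  rw [intervalIntegral.integral_finsetSum]
  · rw [Finset.sum_filter, Complex.ofReal_sum]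
    refine Finset.sum_congr rfl fun x _ => ?_
    rw [intervalIntegral.integral_const_mul]
    have h : ∀ α : ℝ, e (α * ((∑ i, x i ^ k : ℕ) : ℝ) + -(α * n)) =
        e ((((∑ i, x i ^ k : ℕ) : ℤ) - n : ℤ) * α) := by
      intro α; congr 1; push_cast; ring
    simp only [h, integral_e_int, sub_eq_zero, Nat.cast_inj]
    split_ifs <;> simp
  · intro x _
    exact (continuous_const.mul (continuous_e.comp (by fun_prop))).intervalIntegrable _ _

theorem repCount_eq_integral (hk : k ≠ 0) (s n : ℕ) :
    (repCount a k s n : ℂ) =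
    ∫ α in (0 : ℝ)..1, expSum a k α ((n : ℝ) ^ (1 / k : ℝ)) ^ s * e (-(α * n)) := by
  rw [integral_expSum_pow, repCount]
  congr 1
  -- The two boxes differ (x_i ≤ n and x_i ≤ n^{1/k}), but on solutions both constraints are
  -- automatic, since each x_i^k is at most n.
  have key : ∀ m : ℕ, m ^ k ≤ n ↔ m ≤ ⌊(n : ℝ) ^ (1 / k : ℝ)⌋₊ := by
    intro m
    rw [Nat.le_floor_iff (by positivity), ← Nat.cast_le (α := ℝ), Nat.cast_pow]
    have hk0 : (0 : ℝ) < k := by positivity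
    rw [one_div, Real.le_rpow_inv_iff_of_pos (by positivity) (by positivity) hk0, Real.rpow_natCast]
  refine Finset.sum_congr ?_ fun _ _ => rfl
  ext x
  simp only [Finset.mem_filter, Fintype.mem_piFinset, Finset.mem_Icc]
  refine and_congr_left fun hx => forall_congr' fun i => and_congr_right fun _ => ?_
  rw [← key]
  have hle : x i ^ k ≤ n := by
    rw [← hx]; exact Finset.single_le_sum (f := fun i => x i ^ k) (fun _ _ => Nat.zero_le _) (Finset.mem_univ i)
  exact ⟨fun _ => hle, fun _ => (Nat.le_self_pow hk _).trans hle⟩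

/-- A weight is a Fourier coefficient of f, so it is bounded by the first moment. This gives a lower
bound for moments that does not decay with X. -/
theorem coeff_le_integral_norm (hk : k ≠ 0) {X : ℝ} {m : ℕ} (hm : m ∈ Finset.Icc 1 ⌊X⌋₊) :
    a m ≤ ∫ α in (0 : ℝ)..1, ‖expSum a k α X‖ := by
  have h := integral_expSum_pow (a := a) (k := k) 1 (m ^ k) X
  have h2 : (∑ x ∈ (Fintype.piFinset (fun _ : Fin 1 => Finset.Icc 1 ⌊X⌋₊)).filter
      (fun x => ∑ i, x i ^ k = m ^ k), ∏ i, a (x i)) = a m := by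
    have : (Fintype.piFinset (fun _ : Fin 1 => Finset.Icc 1 ⌊X⌋₊)).filter
      (fun x => ∑ i, x i ^ k = m ^ k) = {fun _ => m} := by
      ext x
      simp only [Finset.mem_filter, Fintype.mem_piFinset, Finset.mem_singleton,
        Finset.univ_unique, Finset.sum_singleton]
      constructor
      · rintro ⟨_, h⟩
        funext i
        rw [Subsingleton.elim i default]
        exact Nat.pow_left_injective hk h
      · rintro rfl
        exact ⟨fun _ => hm, rfl⟩
    rw [this]; simp
  rw [h2] at h
  calc a m ≤ ‖((a m : ℝ) : ℂ)‖ := by rw [Complex.norm_real]; exact le_abs_self _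
    _ ≤ ∫ α in (0 : ℝ)..1, ‖expSum a k α X ^ 1 * e (-(α * ((m ^ k : ℕ) : ℝ)))‖ := by
        rw [← h]; exact intervalIntegral.norm_integral_le_integral_norm zero_le_one
    _ = _ := by simp [norm_e]

theorem integral_norm_sq_expSum (hk : k ≠ 0) (X : ℝ) :
    ∫ α in (0 : ℝ)..1, ‖expSum a k α X‖ ^ 2 = ∑ n ∈ Finset.Icc 1 ⌊X⌋₊, a n ^ 2 := by
  have h1 : ∀ α : ℝ, ((‖expSum a k α X‖ ^ 2 : ℝ) : ℂ) =
      ∑ x ∈ Finset.Icc 1 ⌊X⌋₊, ∑ y ∈ Finset.Icc 1 ⌊X⌋₊, ((a x * a y : ℝ) : ℂ) *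
        e ((((x : ℤ) ^ k - (y : ℤ) ^ k : ℤ) : ℝ) * α) := by
    intro α
    rw [Complex.ofReal_pow, ← Complex.mul_conj', expSum, map_sum, Finset.sum_mul_sum]
    refine Finset.sum_congr rfl fun x _ => Finset.sum_congr rfl fun y _ => ?_
    rw [map_mul, ← e_neg, Complex.conj_ofReal]
    have : e ((((x : ℤ) ^ k - (y : ℤ) ^ k : ℤ) : ℝ) * α) = e (α * x ^ k) * e (-(α * y ^ k)) := by
      rw [← e_add]; congr 1; push_cast; ring
    rw [this]; push_cast; ring
  have hint : ∀ x y : ℕ, IntervalIntegrable (fun α : ℝ => ((a x * a y : ℝ) : ℂ) *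
        e ((((x : ℤ) ^ k - (y : ℤ) ^ k : ℤ) : ℝ) * α)) volume 0 1 := fun x y =>
    (continuous_const.mul (continuous_e.comp (by fun_prop))).intervalIntegrable _ _
  apply Complex.ofReal_injective
  rw [← intervalIntegral.integral_ofReal]
  simp only [h1]
  rw [intervalIntegral.integral_finsetSum, Complex.ofReal_sum]
  swap
  · intro x _
    exact (continuous_finsetSum _ fun y _ =>
      continuous_const.mul (continuous_e.comp (by fun_prop))).intervalIntegrable _ _
  refine Finset.sum_congr rfl fun x hx => ?_
  rw [intervalIntegral.integral_finsetSum (fun y _ => hint x y), Finset.sum_eq_single x]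
  · rw [intervalIntegral.integral_const_mul, integral_e_int]; simp [sq]
  · intro y _ hyx
    rw [intervalIntegral.integral_const_mul, integral_e_int, if_neg, mul_zero]
    rw [sub_eq_zero]
    intro h
    exact hyx (Nat.pow_left_injective hk (by exact_mod_cast h.symm))
  · exact fun h => absurd hx h

/-- Cauchy–Schwarz over the at most X integers, then Parseval. It limits how much any minor arc
bound can save. -/
theorem sq_count_le_mul_integral (hk : k ≠ 0) {X : ℝ} (hX : 0 ≤ X) :
    count a X ^ 2 ≤ X * ∫ α in (0 : ℝ)..1, ‖expSum a k α X‖ ^ 2 := by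
  rw [integral_norm_sq_expSum hk, count]
  refine (sq_sum_le_card_mul_sum_sq).trans ?_
  refine mul_le_mul_of_nonneg_right ?_ (Finset.sum_nonneg fun n _ => sq_nonneg (a n))
  simpa using Nat.floor_le hX

end Basic

/-! ### Geometry of the major arcs -/

section Arcs
variable {k : ℕ} {X Q : ℝ}

theorem mem_majorArcs_iff {α : ℝ} : α ∈ majorArcs k X Q ↔
    ∃ q : ℕ, 1 ≤ q ∧ (q : ℝ) ≤ Q ∧ ∃ b : ℤ, |α * q - b| ≤ Q / X ^ k := by
  constructor
  · rintro ⟨q, h1, h2, h3⟩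
    exact ⟨q, h1, h2, _, h3⟩
  · rintro ⟨q, h1, h2, b, h3⟩
    exact ⟨q, h1, h2, (round_le _ b).trans h3⟩

theorem exists_coprime_of_mem_majorArcs {α : ℝ} (h : α ∈ majorArcs k X Q) :
    ∃ q : ℕ, 1 ≤ q ∧ (q : ℝ) ≤ Q ∧ ∃ b : ℤ, IsCoprime b (q : ℤ) ∧
      q * |α - b / q| ≤ Q / X ^ k := by
  obtain ⟨q, h1, h2, b, h3⟩ := mem_majorArcs_iff.1 h
  have hg : Int.gcd b q ≠ 0 := by
    rw [Ne, Int.gcd_eq_zero_iff]; omega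
  obtain ⟨g, hgpos, hg0⟩ : ∃ g : ℕ, 0 < g ∧ g = Int.gcd b q := ⟨_, Nat.pos_of_ne_zero hg, rfl⟩
  obtain ⟨b', hb'⟩ : (g : ℤ) ∣ b := hg0 ▸ Int.gcd_dvd_left ..
  obtain ⟨q', hq'⟩ : g ∣ q := by
    have : (g : ℤ) ∣ (q : ℤ) := hg0 ▸ Int.gcd_dvd_right ..
    exact_mod_cast this
  have hq'1 : 1 ≤ q' := by
    rcases Nat.eq_zero_or_pos q' with h | h
    · subst h; omega
    · exact h
  have hgR : (1 : ℝ) ≤ g := by exact_mod_cast hgpos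
  have hq'R : (1 : ℝ) ≤ q' := by exact_mod_cast hq'1
  have hqR : (q : ℝ) = g * q' := by exact_mod_cast hq'
  have hbR : (b : ℝ) = g * b' := by exact_mod_cast hb'
  refine ⟨q', hq'1, ?_, b', ?_, ?_⟩
  · rw [hqR] at h2; nlinarith
  · rw [Int.isCoprime_iff_gcd_eq_one]
    have : (g : ℤ) = Int.gcd (g * b') (g * q') := by
      have hq'' : (q : ℤ) = g * q' := by exact_mod_cast hq'
      rw [← hb', ← hq'', ← hg0]
    rw [Int.gcd_mul_left] at this
    have h5 : g = g * Int.gcd b' q' := by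
      have := this; simp at this; exact_mod_cast this
    exact Nat.eq_of_mul_eq_mul_left hgpos (by rw [← h5, mul_one])
  · have h4 : |α * q - b| = g * (q' * |α - b' / q'|) := by
      have : α * q - b = g * (q' * (α - b' / q')) := by
        rw [hqR, hbR]; field_simp
      rw [this, abs_mul, abs_mul, abs_of_pos (by linarith : (0 : ℝ) < g),
        abs_of_pos (by linarith : (0 : ℝ) < q')]
    rw [h4] at h3
    refine le_trans ?_ h3
    exact le_mul_of_one_le_left (by positivity) hgR

theorem measurableSet_majorArcs : MeasurableSet (majorArcs k X Q) := by
  have : majorArcs k X Q = ⋃ q ∈ {q : ℕ | 1 ≤ q ∧ (q : ℝ) ≤ Q},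
      {α : ℝ | |α * q - (round (α * q) : ℝ)| ≤ Q / X ^ k} := by
    ext α; simp [majorArcs, and_assoc]
  rw [this]
  refine MeasurableSet.biUnion (Set.to_countable _) fun q _ => ?_
  apply measurableSet_le _ measurable_const
  simp only [round_eq]
  have : Measurable fun α : ℝ => ((⌊α * q + 1 / 2⌋ : ℤ) : ℝ) :=
    measurable_from_top.comp (Int.measurable_floor.comp (by fun_prop))
  exact ((by fun_prop : Measurable fun α : ℝ => α * q).sub this).norm

theorem measurableSet_minorArcs : MeasurableSet (minorArcs k X Q) :=
  measurableSet_majorArcs.compl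

theorem volume_majorArcs_inter_le (hX : 0 < X) (hQ : 0 ≤ Q) :
    volume.real (majorArcs k X Q ∩ Set.Ioc 0 1) ≤ 4 * Q ^ 2 / X ^ k := by
  set δ := Q / X ^ k with hδ
  have hδ0 : 0 ≤ δ := by positivity
  have e1 : 4 * Q ^ 2 / X ^ k = Q * (4 * δ) := by rw [hδ]; ring
  rw [e1]
  rcases lt_or_ge Q 1 with hQ1 | hQ1
  · have : majorArcs k X Q = ∅ := by
      ext α; simp only [majorArcs, Set.mem_ofPred_eq, Set.mem_empty_iff_false, iff_false]
      rintro ⟨q, h1, h2, _⟩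
      have : (1 : ℝ) ≤ q := by exact_mod_cast h1
      linarith
    rw [this]; simp; positivity
  -- For δ ≥ 1/2 the bound exceeds the length of the period; for δ < 1/2 the nearest integer to αq
  -- is confined to 0, …, q, so each q costs q + 1 intervals of length 2δ/q.
  rcases le_or_gt (1 / 2) δ with h | h
  · have : volume.real (majorArcs k X Q ∩ Set.Ioc 0 1) ≤ volume.real (Set.Ioc (0 : ℝ) 1) :=
      measureReal_mono Set.inter_subset_right (by simp)
    simp at this
    nlinarith
  have hsub : majorArcs k X Q ∩ Set.Ioc 0 1 ⊆ ⋃ q ∈ Finset.Icc 1 ⌊Q⌋₊, ⋃ b ∈ Finset.range (q + 1),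
      Set.Icc ((b - δ) / q : ℝ) ((b + δ) / q) := by
    rintro α ⟨hα, h0, h1⟩
    obtain ⟨q, hq1, hqQ, b, hb⟩ := mem_majorArcs_iff.1 hα
    rw [abs_le] at hb
    have hq : (1 : ℝ) ≤ q := by exact_mod_cast hq1
    have hb0 : (0 : ℤ) ≤ b := by
      have : (-1 : ℝ) < b := by nlinarith
      have : (-1 : ℤ) < b := by exact_mod_cast this
      omega
    have hb1 : b ≤ q := by
      have : (b : ℝ) < q + 1 := by nlinarith
      have : b < q + 1 := by exact_mod_cast this
      omega
    lift b to ℕ using hb0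
    simp only [Set.mem_iUnion, Finset.mem_Icc, Finset.mem_range, Set.mem_Icc]
    refine ⟨q, ⟨hq1, Nat.le_floor hqQ⟩, b, by omega, ?_, ?_⟩
    · rw [div_le_iff₀ (by linarith)]
      have := hb.1; push_cast at this; linarith
    · rw [le_div_iff₀ (by linarith)]
      have := hb.2; push_cast at this; linarith
  have hmeas : ∀ q ∈ Finset.Icc 1 ⌊Q⌋₊, volume.real (⋃ b ∈ Finset.range (q + 1),
      Set.Icc ((b - δ) / q : ℝ) ((b + δ) / q)) ≤ 4 * δ := by
    intro q hq
    have hq1 : (1 : ℝ) ≤ q := by exact_mod_cast (Finset.mem_Icc.1 hq).1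
    refine (measureReal_biUnion_finset_le _ _).trans ?_
    have : ∀ b ∈ Finset.range (q + 1), volume.real (Set.Icc ((b - δ) / q : ℝ) ((b + δ) / q)) =
        2 * δ / q := by
      intro b _
      rw [Real.volume_real_Icc_of_le]
      · ring
      · gcongr; linarith
    rw [Finset.sum_congr rfl this]
    simp only [Finset.sum_const, Finset.card_range, nsmul_eq_mul]
    push_cast
    rw [mul_div_assoc', div_le_iff₀ (by linarith)]
    nlinarith
  refine (measureReal_mono hsub ?_).trans ?_
  · refine (measure_biUnion_lt_top (Finset.finite_toSet _) fun q _ =>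
      measure_biUnion_lt_top (Finset.finite_toSet _) fun b _ => ?_).ne
    simp
  refine (measureReal_biUnion_finset_le _ _).trans ((Finset.sum_le_sum hmeas).trans ?_)
  simp only [Finset.sum_const, nsmul_eq_mul, Nat.card_Icc, Nat.add_sub_cancel]
  have := Nat.floor_le hQ
  gcongr

theorem eq_of_coprime_div_eq {q q' : ℕ} {b b' : ℤ} (hq : 1 ≤ q) (hq' : 1 ≤ q')
    (h : IsCoprime b (q : ℤ)) (h' : IsCoprime b' (q' : ℤ)) (he : (b : ℝ) / q = b' / q') :
    q = q' ∧ b = b' := by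
  have hqR : (q : ℝ) ≠ 0 := by positivity
  have hqR' : (q' : ℝ) ≠ 0 := by positivity
  rw [div_eq_div_iff hqR hqR'] at he
  have he' : b * q' = b' * q := by exact_mod_cast he
  have h1 : (q : ℤ) ∣ q' := h.symm.dvd_of_dvd_mul_left (he' ▸ Dvd.intro_left _ rfl)
  have h2 : (q' : ℤ) ∣ q := h'.symm.dvd_of_dvd_mul_left (he' ▸ Dvd.intro_left _ rfl)
  have h3 : q = q' := Nat.dvd_antisymm (by exact_mod_cast h1) (by exact_mod_cast h2)
  subst h3
  refine ⟨rfl, mul_right_cancel₀ (b := (q : ℤ)) (by omega) he'⟩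

theorem inv_mul_le_abs_div_sub_div {q q' : ℕ} {b b' : ℤ} (hq : 1 ≤ q) (hq' : 1 ≤ q')
    (hne : (b : ℝ) / q ≠ b' / q') : 1 / ((q : ℝ) * q') ≤ |(b : ℝ) / q - b' / q'| := by
  have hqR : (0 : ℝ) < q := by positivity
  have hqR' : (0 : ℝ) < q' := by positivity
  rw [div_sub_div _ _ hqR.ne' hqR'.ne', abs_div, abs_of_pos (by positivity : (0 : ℝ) < q * q')]
  gcongr
  have : b * q' - q * b' ≠ 0 := by
    intro h
    apply hne
    rw [div_eq_div_iff hqR.ne' hqR'.ne']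
    have : (b : ℝ) * q' - q * b' = 0 := by exact_mod_cast h
    linarith
  have := Int.one_le_abs this
  exact_mod_cast this

/-- A point close to a reduced fraction that does not certify a major arc lies on the minor arcs. -/
theorem mem_minorArcs_of_near {q : ℕ} {b : ℤ} (hq : 1 ≤ q) (hb : IsCoprime b (q : ℤ)) {β r : ℝ}
    (hQ : 0 ≤ Q) (hX : 0 < X) (hβ : |β| ≤ r) (hfar : Q < q ∨ Q / X ^ k < q * |β|)
    (hsmall : (r + Q / X ^ k) * q * Q < 1) : (b : ℝ) / q + β ∈ minorArcs k X Q := by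
  intro hM
  obtain ⟨q', hq', hq'Q, b', hb', h⟩ := exists_coprime_of_mem_majorArcs hM
  have hqR : (0 : ℝ) < q := by positivity
  have hqR' : (1 : ℝ) ≤ q' := by exact_mod_cast hq'
  -- A second reduced fraction certifying a major arc is either b/q itself, which the farness
  -- hypothesis forbids, or a different one, which is at least 1/(qq') away and so too far.
  by_cases he : (b : ℝ) / q = b' / q'
  · obtain ⟨h1, h2⟩ := eq_of_coprime_div_eq hq hq' hb hb' he
    subst h1 h2
    rw [add_sub_cancel_left] at h
    rcases hfar with hf | hf <;> linarith
  · have h1 := inv_mul_le_abs_div_sub_div hq hq' he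
    have hρ : 0 ≤ Q / X ^ k := by positivity
    have h2 : |(b : ℝ) / q + β - b' / q'| ≤ Q / X ^ k := by
      nlinarith [abs_nonneg ((b : ℝ) / q + β - b' / q')]
    have h3 : |(b : ℝ) / q - b' / q'| ≤ r + Q / X ^ k := by
      have : (b : ℝ) / q - b' / q' = ((b : ℝ) / q + β - b' / q') - β := by ring
      rw [this]
      exact (abs_sub _ _).trans (by linarith)
    have h4 := h1.trans h3
    rw [div_le_iff₀ (by positivity)] at h4
    have h5 : (r + Q / X ^ k) * (q * q') ≤ (r + Q / X ^ k) * q * Q := by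
      rw [mul_assoc]
      have : 0 ≤ r := (abs_nonneg β).trans hβ
      gcongr
    linarith

/-- The reduced fractions `b / q` with `q ∈ t`, `1 ≤ b ≤ q`. -/
def fractions (t : Finset ℕ) : Finset (Σ _ : ℕ, ℕ) := t.sigma reducedResidues

theorem mem_fractions {t : Finset ℕ} {x : Σ _ : ℕ, ℕ} :
    x ∈ fractions t ↔ x.1 ∈ t ∧ 1 ≤ x.2 ∧ x.2 ≤ x.1 ∧ IsCoprime (x.2 : ℤ) (x.1 : ℤ) := by
  rw [fractions, Finset.mem_sigma, reducedResidues, Finset.mem_filter, Finset.mem_Icc,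
    Nat.isCoprime_iff_coprime]
  tauto

theorem card_reducedResidues_le (q : ℕ) : (reducedResidues q).card ≤ q :=
  (Finset.card_filter_le _ _).trans (by simp)

/-- The point of the real line given by a fraction. -/
def fracPt (x : Σ _ : ℕ, ℕ) : ℝ := (x.2 : ℝ) / x.1

theorem abs_fracPt_sub_ge {t : Finset ℕ} {x y : Σ _ : ℕ, ℕ} (hx : x ∈ fractions t)
    (hy : y ∈ fractions t) (hxy : x ≠ y) {N : ℝ} (hN : ∀ q ∈ t, (q : ℝ) ≤ N) :
    1 / N ^ 2 ≤ |fracPt x - fracPt y| := by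
  rw [mem_fractions] at hx hy
  have hx1 : 1 ≤ x.1 := by omega
  have hy1 : 1 ≤ y.1 := by omega
  have hne : ((x.2 : ℤ) : ℝ) / x.1 ≠ ((y.2 : ℤ) : ℝ) / y.1 := by
    intro he
    obtain ⟨h1, h2⟩ := eq_of_coprime_div_eq hx1 hy1 hx.2.2.2 hy.2.2.2 he
    apply hxy
    obtain ⟨q, b⟩ := x
    obtain ⟨q', b'⟩ := y
    simp only at h1 h2
    subst h1
    have : b = b' := by exact_mod_cast h2
    rw [this]
  have := inv_mul_le_abs_div_sub_div hx1 hy1 hne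
  simp only [Int.cast_natCast] at this
  refine le_trans ?_ this
  have h1 := hN _ hx.1
  have h2 := hN _ hy.1
  have : (0 : ℝ) ≤ N := (Nat.cast_nonneg _).trans h1
  rw [sq]
  gcongr

theorem fracPt_bounds {t : Finset ℕ} {x : Σ _ : ℕ, ℕ} (hx : x ∈ fractions t) {N : ℝ}
    (hN : ∀ q ∈ t, (q : ℝ) ≤ N) :
    1 / N ≤ fracPt x ∧ fracPt x ≤ 1 := by
  rw [mem_fractions] at hx
  have hx1 : (1 : ℝ) ≤ x.1 := by exact_mod_cast (by omega : 1 ≤ x.1)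
  have hb1 : (1 : ℝ) ≤ x.2 := by exact_mod_cast hx.2.1
  have hb2 : (x.2 : ℝ) ≤ x.1 := by exact_mod_cast hx.2.2.1
  have := hN _ hx.1
  constructor
  · unfold fracPt; gcongr
  · unfold fracPt; rw [div_le_one (by linarith)]; exact hb2

/-- Integrals over disjoint arcs centred at distinct fractions add up. -/
theorem sum_setIntegral_arcs {E : Type*} [NormedAddCommGroup E] [NormedSpace ℝ E]
    {t : Finset ℕ} {N r : ℝ} (hN : ∀ q ∈ t, (q : ℝ) ≤ N)
    (hr : 2 * r * N ^ 2 < 1) {D : (Σ _ : ℕ, ℕ) → Set ℝ} (hD : ∀ x, MeasurableSet (D x))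
    (hDr : ∀ x ∈ fractions t, ∀ β ∈ D x, |β| ≤ r) {F : ℝ → E} (hF : Continuous F) :
    ∑ x ∈ fractions t, ∫ β in D x, F (fracPt x + β) =
      ∫ α in ⋃ x ∈ fractions t, (fun β => fracPt x + β) '' D x, F α := by
  rw [integral_biUnion_finset]
  · refine Finset.sum_congr rfl fun x _ => ?_
    rw [(measurePreserving_add_left volume (fracPt x)).setIntegral_image_emb
      (MeasurableEquiv.addLeft (fracPt x)).measurableEmbedding]
  · intro x _
    exact (MeasurableEquiv.addLeft (fracPt x)).measurableEmbedding.measurableSet_image.2 (hD x)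
  · intro x hx y hy hxy
    rw [Function.onFun, Set.disjoint_left]
    rintro _ ⟨β, hβ, rfl⟩ ⟨γ, hγ, h⟩
    simp only at h
    have h1 := abs_fracPt_sub_ge hx hy hxy hN
    have h2 : |fracPt x - fracPt y| ≤ 2 * r := by
      have : fracPt x - fracPt y = γ - β := by linarith
      rw [this]
      have := abs_sub γ β
      have := hDr x hx β hβ
      have := hDr y hy γ hγ
      linarith
    have hx' := hx
    rw [Finset.mem_coe, mem_fractions] at hx
    have hNpos : 0 < N := by
      have := hN _ hx.1
      have : (1 : ℝ) ≤ x.1 := by exact_mod_cast (by omega : 1 ≤ x.1)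
      linarith
    have h3 := h1.trans h2
    rw [div_le_iff₀ (by positivity)] at h3
    linarith
  · intro x hx
    have hb : (fun β => fracPt x + β) '' D x ⊆ Set.Icc (fracPt x - r) (fracPt x + r) := by
      rintro _ ⟨β, hβ, rfl⟩
      have := abs_le.1 (hDr x hx β hβ)
      simp only [Set.mem_Icc]
      constructor <;> linarith [this.1, this.2]
    exact (hF.continuousOn.integrableOn_compact isCompact_Icc).mono_set hb

theorem sum_setIntegral_arcs_le {t : Finset ℕ} {N r : ℝ} (hN : ∀ q ∈ t, (q : ℝ) ≤ N)
    (hr : 2 * r * N ^ 2 < 1) {D : (Σ _ : ℕ, ℕ) → Set ℝ} (hD : ∀ x, MeasurableSet (D x))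
    (hDr : ∀ x ∈ fractions t, ∀ β ∈ D x, |β| ≤ r) {F : ℝ → ℝ} (hF : Continuous F)
    (hF0 : ∀ α, 0 ≤ F α) {U : Set ℝ} (hU : IntegrableOn F U)
    (hDU : ∀ x ∈ fractions t, ∀ β ∈ D x, fracPt x + β ∈ U) :
    ∑ x ∈ fractions t, ∫ β in D x, F (fracPt x + β) ≤ ∫ α in U, F α := by
  rw [sum_setIntegral_arcs hN hr hD hDr hF]
  refine setIntegral_mono_set hU (ae_of_all _ hF0) ?_
  refine LE.le.eventuallyLE ?_
  intro α hα
  simp only [Set.mem_iUnion, Set.mem_image] at hα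
  obtain ⟨x, hx, β, hβ, rfl⟩ := hα
  exact hDU x hx β hβ

/-- Decomposition of the major arcs in a period. -/
theorem majorArcs_inter_Ioc {t : ℝ} (hX : 0 < X) (hQ : 0 ≤ Q) (ht : Q / X ^ k < t)
    (ht' : t * Q + Q / X ^ k < 1) :
    majorArcs k X Q ∩ Set.Ioc t (t + 1) = ⋃ x ∈ fractions (Finset.Icc 1 ⌊Q⌋₊),
      (fun β => fracPt x + β) '' {β | x.1 * |β| ≤ Q / X ^ k} := by
  have hρ : 0 ≤ Q / X ^ k := by positivity
  ext α
  simp only [Set.mem_inter_iff, Set.mem_iUnion, Set.mem_image, Set.mem_ofPred_eq, exists_prop,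
    Set.mem_Ioc]
  constructor
  · rintro ⟨hα, h1, h2⟩
    obtain ⟨q, hq1, hqQ, b, hb, h⟩ := exists_coprime_of_mem_majorArcs hα
    have hqR : (1 : ℝ) ≤ q := by exact_mod_cast hq1
    have hq0 : (0 : ℝ) < q := by linarith
    have habs : |α * q - b| ≤ Q / X ^ k := by
      have : α * q - b = q * (α - b / q) := by field_simp
      rw [this, abs_mul, abs_of_pos hq0]; exact h
    rw [abs_le] at habs
    -- The window (t, t + 1] starts to the right of the arc around 0 and contains the whole arc
    -- around 1, so numerators run over exactly 1, …, q.
    have hb1 : 1 ≤ b := by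
      have : (0 : ℝ) < b := by nlinarith [habs.2]
      have : 0 < b := by exact_mod_cast this
      omega
    have hb2 : b ≤ q := by
      have : (b : ℝ) < q + 1 := by nlinarith [habs.1]
      have : b < q + 1 := by exact_mod_cast this
      omega
    lift b to ℕ using (by omega)
    refine ⟨⟨q, b⟩, ?_, α - b / q, ?_, ?_⟩
    · rw [mem_fractions]
      refine ⟨Finset.mem_Icc.2 ⟨hq1, Nat.le_floor hqQ⟩, by exact_mod_cast hb1,
        by exact_mod_cast hb2, hb⟩
    · simpa using h
    · simp [fracPt]
  · rintro ⟨⟨q, b⟩, hx, β, hβ, rfl⟩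
    rw [mem_fractions] at hx
    obtain ⟨hq, hb1, hb2, hb⟩ := hx
    simp only [Finset.mem_Icc] at hq hβ hb1 hb2
    have hqQ : (q : ℝ) ≤ Q := (Nat.le_floor_iff hQ).1 hq.2
    have hqR : (1 : ℝ) ≤ q := by exact_mod_cast hq.1
    have hb1R : (1 : ℝ) ≤ b := by exact_mod_cast hb1
    have hb2R : (b : ℝ) ≤ q := by exact_mod_cast hb2
    have hq0 : (0 : ℝ) < q := by linarith
    have hqβ : |q * β| ≤ Q / X ^ k := by rwa [abs_mul, abs_of_pos hq0]
    rw [abs_le] at hqβ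
    have hpt : q * fracPt ⟨q, b⟩ = b := by simp only [fracPt]; field_simp
    refine ⟨?_, ?_, ?_⟩
    · refine mem_majorArcs_iff.2 ⟨q, hq.1, hqQ, b, ?_⟩
      have : (fracPt ⟨q, b⟩ + β) * q - ((b : ℤ) : ℝ) = q * β := by
        push_cast; rw [← hpt]; ring
      rw [this, abs_le]; exact hqβ
    · have : q * t < q * (fracPt ⟨q, b⟩ + β) := by
        rw [mul_add, hpt]; nlinarith [hqβ.1]
      exact lt_of_mul_lt_mul_left this hq0.le
    · have : q * (fracPt ⟨q, b⟩ + β) ≤ q * (t + 1) := by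
        rw [mul_add, hpt]; nlinarith [hqβ.2]
      exact le_of_mul_le_mul_left this hq0

end Arcs

/-! ### Consequences of the distribution and Weyl hypotheses -/

section Reduction
variable {a : ℕ → ℝ} {k : ℕ} {κ : (q : ℕ) → ZMod q → ℝ} {QD QW E L : ℝ → ℝ} {ϱ : ℝ}

theorem Distributed.exists_uniform (hD : Distributed a κ QD E)
    (hE : E =O[atTop] (fun _ : ℝ => (1 : ℝ))) (hQD : ComparableToId QD) :
    ∃ c C : ℝ, 0 < c ∧ 0 ≤ C ∧ ∀ᶠ X : ℝ in atTop, ∀ q : ℕ, 1 ≤ q → (q : ℝ) ≤ c * X →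
      ∀ b : ZMod q, |countMod a q b X - κ q b * count a X| ≤ C := by
  obtain ⟨-, -, C, hC⟩ := hD
  obtain ⟨C', hC'⟩ := hE.bound
  obtain ⟨c, c', hc, hcc⟩ := hQD
  refine ⟨c, |C| * |C'|, hc, by positivity, ?_⟩
  filter_upwards [hC, hC', hcc] with X h1 h2 h3 q hq hqX b
  refine (h1 q hq (hqX.trans h3.1) b).trans ((le_abs_self _).trans ?_)
  rw [abs_mul]
  simp only [norm_one, mul_one, Real.norm_eq_abs] at h2
  exact mul_le_mul_of_nonneg_left (h2.trans (le_abs_self _)) (abs_nonneg _)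

theorem WeylHyp.exists_uniform (ha : ∀ n, 0 ≤ a n) (hW : WeylHyp a k ϱ QW L)
    (hQW : ComparableToId QW) :
    ∃ c : ℝ, 0 < c ∧ ∀ ε : ℝ, 0 < ε → ∃ C : ℝ, 0 ≤ C ∧ ∀ᶠ X : ℝ in atTop, ∀ Q : ℝ, 1 ≤ Q →
      Q ≤ c * X → ∀ α ∈ minorArcs k X Q,
        ‖expSum a k α X‖ ≤ C * count a X * Q ^ (-ϱ) * X ^ ε := by
  obtain ⟨hL, C, hC⟩ := hW
  obtain ⟨c, c', hc, hcc⟩ := hQW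
  refine ⟨c, hc, fun ε hε => ?_⟩
  obtain ⟨C', hC'⟩ := (hL ε hε).bound
  refine ⟨|C| * |C'|, by positivity, ?_⟩
  filter_upwards [hC, hC', hcc, eventually_ge_atTop (0 : ℝ)] with X h1 h2 h3 h4 Q hQ hQX α hα
  refine (h1 Q hQ (hQX.trans h3.1) α hα).trans ((le_abs_self _).trans ?_)
  have hQ0 : 0 ≤ Q ^ (-ϱ) := by positivity
  have h5 : |L X| ≤ |C'| * X ^ ε := by
    rw [Real.norm_eq_abs, Real.norm_of_nonneg (by positivity)] at h2
    exact h2.trans (by gcongr; exact le_abs_self _)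
  rw [abs_mul, abs_mul, abs_mul, abs_of_nonneg (count_nonneg ha X), abs_of_nonneg hQ0]
  calc |C| * (count a X * Q ^ (-ϱ) * |L X|)
      ≤ |C| * (count a X * Q ^ (-ϱ) * (|C'| * X ^ ε)) := by
        have := count_nonneg ha X
        gcongr
    _ = _ := by ring

theorem sum_e_div_eq (p : ℕ) (hp : 1 ≤ p) (m r : ℕ) :
    ∑ c ∈ Finset.range p, e ((c : ℝ) / p * m) * e (-((c : ℝ) / p * r)) =
      if (m : ZMod p) = r then (p : ℂ) else 0 := by
  have hp0 : (p : ℝ) ≠ 0 := by positivity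
  have h1 : ∀ c : ℕ, e ((c : ℝ) / p * m) * e (-((c : ℝ) / p * r)) =
      e (((m : ℝ) - r) / p) ^ c := by
    intro c
    rw [← e_add, ← e_nat_mul]; congr 1; ring
  simp only [h1]
  split_ifs with h
  · have h2 : e (((m : ℝ) - r) / p) = 1 := by
      have h3 : ((((m : ℤ) - r : ℤ)) : ZMod p) = 0 := by push_cast; rw [h, sub_self]
      rw [ZMod.intCast_zmod_eq_zero_iff_dvd _ p] at h3
      obtain ⟨z, hz⟩ := h3
      have : ((m : ℝ) - r) = p * z := by exact_mod_cast hz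
      rw [this, mul_div_cancel_left₀ _ hp0, e_int]
    simp [h2]
  · have h2 : e (((m : ℝ) - r) / p) ^ p = 1 := by
      rw [← e_nat_mul, mul_div_cancel₀ _ hp0]
      have := e_int ((m : ℤ) - r)
      push_cast at this
      exact this
    have h3 : e (((m : ℝ) - r) / p) ≠ 1 := by
      intro h4
      apply h
      rw [e, Complex.exp_eq_one_iff] at h4
      obtain ⟨z, hz⟩ := h4
      have h5 : ((((m : ℝ) - r) / p : ℝ) : ℂ) = z := by
        have hpi : (2 * Real.pi * Complex.I : ℂ) ≠ 0 := Complex.two_pi_I_ne_zero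
        have : (2 * Real.pi * Complex.I : ℂ) * ((((m : ℝ) - r) / p : ℝ) : ℂ) =
          (2 * Real.pi * Complex.I : ℂ) * z := by rw [hz]; ring
        exact mul_left_cancel₀ hpi this
      have h6 : ((m : ℝ) - r) / p = z := by exact_mod_cast h5
      rw [div_eq_iff hp0] at h6
      have h7 : (m : ℤ) - r = z * p := by exact_mod_cast h6
      have h8 : ((((m : ℤ) - r : ℤ)) : ZMod p) = 0 := by rw [h7]; simp
      push_cast at h8
      exact sub_eq_zero.1 h8
    rw [geom_sum_eq h3, h2]; simp

/-- Additive characters detect the congruence n^k ≡ b^k modulo p, which every n ≡ b satisfies; the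
other solutions only add non-negative weight. -/
theorem mul_countMod_le_sum_norm (ha : ∀ n, 0 ≤ a n) {p : ℕ} (hp : 1 ≤ p) (b : ZMod p) (X : ℝ) :
    p * countMod a p b X ≤ ∑ c ∈ Finset.range p, ‖expSum a k ((c : ℝ) / p) X‖ := by
  have : NeZero p := ⟨by omega⟩
  classical
  have h : ∑ c ∈ Finset.range p, expSum a k ((c : ℝ) / p) X *
      e (-((c : ℝ) / p * ((b.val ^ k : ℕ) : ℝ))) =
      ((∑ n ∈ Finset.Icc 1 ⌊X⌋₊, a n * if ((n ^ k : ℕ) : ZMod p) = ((b.val ^ k : ℕ) : ZMod p)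
        then (p : ℝ) else 0 : ℝ) : ℂ) := by
    simp only [expSum, Finset.sum_mul]
    rw [Finset.sum_comm, Complex.ofReal_sum]
    refine Finset.sum_congr rfl fun n _ => ?_
    simp only [mul_assoc]
    rw [← Finset.mul_sum]
    have := sum_e_div_eq p hp (n ^ k) (b.val ^ k)
    simp only [Nat.cast_pow] at this ⊢
    rw [this]
    push_cast
    split_ifs <;> simp
  have h1 : (p : ℝ) * countMod a p b X ≤ ∑ n ∈ Finset.Icc 1 ⌊X⌋₊, a n *
      if ((n ^ k : ℕ) : ZMod p) = ((b.val ^ k : ℕ) : ZMod p) then (p : ℝ) else 0 := by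
    rw [countMod, Finset.sum_filter, Finset.mul_sum]
    refine Finset.sum_le_sum fun n _ => ?_
    by_cases hn : (n : ZMod p) = b
    · rw [if_pos hn, if_pos, mul_comm]
      push_cast
      rw [hn, ZMod.natCast_zmod_val]
    · rw [if_neg hn, mul_zero]
      have := ha n
      split_ifs <;> positivity
  refine h1.trans ((le_abs_self _).trans ?_)
  rw [← Real.norm_eq_abs, ← Complex.norm_real, ← h]
  refine (norm_sum_le _ _).trans (Finset.sum_le_sum fun c _ => ?_)
  rw [norm_mul, norm_e, mul_one]

/-- At X = p² the fractions i/p with 0 < i < p lie on the minor arcs of level p/2, because their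
denominator exceeds the level. So all sums f(i/p) except the one at i = 0 are o(A), and no residue
class modulo a large prime p can carry half of the mass. -/
theorem exists_prime_density_le_half (hk : 2 ≤ k) (ha : ∀ n, 0 ≤ a n)
    (ha_top : Tendsto (count a) atTop atTop) (hD : Distributed a κ QD E)
    (hE : E =O[atTop] (fun _ : ℝ => (1 : ℝ))) (hQD : ComparableToId QD)
    (hϱ : 0 < ϱ) (hW : WeylHyp a k ϱ QW L) (hQW : ComparableToId QW) :
    ∃ p : ℕ, 1 ≤ p ∧ ∀ b : ZMod p, κ p b ≤ 1 / 2 := by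
  obtain ⟨c, C, hc, hC, hDu⟩ := hD.exists_uniform hE hQD
  obtain ⟨c', hc', hWu⟩ := hW.exists_uniform ha hQW
  -- With X = p² and Q = p/2 this ε leaves Q^{-ϱ} X^{ϱ/4} = 2^ϱ p^{-ϱ/2}, which still tends to 0.
  obtain ⟨C', hC', hWu⟩ := hWu (ϱ / 4) (by positivity)
  have hsq : Tendsto (fun p : ℕ => (p : ℝ) ^ 2) atTop atTop :=
    (tendsto_pow_atTop two_ne_zero).comp tendsto_natCast_atTop_atTop
  have hlim : Tendsto (fun p : ℕ => 1 / (p : ℝ) + C' * 2 ^ ϱ * (p : ℝ) ^ (-(ϱ / 2))) atTop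
      (nhds (0 + C' * 2 ^ ϱ * 0)) :=
    tendsto_one_div_atTop_nhds_zero_nat.add
      (((tendsto_rpow_neg_atTop (by positivity)).comp tendsto_natCast_atTop_atTop).const_mul _)
  rw [mul_zero, add_zero] at hlim
  have hev : ∀ᶠ p : ℕ in atTop, ∀ _ : p.Prime, 1 ≤ p ∧ ∀ b : ZMod p, κ p b ≤ 1 / 2 := by
    filter_upwards [hsq.eventually hDu, hsq.eventually hWu,
      hlim.eventually (eventually_le_nhds (by norm_num : (0 : ℝ) < 1 / 4)),
      (hsq.eventually (ha_top.eventually_ge_atTop (4 * C + 1))),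
      eventually_ge_atTop 2,
      tendsto_natCast_atTop_atTop.eventually_ge_atTop (1 / c),
      tendsto_natCast_atTop_atTop.eventually_ge_atTop (1 / c')] with p h1 h2 h3 h4 h5 h6 h7 hpp
    have hp2 : (2 : ℝ) ≤ p := by exact_mod_cast h5
    rw [div_le_iff₀ hc] at h6
    rw [div_le_iff₀ hc'] at h7
    refine ⟨by omega, fun b => ?_⟩
    set X : ℝ := (p : ℝ) ^ 2 with hX
    have hA0 : 0 < count a X := by linarith
    have hminor : ∀ i ∈ Finset.range p, i ≠ 0 →
        ‖expSum a k ((i : ℝ) / p) X‖ ≤ C' * count a X * (p / 2 : ℝ) ^ (-ϱ) * X ^ (ϱ / 4) := by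
      intro i hi hi0
      refine h2 (p / 2) (by linarith) (by rw [hX]; nlinarith) _ ?_
      have hcop : IsCoprime ((i : ℕ) : ℤ) (p : ℤ) := by
        rw [Nat.isCoprime_iff_coprime]
        exact ((hpp.coprime_iff_not_dvd).2 fun hd =>
          absurd (Nat.le_of_dvd (Nat.pos_of_ne_zero hi0) hd)
            (by have := Finset.mem_range.1 hi; omega)).symm
      have := mem_minorArcs_of_near (k := k) (X := X) (Q := p / 2) (β := 0) (r := 0)
        (by omega : 1 ≤ p) hcop (by positivity) (by positivity) (by simp)
        (Or.inl (by linarith)) ?_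
      · simpa using this
      · have hXk : (p : ℝ) ^ 4 ≤ X ^ k := by
          calc (p : ℝ) ^ 4 = X ^ 2 := by rw [hX]; ring
            _ ≤ X ^ k := pow_le_pow_right₀ (by rw [hX]; nlinarith) hk
        rw [zero_add, div_mul_eq_mul_div, div_mul_eq_mul_div, div_lt_one (by positivity)]
        refine lt_of_lt_of_le ?_ hXk
        have : (0 : ℝ) < p ^ 3 := by positivity
        nlinarith
    have hbd : (p / 2 : ℝ) ^ (-ϱ) * X ^ (ϱ / 4) = 2 ^ ϱ * (p : ℝ) ^ (-(ϱ / 2)) := by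
      rw [hX, Real.div_rpow (by positivity) (by positivity), ← Real.rpow_natCast (p : ℝ) 2,
        ← Real.rpow_mul (by positivity), Real.rpow_neg (by positivity : (0 : ℝ) ≤ 2), div_inv_eq_mul]
      rw [mul_comm ((p : ℝ) ^ (-ϱ)), mul_assoc, ← Real.rpow_add (by positivity)]
      congr 2; push_cast; ring
    have hsum := mul_countMod_le_sum_norm (k := k) ha (by omega : 1 ≤ p) b X
    have hsum2 : ∑ i ∈ Finset.range p, ‖expSum a k ((i : ℝ) / p) X‖ ≤
        count a X + p * (C' * count a X * (2 ^ ϱ * (p : ℝ) ^ (-(ϱ / 2)))) := by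
      have hT : 0 ≤ C' * count a X * (2 ^ ϱ * (p : ℝ) ^ (-(ϱ / 2))) := by positivity
      have : ∀ i ∈ Finset.range p, ‖expSum a k ((i : ℝ) / p) X‖ ≤
          (if i = 0 then count a X else 0) + C' * count a X * (2 ^ ϱ * (p : ℝ) ^ (-(ϱ / 2))) := by
        intro i hi
        split_ifs with h
        · exact (norm_expSum_le ha _ _).trans (by linarith)
        · have := hminor i hi h
          rw [mul_assoc _ _ (X ^ (ϱ / 4)), hbd] at this
          linarith
      refine (Finset.sum_le_sum this).trans ?_
      rw [Finset.sum_add_distrib, Finset.sum_ite_eq']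
      simp [show 0 < p by omega]
    have hA := hsum.trans hsum2
    have hA2 : countMod a p b X ≤ count a X / 4 := by
      have e1 : count a X + p * (C' * count a X * (2 ^ ϱ * (p : ℝ) ^ (-(ϱ / 2)))) =
        p * (count a X * (1 / (p : ℝ) + C' * 2 ^ ϱ * (p : ℝ) ^ (-(ϱ / 2)))) := by
        field_simp
      rw [e1] at hA
      have := le_of_mul_le_mul_left hA (by positivity)
      nlinarith
    have hd := (abs_le.1 (h1 p (by omega) (by rw [hX]; nlinarith) b)).1
    -- If κ > 1/2 then A/2 - C ≤ A/4, contrary to A ≥ 4C + 1.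
    by_contra hcon
    push Not at hcon
    nlinarith
  obtain ⟨N, hN⟩ := eventually_atTop.1 hev
  obtain ⟨p, hp, hpp⟩ := Nat.exists_infinite_primes N
  exact ⟨p, hN p hp hpp⟩

theorem countMod_succ (q n : ℕ) :
    countMod a q ((n + 1 : ℕ) : ZMod q) ((n + 1 : ℕ) : ℝ) =
      countMod a q ((n + 1 : ℕ) : ZMod q) (n : ℝ) + a (n + 1) := by
  classical
  simp only [countMod, Nat.floor_natCast, Finset.sum_filter]
  rw [Finset.sum_Icc_succ_top (by omega)]
  simp

/-- The weights are bounded. -/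
theorem exists_bound_coeff (ha : ∀ n, 0 ≤ a n) (hD : Distributed a κ QD E)
    (hE : E =O[atTop] (fun _ : ℝ => (1 : ℝ))) (hQD : ComparableToId QD)
    (hp : ∃ p : ℕ, 1 ≤ p ∧ ∀ b : ZMod p, κ p b ≤ 1 / 2) :
    ∃ C : ℝ, 0 < C ∧ ∀ n, 1 ≤ n → a n ≤ C := by
  obtain ⟨p, hp1, hp⟩ := hp
  obtain ⟨c, C, hc, hC, hDu⟩ := hD.exists_uniform hE hQD
  obtain ⟨N, hN⟩ := eventually_atTop.1
    (tendsto_natCast_atTop_atTop.eventually (hDu.and (eventually_ge_atTop (p / c))))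
  refine ⟨4 * C + count a (N + 1 : ℕ) + 1, ?_, fun n hn => ?_⟩
  · have := count_nonneg ha (N + 1 : ℕ); positivity
  rcases le_or_gt n (N + 1) with h | h
  · have : a n ≤ count a (N + 1 : ℕ) := by
      simp only [count, Nat.floor_natCast]
      exact Finset.single_le_sum (f := a) (fun i _ => ha i) (Finset.mem_Icc.2 ⟨hn, h⟩)
    linarith
  · obtain ⟨m, rfl⟩ : ∃ m, n = m + 1 := ⟨n - 1, by omega⟩
    have h1 := hN m (by omega)
    have h2 := hN (m + 1) (by omega)
    have h3 := abs_le.1 (h1.1 p hp1 (by have := h1.2; rw [div_le_iff₀ hc] at this; linarith)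
      ((m + 1 : ℕ) : ZMod p))
    have h4 := abs_le.1 (h2.1 p hp1 (by have := h2.2; rw [div_le_iff₀ hc] at this; linarith)
      ((m + 1 : ℕ) : ZMod p))
    rw [countMod_succ, count_succ] at h4
    have h5 := hp ((m + 1 : ℕ) : ZMod p)
    have := ha (m + 1)
    have := count_nonneg ha (N + 1 : ℕ)
    -- Passing from m to m + 1 changes the discrepancy in the class of m + 1 by (1 - κ) a(m + 1),
    -- which is at least a(m + 1)/2 and at most 2C.
    nlinarith [h3.1, h4.2]

theorem count_le_mul {C : ℝ} (hC : ∀ n, 1 ≤ n → a n ≤ C) (hC0 : 0 ≤ C) {X : ℝ} (hX : 0 ≤ X) :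
    count a X ≤ C * X := by
  refine (Finset.sum_le_card_nsmul _ _ C fun n hn => hC n (Finset.mem_Icc.1 hn).1).trans ?_
  simp only [Nat.card_Icc, Nat.add_sub_cancel, nsmul_eq_mul]
  rw [mul_comm]
  exact mul_le_mul_of_nonneg_left (Nat.floor_le hX) hC0

/-- The distribution hypothesis holds without any restriction on the modulus. -/
theorem exists_uniform_discrepancy (ha : ∀ n, 0 ≤ a n) (hD : Distributed a κ QD E)
    (hE : E =O[atTop] (fun _ : ℝ => (1 : ℝ))) (hQD : ComparableToId QD)
    {B : ℝ} (hB : ∀ n, 1 ≤ n → a n ≤ B) (hB0 : 0 ≤ B) :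
    ∃ C : ℝ, 0 < C ∧ ∀ q : ℕ, 1 ≤ q → ∀ (b : ZMod q) (X : ℝ),
      |countMod a q b X - κ q b * count a X| ≤ C := by
  obtain ⟨c, C, hc, hC, hDu⟩ := hD.exists_uniform hE hQD
  obtain ⟨U, hU⟩ := eventually_atTop.1 hDu
  refine ⟨count a U + B * (1 / c + 1) + C + 1, ?_, fun q hq b X => ?_⟩
  · have := count_nonneg ha U; positivity
  have hcU := count_nonneg ha U
  have hBc : 0 ≤ B * (1 / c + 1) := by positivity
  have hqR : (1 : ℝ) ≤ q := by exact_mod_cast hq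
  -- The point v is the first at which the assumed bound is available for the modulus q. Below v
  -- both terms of the discrepancy are non-negative and bounded by monotonicity by their values at
  -- v, which are O(1).
  set v := max U (q / c) with hv
  have hvq : (q : ℝ) ≤ c * v := by
    have : (q : ℝ) / c ≤ v := le_max_right _ _
    rw [div_le_iff₀ hc] at this; linarith
  rcases le_or_gt v X with h | h
  · refine (hU X ((le_max_left _ _).trans h) q hq (hvq.trans (by gcongr)) b).trans (by linarith)
  · have h1 := hU v (le_max_left _ _) q hq hvq b
    have hκ := hD.1 q hq b
    have h2 : countMod a q b v ≤ count a U + B * (1 / c + 1) := by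
      rcases le_total U (q / c) with h3 | h3
      · rw [hv, max_eq_right h3]
        have : countMod a q b (q / c) ≤ B * (1 / c + 1) := by
          classical
          rw [countMod]
          refine (Finset.sum_le_card_nsmul _ _ B fun n hn =>
            hB n (Finset.mem_Icc.1 (Finset.mem_filter.1 hn).1).1).trans ?_
          rw [nsmul_eq_mul, mul_comm]
          refine mul_le_mul_of_nonneg_left ?_ hB0
          have hcard : (Finset.filter (fun n : ℕ => (n : ZMod q) = b)
              (Finset.Icc 1 ⌊(q : ℝ) / c⌋₊)).card ≤ (Finset.range (⌊1 / c⌋₊ + 1)).card := by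
            -- Within a fixed residue class n is determined by its quotient by q, and the quotients
            -- are at most 1/c.
            refine Finset.card_le_card_of_injOn (fun n => n / q) ?_ ?_
            · intro n hn
              have hn2 := (Finset.mem_Icc.1 (Finset.mem_filter.1 hn).1).2
              rw [Nat.le_floor_iff (by positivity)] at hn2
              simp only [Finset.coe_range, Set.mem_Iio, Nat.lt_succ_iff]
              apply Nat.le_floor
              refine (Nat.cast_div_le).trans ?_
              rw [div_le_iff₀ (by linarith)]
              refine hn2.trans (le_of_eq ?_); ring
            · intro n hn m hm hnm
              have h5 := (Finset.mem_filter.1 hn).2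
              have h6 := (Finset.mem_filter.1 hm).2
              have h7 : n % q = m % q := (ZMod.natCast_eq_natCast_iff' n m q).1 (h5.trans h6.symm)
              have hnm' : n / q = m / q := hnm
              rw [← Nat.div_add_mod n q, ← Nat.div_add_mod m q, h7, hnm']
          rw [Finset.card_range] at hcard
          have h8 : ((Finset.filter (fun n : ℕ => (n : ZMod q) = b)
              (Finset.Icc 1 ⌊(q : ℝ) / c⌋₊)).card : ℝ) ≤ (⌊1 / c⌋₊ : ℝ) + 1 := by
            exact_mod_cast hcard
          have h9 := Nat.floor_le (by positivity : 0 ≤ 1 / c)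
          exact h8.trans (by linarith)
        linarith
      · rw [hv, max_eq_left h3]
        have := countMod_le_count ha q b U
        linarith
    have h3 := countMod_mono ha q b h.le
    have h4 := mul_le_mul_of_nonneg_left (count_mono ha h.le) hκ
    have h5 := countMod_nonneg ha q b X
    have h6 := mul_nonneg hκ (count_nonneg ha X)
    rw [abs_le] at h1 ⊢
    constructor <;> linarith [h1.1, h1.2]

/-- Partial summation. The phase β n^k is monotone in n, so its increments telescope to |β| N^k. -/
theorem norm_sum_mul_e_le {d : ℕ → ℝ} {C : ℝ} (hC : ∀ m : ℕ, |∑ n ∈ Finset.Icc 1 m, d n| ≤ C)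
    (β : ℝ) (hk : k ≠ 0) (N : ℕ) :
    ‖∑ n ∈ Finset.Icc 1 N, (d n : ℂ) * e (β * (n : ℝ) ^ k)‖ ≤
      C * (1 + 2 * Real.pi * (|β| * (N : ℝ) ^ k)) := by
  have hC0 : 0 ≤ C := (abs_nonneg _).trans (hC 0)
  have key : ∀ N : ℕ, ‖∑ n ∈ Finset.Icc 1 N, (d n : ℂ) * e (β * (n : ℝ) ^ k) -
      ((∑ n ∈ Finset.Icc 1 N, d n : ℝ) : ℂ) * e (β * (N : ℝ) ^ k)‖ ≤
      C * (2 * Real.pi * (|β| * (N : ℝ) ^ k)) := by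
    intro N
    induction N with
    | zero => simp [hk]
    | succ N ih =>
      rw [Finset.sum_Icc_succ_top (by omega), Finset.sum_Icc_succ_top (by omega)]
      have e1 : ∑ n ∈ Finset.Icc 1 N, (d n : ℂ) * e (β * (n : ℝ) ^ k) +
          (d (N + 1) : ℂ) * e (β * ((N + 1 : ℕ) : ℝ) ^ k) -
          ((∑ n ∈ Finset.Icc 1 N, d n + d (N + 1) : ℝ) : ℂ) * e (β * ((N + 1 : ℕ) : ℝ) ^ k) =
          (∑ n ∈ Finset.Icc 1 N, (d n : ℂ) * e (β * (n : ℝ) ^ k) -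
          ((∑ n ∈ Finset.Icc 1 N, d n : ℝ) : ℂ) * e (β * (N : ℝ) ^ k)) +
          ((∑ n ∈ Finset.Icc 1 N, d n : ℝ) : ℂ) *
            (e (β * (N : ℝ) ^ k) - e (β * ((N + 1 : ℕ) : ℝ) ^ k)) := by
        push_cast; ring
      rw [e1]
      refine (norm_add_le _ _).trans ((add_le_add (d := C * (2 * Real.pi *
        (|β| * (((N + 1 : ℕ) : ℝ) ^ k - (N : ℝ) ^ k)))) ih ?_).trans ?_)
      · rw [norm_mul, Complex.norm_real, Real.norm_eq_abs]
        refine mul_le_mul (hC N) ((norm_e_sub_e_le _ _).trans (le_of_eq ?_)) (norm_nonneg _) hC0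
        rw [← mul_sub, abs_mul, abs_sub_comm, abs_of_nonneg (a := ((N + 1 : ℕ) : ℝ) ^ k - (N : ℝ) ^ k)]
        rw [sub_nonneg]; gcongr; omega
      · apply le_of_eq; ring
  have h1 := key N
  have h2 := norm_add_le (∑ n ∈ Finset.Icc 1 N, (d n : ℂ) * e (β * (n : ℝ) ^ k) -
      ((∑ n ∈ Finset.Icc 1 N, d n : ℝ) : ℂ) * e (β * (N : ℝ) ^ k))
      (((∑ n ∈ Finset.Icc 1 N, d n : ℝ) : ℂ) * e (β * (N : ℝ) ^ k))
  rw [sub_add_cancel] at h2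
  refine h2.trans ?_
  rw [norm_mul, norm_e, mul_one, Complex.norm_real, Real.norm_eq_abs]
  have := hC N
  linarith

/-- The exponential sum near a rational point. -/
theorem norm_expSum_sub_le (hk : k ≠ 0) {C : ℝ}
    (hC : ∀ q : ℕ, 1 ≤ q → ∀ (b : ZMod q) (X : ℝ),
      |countMod a q b X - κ q b * count a X| ≤ C)
    {q : ℕ} (hq : 1 ≤ q) (b : ℕ) (β : ℝ) {X : ℝ} (hX : 0 ≤ X) :
    ‖expSum a k ((b : ℝ) / q + β) X - completeSum κ k q b * expSum a k β X‖ ≤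
      C * q * (1 + 2 * Real.pi * (|β| * X ^ k)) := by
  classical
  have hC0 : 0 ≤ C := (abs_nonneg _).trans (hC 1 le_rfl 0 0)
  have hq0 : (q : ℝ) ≠ 0 := by positivity
  have h1 : expSum a k ((b : ℝ) / q + β) X - completeSum κ k q b * expSum a k β X =
      ∑ l ∈ Finset.range q, e ((b : ℝ) * (l : ℝ) ^ k / q) *
        ∑ n ∈ Finset.Icc 1 ⌊X⌋₊,
          ((((if (n : ZMod q) = (l : ZMod q) then a n else 0) - κ q (l : ZMod q) * a n : ℝ)) : ℂ) *
            e (β * (n : ℝ) ^ k) := by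
    have h2 : expSum a k ((b : ℝ) / q + β) X = ∑ l ∈ Finset.range q, ∑ n ∈ Finset.Icc 1 ⌊X⌋₊,
        e ((b : ℝ) * (l : ℝ) ^ k / q) *
          ((((if (n : ZMod q) = (l : ZMod q) then a n else 0) : ℝ) : ℂ) * e (β * (n : ℝ) ^ k)) := by
      rw [Finset.sum_comm, expSum]
      refine Finset.sum_congr rfl fun n _ => ?_
      rw [Finset.sum_eq_single (n % q)]
      · have h3 : ((n % q : ℕ) : ZMod q) = n := by simp
        rw [h3, if_pos rfl, add_mul, e_add]
        have h4 : e ((b : ℝ) / q * (n : ℝ) ^ k) = e ((b : ℝ) * ((n % q : ℕ) : ℝ) ^ k / q) := by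
          have h5 : (q : ℤ) ∣ (n : ℤ) ^ k - ((n % q : ℕ) : ℤ) ^ k := by
            refine dvd_trans ?_ (sub_dvd_pow_sub_pow _ _ k)
            rw [← ZMod.intCast_zmod_eq_zero_iff_dvd]; push_cast; simp
          obtain ⟨z, hz⟩ := h5
          refine e_eq_of_sub_int (b * z) ?_
          have h6 : (n : ℝ) ^ k - ((n % q : ℕ) : ℝ) ^ k = q * z := by exact_mod_cast hz
          rw [div_mul_eq_mul_div, ← sub_div, ← mul_sub, h6]
          push_cast; field_simp
        rw [h4]; ring
      · intro l hl hne
        rw [if_neg, Complex.ofReal_zero, zero_mul, mul_zero]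
        intro h
        apply hne
        have := (ZMod.natCast_eq_natCast_iff' n l q).1 h
        rw [this, Nat.mod_eq_of_lt (Finset.mem_range.1 hl)]
      · intro h
        exact absurd (Finset.mem_range.2 (Nat.mod_lt _ (by omega))) h
    rw [h2, completeSum, Finset.sum_mul, ← Finset.sum_sub_distrib]
    refine Finset.sum_congr rfl fun l _ => ?_
    rw [expSum, Finset.mul_sum, Finset.mul_sum, ← Finset.sum_sub_distrib]
    refine Finset.sum_congr rfl fun n _ => ?_
    push_cast; ring
  rw [h1]
  refine (norm_sum_le _ _).trans ?_
  have h2 : ∀ l ∈ Finset.range q, ‖e ((b : ℝ) * (l : ℝ) ^ k / q) *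
        ∑ n ∈ Finset.Icc 1 ⌊X⌋₊,
          ((((if (n : ZMod q) = (l : ZMod q) then a n else 0) - κ q (l : ZMod q) * a n : ℝ)) : ℂ) *
            e (β * (n : ℝ) ^ k)‖ ≤ C * (1 + 2 * Real.pi * (|β| * X ^ k)) := by
    intro l _
    rw [norm_mul, norm_e, one_mul]
    refine (norm_sum_mul_e_le (C := C) (fun m => ?_) β hk _).trans ?_
    · rw [Finset.sum_sub_distrib, ← Finset.sum_filter, ← Finset.mul_sum]
      have := hC q hq (l : ZMod q) (m : ℝ)
      simp only [countMod, count, Nat.floor_natCast] at this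
      convert this using 4
    · gcongr
      exact Nat.floor_le hX
  refine (Finset.sum_le_sum h2).trans (le_of_eq ?_)
  simp; ring

/-- The complete sum is the mean of e(b x^k/q) over the weighted set. Through this limit, bounds and
positivity properties of f pass to S(q, b). -/
theorem tendsto_expSum_div_count (hk : k ≠ 0) {C : ℝ}
    (hC : ∀ q : ℕ, 1 ≤ q → ∀ (b : ZMod q) (X : ℝ),
      |countMod a q b X - κ q b * count a X| ≤ C) (ha_top : Tendsto (count a) atTop atTop)
    {q : ℕ} (hq : 1 ≤ q) (b : ℕ) :
    Tendsto (fun X : ℝ => expSum a k ((b : ℝ) / q) X / (count a X : ℂ)) atTop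
      (nhds (completeSum κ k q b)) := by
  rw [tendsto_iff_norm_sub_tendsto_zero]
  have hlim : Tendsto (fun X : ℝ => C * q / count a X) atTop (nhds 0) :=
    tendsto_const_nhds.div_atTop ha_top
  refine squeeze_zero' (Eventually.of_forall fun _ => norm_nonneg _) ?_ hlim
  filter_upwards [ha_top.eventually_gt_atTop 0, eventually_ge_atTop (0 : ℝ)] with X h1 h2
  have h3 := norm_expSum_sub_le hk hC hq b 0 h2
  rw [add_zero, expSum_zero] at h3
  have hne : (count a X : ℂ) ≠ 0 := by exact_mod_cast h1.ne'
  have : expSum a k ((b : ℝ) / q) X / (count a X : ℂ) - completeSum κ k q b =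
    (expSum a k ((b : ℝ) / q) X - completeSum κ k q b * count a X) / (count a X : ℂ) := by
    field_simp
  rw [this, norm_div, Complex.norm_real, Real.norm_of_nonneg h1.le]
  gcongr
  simpa using h3

theorem norm_completeSum_le_one (hk : k ≠ 0) (ha : ∀ n, 0 ≤ a n) {C : ℝ}
    (hC : ∀ q : ℕ, 1 ≤ q → ∀ (b : ZMod q) (X : ℝ),
      |countMod a q b X - κ q b * count a X| ≤ C) (ha_top : Tendsto (count a) atTop atTop)
    {q : ℕ} (hq : 1 ≤ q) (b : ℕ) : ‖completeSum κ k q b‖ ≤ 1 := by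
  refine le_of_tendsto (tendsto_expSum_div_count hk hC ha_top hq b).norm ?_
  filter_upwards [ha_top.eventually_gt_atTop 0] with X h1
  rw [norm_div, Complex.norm_real, Real.norm_of_nonneg h1.le, div_le_one h1]
  exact norm_expSum_le ha _ _

/-- This lets factors X^ε be absorbed into powers of A, the scale in which all savings are measured.
-/
theorem exists_rpow_le_count (ha : ∀ n, 0 ≤ a n) (hdens : 0 < logLowerDensity a) :
    ∃ c : ℝ, 0 < c ∧ ∀ᶠ X : ℝ in atTop, X ^ c ≤ count a X := by
  obtain ⟨c, hc0, hc⟩ := EReal.lt_iff_exists_real_btwn.1 hdens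
  have hc0' : 0 < c := by exact_mod_cast hc0
  refine ⟨c, hc0', ?_⟩
  have h := eventually_lt_of_lt_liminf hc
  filter_upwards [h, eventually_gt_atTop (1 : ℝ)] with X h1 h2
  have h3 : c < Real.log (count a X) / Real.log X := by exact_mod_cast h1
  have hlog := Real.log_pos h2
  rw [lt_div_iff₀ hlog] at h3
  have hpos : 0 < Real.log (count a X) := by nlinarith
  have hcount : 0 < count a X := (count_nonneg ha X).lt_of_ne fun h0 => by
    rw [← h0] at hpos; simp at hpos
  rw [Real.rpow_def_of_pos (by linarith), ← Real.le_log_iff_exp_le hcount]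
  linarith

end Reduction

/-! ### The minor arcs and the singular series -/

/-- The consequences of the hypotheses on a weighted set used in the circle method. -/
structure Regular (a : ℕ → ℝ) (k : ℕ) (κ : (q : ℕ) → ZMod q → ℝ) (t₀ ϱ ω : ℝ) : Prop where
  two_le : 2 ≤ k
  nonneg : ∀ n, 0 ≤ a n
  top : Tendsto (count a) atTop atTop
  bound : ∃ B : ℝ, 0 < B ∧ ∀ n, 1 ≤ n → a n ≤ B
  disc : ∃ C : ℝ, 0 < C ∧ ∀ q : ℕ, 1 ≤ q → ∀ (b : ZMod q) (X : ℝ),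
      |countMod a q b X - κ q b * count a X| ≤ C
  weyl : ∃ c : ℝ, 0 < c ∧ ∀ ε : ℝ, 0 < ε → ∃ C : ℝ, 0 ≤ C ∧ ∀ᶠ X : ℝ in atTop, ∀ Q : ℝ, 1 ≤ Q →
      Q ≤ c * X → ∀ α ∈ minorArcs k X Q,
        ‖expSum a k α X‖ ≤ C * count a X * Q ^ (-ϱ) * count a X ^ ε
  mean : ∀ t : ℝ, t₀ ≤ t → ∃ C : ℝ, 0 ≤ C ∧ ∀ᶠ X : ℝ in atTop,
      meanValue a k t X ≤ C * (count a X ^ (2 * t + ω) / X ^ k)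
  t_nonneg : 0 ≤ t₀
  ϱ_pos : 0 < ϱ
  ω_nonneg : 0 ≤ ω

theorem regular_of_hypotheses {k : ℕ} (hk : 2 ≤ k)
    {a : ℕ → ℝ} (ha : ∀ n, 0 ≤ a n) (ha_top : Tendsto (count a) atTop atTop)
    (hdens : 0 < logLowerDensity a)
    {κ : (q : ℕ) → ZMod q → ℝ} {QD QW E Δ L : ℝ → ℝ} {t₀ ϱ ω : ℝ}
    (ht₀ : 0 ≤ t₀) (hϱ : 0 < ϱ) (hω : 0 ≤ ω)
    (hD : Distributed a κ QD E) (hV : MeanValueHyp a k t₀ Δ) (hW : WeylHyp a k ϱ QW L)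
    (hE : E =O[atTop] (fun _ : ℝ => (1 : ℝ)))
    (hQD : ComparableToId QD) (hQW : ComparableToId QW)
    (hΔ : Δ =O[atTop] (fun X : ℝ => min X (count a X) ^ ω)) : Regular a k κ t₀ ϱ ω := by
  obtain ⟨B, hB0, hB⟩ := exists_bound_coeff ha hD hE hQD
    (exists_prime_density_le_half hk ha ha_top hD hE hQD hϱ hW hQW)
  refine ⟨hk, ha, ha_top, ⟨B, hB0, hB⟩, exists_uniform_discrepancy ha hD hE hQD hB hB0.le,
    ?_, ?_, ht₀, hϱ, hω⟩
  · obtain ⟨c, hc, hWu⟩ := hW.exists_uniform ha hQW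
    obtain ⟨c₀, hc₀, hgrow⟩ := exists_rpow_le_count ha hdens
    refine ⟨c, hc, fun ε hε => ?_⟩
    -- Since X^{c₀} ≤ A, the factor X^{c₀ε} is at most A^ε.
    obtain ⟨C, hC, hCu⟩ := hWu (c₀ * ε) (by positivity)
    refine ⟨C, hC, ?_⟩
    filter_upwards [hCu, hgrow, eventually_gt_atTop (0 : ℝ)] with X h1 h2 h3 Q hQ hQX α hα
    refine (h1 Q hQ hQX α hα).trans ?_
    have := count_nonneg ha X
    rw [Real.rpow_mul h3.le]
    gcongr
  · intro t ht
    obtain ⟨C, hC⟩ := (hV t ht).bound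
    obtain ⟨C', hC'⟩ := hΔ.bound
    refine ⟨|C| * |C'|, by positivity, ?_⟩
    filter_upwards [hC, hC', eventually_gt_atTop (0 : ℝ),
      ha_top.eventually_gt_atTop 0] with X h1 h2 h3 h4
    refine (le_abs_self _).trans ((h1.trans ?_))
    have hmin : 0 ≤ min X (count a X) := le_min h3.le h4.le
    have h5 : |Δ X| ≤ |C'| * count a X ^ ω := by
      rw [Real.norm_eq_abs, Real.norm_of_nonneg (by positivity)] at h2
      refine h2.trans ?_
      have : min X (count a X) ^ ω ≤ count a X ^ ω :=
        Real.rpow_le_rpow hmin (min_le_right _ _) hω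
      exact mul_le_mul (le_abs_self _) this (by positivity) (abs_nonneg _)
    rw [norm_mul, Real.norm_of_nonneg (by positivity), Real.norm_eq_abs, Real.rpow_add h4]
    calc C * (count a X ^ (2 * t) / X ^ k * |Δ X|)
        ≤ |C| * (count a X ^ (2 * t) / X ^ k * (|C'| * count a X ^ ω)) := by
          gcongr
          exact le_abs_self _
      _ = _ := by ring

theorem eventually_mul_rpow_le {p q : ℝ} (h : p < q) (C : ℝ) :
    ∀ᶠ X : ℝ in atTop, C * X ^ p ≤ X ^ q := by
  filter_upwards [(tendsto_rpow_atTop (sub_pos.2 h)).eventually_ge_atTop C,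
    eventually_gt_atTop (0 : ℝ)] with X h1 h2
  have : X ^ q = X ^ (q - p) * X ^ p := by rw [← Real.rpow_add h2]; congr 1; ring
  rw [this]
  gcongr

theorem add_pow_le_two_pow_mul {x y : ℝ} (hx : 0 ≤ x) (hy : 0 ≤ y) (s : ℕ) :
    (x + y) ^ s ≤ 2 ^ s * (x ^ s + y ^ s) := by
  rcases le_total x y with h | h
  · calc (x + y) ^ s ≤ (2 * y) ^ s := by gcongr; linarith
      _ = 2 ^ s * y ^ s := by ring
      _ ≤ _ := by gcongr; linarith [pow_nonneg hx s]
  · calc (x + y) ^ s ≤ (2 * x) ^ s := by gcongr; linarith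
      _ = 2 ^ s * x ^ s := by ring
      _ ≤ _ := by gcongr; linarith [pow_nonneg hy s]

theorem integrableOn_norm_expSum_pow {a : ℕ → ℝ} {k : ℕ} (s : ℕ) (X t : ℝ) (U : Set ℝ) :
    IntegrableOn (fun α => ‖expSum a k α X‖ ^ s) (Set.Ioc t (t + 1) ∩ U) := by
  refine IntegrableOn.mono_set ?_ (Set.inter_subset_left.trans Set.Ioc_subset_Icc_self)
  exact ((continuous_expSum X).norm.pow s).continuousOn.integrableOn_compact isCompact_Icc

theorem setIntegral_major_add_minor {a : ℕ → ℝ} {k : ℕ} (s : ℕ) (X Q t : ℝ) :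
    ∫ α in Set.Ioc t (t + 1), ‖expSum a k α X‖ ^ s =
      (∫ α in Set.Ioc t (t + 1) ∩ majorArcs k X Q, ‖expSum a k α X‖ ^ s) +
      ∫ α in Set.Ioc t (t + 1) ∩ minorArcs k X Q, ‖expSum a k α X‖ ^ s := by
  rw [← integral_inter_add_sdiff measurableSet_majorArcs]
  · rfl
  · simpa using integrableOn_norm_expSum_pow s X t Set.univ

/-! ### Power savings on the minor arcs and the size constraints they force. -/

namespace Regular
variable {a : ℕ → ℝ} {k : ℕ} {κ : (q : ℕ) → ZMod q → ℝ} {t₀ ϱ ω : ℝ}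

theorem ne_zero (H : Regular a k κ t₀ ϱ ω) : k ≠ 0 := by have := H.two_le; omega

theorem exists_count_le (H : Regular a k κ t₀ ϱ ω) :
    ∃ B : ℝ, 0 < B ∧ ∀ X : ℝ, 0 ≤ X → count a X ≤ B * X := by
  obtain ⟨B, hB0, hB⟩ := H.bound
  exact ⟨B, hB0, fun X hX => count_le_mul hB hB0.le hX⟩

theorem eventually_mul_count_rpow_le (H : Regular a k κ t₀ ϱ ω) {p q : ℝ} (hp : 0 ≤ p)
    (h : p < q) (C : ℝ) : ∀ᶠ X : ℝ in atTop, C * count a X ^ p ≤ X ^ q := by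
  obtain ⟨B, hB0, hB⟩ := H.exists_count_le
  filter_upwards [eventually_mul_rpow_le h (|C| * B ^ p), eventually_ge_atTop (0 : ℝ)] with X h1 h2
  refine le_trans ?_ h1
  rw [mul_assoc, ← Real.mul_rpow hB0.le h2]
  have h0 := count_nonneg H.nonneg X
  have := hB X h2
  calc C * count a X ^ p ≤ |C| * count a X ^ p := by gcongr; exact le_abs_self _
    _ ≤ _ := by gcongr

/-- Of the s factors, s - 2t₀ are estimated by the Weyl bound and the remaining power 2t₀ is
integrated over a full period. The window may start anywhere, by periodicity. -/
theorem exists_minor_bound (H : Regular a k κ t₀ ϱ ω) :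
    ∃ c : ℝ, 0 < c ∧ ∀ (s : ℕ) (ε : ℝ), 2 * t₀ < s → 0 < ε → ∃ C : ℝ, 0 ≤ C ∧
      ∀ᶠ X : ℝ in atTop, ∀ Q : ℝ, 1 ≤ Q → Q ≤ c * X → ∀ t : ℝ,
        ∫ α in Set.Ioc t (t + 1) ∩ minorArcs k X Q, ‖expSum a k α X‖ ^ s ≤
          C * (count a X ^ (s + ω + ε) / X ^ k) * Q ^ (-(ϱ * (s - 2 * t₀))) := by
  obtain ⟨c, hc, hWu⟩ := H.weyl
  refine ⟨c, hc, fun s ε hs hε => ?_⟩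
  have hst : 0 < (s : ℝ) - 2 * t₀ := by linarith
  obtain ⟨C, hC, hCu⟩ := hWu (ε / (s - 2 * t₀)) (by positivity)
  obtain ⟨C', hC', hm⟩ := H.mean t₀ le_rfl
  refine ⟨C ^ ((s : ℝ) - 2 * t₀) * C', by positivity, ?_⟩
  filter_upwards [hCu, hm, eventually_gt_atTop (0 : ℝ),
    H.top.eventually_gt_atTop 0] with X h1 h2 h3 h4 Q hQ hQX t
  have hQ0 : 0 < Q := by linarith
  set M := C * count a X * Q ^ (-ϱ) * count a X ^ (ε / (s - 2 * t₀)) with hM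
  have hM0 : 0 ≤ M := by positivity
  have hcont : Continuous fun α => ‖expSum a k α X‖ ^ (2 * t₀) :=
    (continuous_expSum X).norm.rpow_const fun _ => Or.inr (by linarith [H.t_nonneg])
  have hint : IntegrableOn (fun α => ‖expSum a k α X‖ ^ (2 * t₀)) (Set.Ioc t (t + 1)) :=
    (hcont.continuousOn.integrableOn_compact isCompact_Icc).mono_set Set.Ioc_subset_Icc_self
  have hper : ∫ α in Set.Ioc t (t + 1), ‖expSum a k α X‖ ^ (2 * t₀) = meanValue a k t₀ X := by
    rw [meanValue, ← intervalIntegral.integral_of_le (by linarith)]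
    have hp : Function.Periodic (fun α => ‖expSum a k α X‖ ^ (2 * t₀)) 1 := fun α => by
      have := periodic_expSum (a := a) (k := k) X α
      simp only at this ⊢
      rw [this]
    have := hp.intervalIntegral_add_eq t 0
    simpa using this
  have hstep : ∫ α in Set.Ioc t (t + 1) ∩ minorArcs k X Q, ‖expSum a k α X‖ ^ s ≤
      M ^ ((s : ℝ) - 2 * t₀) * meanValue a k t₀ X := by
    calc ∫ α in Set.Ioc t (t + 1) ∩ minorArcs k X Q, ‖expSum a k α X‖ ^ s
        ≤ ∫ α in Set.Ioc t (t + 1) ∩ minorArcs k X Q,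
          M ^ ((s : ℝ) - 2 * t₀) * ‖expSum a k α X‖ ^ (2 * t₀) := by
          refine setIntegral_mono_on (integrableOn_norm_expSum_pow s X t _)
            ((hint.mono_set Set.inter_subset_left).const_mul _)
            (measurableSet_Ioc.inter measurableSet_minorArcs) fun α hα => ?_
          have h5 := h1 Q hQ hQX α hα.2
          have : ‖expSum a k α X‖ ^ s = ‖expSum a k α X‖ ^ ((s : ℝ) - 2 * t₀) *
              ‖expSum a k α X‖ ^ (2 * t₀) := by
            rw [← Real.rpow_add_of_nonneg (norm_nonneg _) hst.le (by linarith [H.t_nonneg]),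
              ← Real.rpow_natCast]
            congr 1; ring
          rw [this]
          gcongr
      _ = M ^ ((s : ℝ) - 2 * t₀) *
          ∫ α in Set.Ioc t (t + 1) ∩ minorArcs k X Q, ‖expSum a k α X‖ ^ (2 * t₀) :=
        integral_const_mul _ _
      _ ≤ _ := by
        rw [← hper]
        refine mul_le_mul_of_nonneg_left (setIntegral_mono_set hint
          (ae_of_all _ fun α => by positivity)
          (Set.inter_subset_left.eventuallyLE)) (by positivity)
  refine hstep.trans ((mul_le_mul_of_nonneg_left h2 (by positivity)).trans (le_of_eq ?_))
  have hMp : M ^ ((s : ℝ) - 2 * t₀) = C ^ ((s : ℝ) - 2 * t₀) *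
      count a X ^ ((s : ℝ) - 2 * t₀) * Q ^ (-(ϱ * (s - 2 * t₀))) * count a X ^ ε := by
    rw [hM, Real.mul_rpow (by positivity) (by positivity),
      Real.mul_rpow (by positivity) (by positivity), Real.mul_rpow (by positivity) (by positivity),
      ← Real.rpow_mul hQ0.le, ← Real.rpow_mul h4.le]
    congr 2
    · congr 2; ring
    · field_simp
  rw [hMp]
  have : count a X ^ (s + ω + ε) = count a X ^ ((s : ℝ) - 2 * t₀) * count a X ^ ε *
      count a X ^ (2 * t₀ + ω) := by
    rw [← Real.rpow_add h4, ← Real.rpow_add h4]; congr 1; ring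
  rw [this]; ring

theorem eventually_level (H : Regular a k κ t₀ ϱ ω) {c : ℝ} (hc : 0 < c) :
    ∀ᶠ X : ℝ in atTop, 1 ≤ count a X ^ (1 / 5 : ℝ) ∧ count a X ^ (1 / 5 : ℝ) ≤ c * X := by
  filter_upwards [H.top.eventually_ge_atTop 1, H.eventually_mul_count_rpow_le
    (p := 1 / 5) (q := 1) (by norm_num) (by norm_num) (1 / c)] with X h1 h2
  refine ⟨Real.one_le_rpow h1 (by norm_num), ?_⟩
  rw [Real.rpow_one, one_div, inv_mul_le_iff₀ hc] at h2
  exact h2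

/-- At level A^{1/5} the Weyl saving is A^{ϱ(s-2t₀)/5}, and it has to beat the loss A^ω of the mean
value: this is where the 5 in the condition on s comes from. Half of the surplus is spent on ε, half
is kept as η. -/
theorem exists_minor_saving (H : Regular a k κ t₀ ϱ ω) {s : ℕ} (hs : 2 * t₀ + 5 * ω / ϱ < s) :
    ∃ η C : ℝ, 0 < η ∧ 0 ≤ C ∧ ∀ᶠ X : ℝ in atTop, ∀ t : ℝ,
      ∫ α in Set.Ioc t (t + 1) ∩ minorArcs k X (count a X ^ (1 / 5 : ℝ)), ‖expSum a k α X‖ ^ s ≤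
        C * (count a X ^ (s - η) / X ^ k) := by
  have hϱ := H.ϱ_pos
  have hω := H.ω_nonneg
  have h5 : 0 ≤ 5 * ω / ϱ := by positivity
  have hτ : 0 < ϱ * (s - 2 * t₀) / 5 - ω := by
    have : 5 * ω / ϱ < s - 2 * t₀ := by linarith
    rw [div_lt_iff₀ hϱ] at this
    linarith
  obtain ⟨c, hc, hm⟩ := H.exists_minor_bound
  obtain ⟨C, hC, hm⟩ := hm s ((ϱ * (s - 2 * t₀) / 5 - ω) / 2) (by linarith) (by linarith)
  refine ⟨(ϱ * (s - 2 * t₀) / 5 - ω) / 2, C, by linarith, hC, ?_⟩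
  filter_upwards [hm, H.eventually_level hc, H.top.eventually_gt_atTop 0] with X h1 h2 h3 t
  refine (h1 _ h2.1 h2.2 t).trans (le_of_eq ?_)
  rw [← Real.rpow_mul h3.le, mul_assoc, div_mul_eq_mul_div, ← Real.rpow_add h3]
  congr 3
  ring

theorem exists_sq_count_le (H : Regular a k κ t₀ ϱ ω) (X Q : ℝ) (hX : 0 < X) (hQ : 0 ≤ Q) (s : ℕ) :
    ∫ α in Set.Ioc (0 : ℝ) 1 ∩ majorArcs k X Q, ‖expSum a k α X‖ ^ s ≤
      count a X ^ s * (4 * Q ^ 2 / X ^ k) := by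
  have hc := count_nonneg H.nonneg X
  have hfin : volume (Set.Ioc (0 : ℝ) 1 ∩ majorArcs k X Q) < ⊤ :=
    (measure_mono Set.inter_subset_left).trans_lt (by simp)
  have h := norm_setIntegral_le_of_norm_le_const (f := fun α => ‖expSum a k α X‖ ^ s)
    (C := count a X ^ s) hfin fun α _ => by
      rw [norm_pow, norm_norm]
      exact pow_le_pow_left₀ (norm_nonneg _) (norm_expSum_le H.nonneg _ _) _
  refine (le_abs_self _).trans (h.trans ?_)
  rw [Set.inter_comm]
  exact mul_le_mul_of_nonneg_left (volume_majorArcs_inter_le hX hQ) (by positivity)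

/-- By Parseval the second moment is at least A²/X. At level X^{1/4} the major arcs are too short to
account for it, so the minor arcs do, and their square saving X^{ϱ/2} cannot exceed X by a power. -/
theorem ϱ_le_two (H : Regular a k κ t₀ ϱ ω) : ϱ ≤ 2 := by
  by_contra hcon
  push Not at hcon
  obtain ⟨c, hc, hWu⟩ := H.weyl
  -- So 1 - ϱ/2 = -4ε; the Weyl losses cost at most X^{3ε}, and X^{-ε} remains for the
  -- contradiction.
  set ε := (ϱ / 2 - 1) / 4 with hε
  have hε0 : 0 < ε := by rw [hε]; linarith
  obtain ⟨C, hC, hCu⟩ := hWu ε hε0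
  have hlevel : ∀ᶠ X : ℝ in atTop, X ^ (1 / 4 : ℝ) ≤ c * X := by
    filter_upwards [eventually_mul_rpow_le (p := 1 / 4) (q := 1) (by norm_num) (1 / c)] with X h
    rw [Real.rpow_one, one_div, inv_mul_le_iff₀ hc] at h
    exact h
  have hev : ∀ᶠ X : ℝ in atTop, False := by
    filter_upwards [hCu, hlevel, eventually_ge_atTop (1 : ℝ), eventually_gt_atTop (16 ^ 2 : ℝ),
      H.top.eventually_gt_atTop 0,
      H.eventually_mul_count_rpow_le (p := 2 * ε) (q := 3 * ε) (by positivity) (by linarith)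
        (4 * C ^ 2), (tendsto_rpow_atTop hε0).eventually_gt_atTop 2] with X h1 h2 h3 h4 h5 h6 h7
    have hX0 : 0 < X := by linarith
    set Q := X ^ (1 / 4 : ℝ) with hQ
    have hQ1 : 1 ≤ Q := Real.one_le_rpow h3 (by norm_num)
    have hP := sq_count_le_mul_integral (a := a) H.ne_zero hX0.le
    rw [intervalIntegral.integral_of_le zero_le_one] at hP
    have hsplit := setIntegral_major_add_minor (a := a) (k := k) 2 X Q 0
    rw [zero_add] at hsplit
    rw [hsplit] at hP
    have hM := H.exists_sq_count_le X Q hX0 (by linarith) 2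
    have hfin : volume (Set.Ioc (0 : ℝ) 1 ∩ minorArcs k X Q) < ⊤ :=
      (measure_mono Set.inter_subset_left).trans_lt (by simp)
    have hm := norm_setIntegral_le_of_norm_le_const (f := fun α => ‖expSum a k α X‖ ^ 2)
      (C := (C * count a X * Q ^ (-ϱ) * count a X ^ ε) ^ 2) hfin fun α hα => by
        rw [norm_pow, norm_norm]
        exact pow_le_pow_left₀ (norm_nonneg _) (h1 Q hQ1 h2 α hα.2) _
    have hvol : volume.real (Set.Ioc (0 : ℝ) 1 ∩ minorArcs k X Q) ≤ 1 := by
      have := measureReal_mono (μ := volume) (s₁ := Set.Ioc (0 : ℝ) 1 ∩ minorArcs k X Q)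
        (s₂ := Set.Ioc (0 : ℝ) 1) Set.inter_subset_left (by simp)
      simpa using this
    have hm' := (le_abs_self _).trans (hm.trans (mul_le_of_le_one_right (by positivity) hvol))
    set A := count a X with hA
    have hQ2 : Q ^ 2 = X ^ (1 / 2 : ℝ) := by
      rw [hQ, ← Real.rpow_natCast, ← Real.rpow_mul hX0.le]; norm_num
    have hsqrt : 16 < X ^ (1 / 2 : ℝ) := by
      rw [← Real.sqrt_eq_rpow]; exact Real.lt_sqrt_of_sq_lt h4
    have hss : X ^ (1 / 2 : ℝ) * X ^ (1 / 2 : ℝ) = X := by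
      rw [← Real.rpow_add hX0]; norm_num
    have hXk : X ^ 2 ≤ X ^ k := pow_le_pow_right₀ h3 H.two_le
    have hbM : X * (4 * Q ^ 2 / X ^ k) ≤ 1 / 4 := by
      rw [hQ2]
      calc X * (4 * X ^ (1 / 2 : ℝ) / X ^ k) ≤ X * (4 * X ^ (1 / 2 : ℝ) / X ^ 2) := by gcongr
        _ = 4 * X ^ (1 / 2 : ℝ) / X := by field_simp
        _ ≤ 1 / 4 := by
          rw [div_le_iff₀ hX0]
          nlinarith
    have hQϱ : (Q ^ (-ϱ)) ^ 2 = X ^ (-(ϱ / 2)) := by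
      rw [hQ, ← Real.rpow_natCast, ← Real.rpow_mul hX0.le, ← Real.rpow_mul hX0.le]
      congr 1; push_cast; ring
    have hAε : (A ^ ε) ^ 2 = A ^ (2 * ε) := by
      rw [← Real.rpow_natCast, ← Real.rpow_mul h5.le]
      congr 1; push_cast; ring
    have hbm : X * (C ^ 2 * X ^ (-(ϱ / 2)) * A ^ (2 * ε)) ≤ 1 / 4 := by
      have h8 : C ^ 2 * A ^ (2 * ε) ≤ X ^ (3 * ε) / 4 := by linarith
      have h9 : X * X ^ (-(ϱ / 2)) * X ^ (3 * ε) = X ^ (-ε) := by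
        rw [mul_assoc, ← Real.rpow_add hX0, ← Real.rpow_one_add' hX0.le]
        · congr 1; rw [hε]; ring
        · rw [hε]; intro h; linarith
      calc X * (C ^ 2 * X ^ (-(ϱ / 2)) * A ^ (2 * ε))
          = X * X ^ (-(ϱ / 2)) * (C ^ 2 * A ^ (2 * ε)) := by ring
        _ ≤ X * X ^ (-(ϱ / 2)) * (X ^ (3 * ε) / 4) := by gcongr
        _ = X ^ (-ε) / 4 := by rw [← h9]; ring
        _ ≤ 1 / 4 := by
          gcongr
          exact Real.rpow_le_one_of_one_le_of_nonpos h3 (by linarith)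
    have hfinal : A ^ 2 ≤ A ^ 2 * (1 / 4) + A ^ 2 * (1 / 4) := by
      calc A ^ 2 ≤ X * (A ^ 2 * (4 * Q ^ 2 / X ^ k) + (C * A * Q ^ (-ϱ) * A ^ ε) ^ 2) := by
            refine hP.trans ?_
            gcongr
        _ = A ^ 2 * (X * (4 * Q ^ 2 / X ^ k)) +
            A ^ 2 * (X * (C ^ 2 * (Q ^ (-ϱ)) ^ 2 * (A ^ ε) ^ 2)) := by ring
        _ ≤ _ := by
          rw [hQϱ, hAε]
          gcongr
    nlinarith
  exact hev.exists.elim fun _ h => h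

/-- For s ≤ 2 the trivial inequality |f|² ≤ A^{2-s}|f|^s turns the bound for the s-th moment into a
second moment of size A^{2+2/5}/X^k. This is o(A²/X), because k ≥ 2 and A ≪ X, against the Parseval
lower bound. -/
theorem three_le (H : Regular a k κ t₀ ϱ ω) {s : ℕ} (hs : 2 * t₀ + 5 * ω / ϱ < s) : 3 ≤ s := by
  by_contra hcon
  have hs2 : s ≤ 2 := by omega
  obtain ⟨η, C, hη, hC, hm⟩ := H.exists_minor_saving hs
  have hev : ∀ᶠ X : ℝ in atTop, False := by
    filter_upwards [hm, eventually_ge_atTop (1 : ℝ), H.top.eventually_ge_atTop 1,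
      H.eventually_mul_count_rpow_le (p := 2 / 5) (q := 1) (by norm_num) (by norm_num)
        (2 * (C + 4))] with X h1 h3 h5 h6
    have hX0 : 0 < X := by linarith
    set A := count a X with hA
    have hA0 : 0 < A := by linarith
    have hP := sq_count_le_mul_integral (a := a) H.ne_zero hX0.le
    rw [intervalIntegral.integral_of_le zero_le_one] at hP
    have hsplit := setIntegral_major_add_minor (a := a) (k := k) s X (A ^ (1 / 5 : ℝ)) 0
    have hm0 := h1 0
    rw [zero_add] at hsplit hm0
    have hM := H.exists_sq_count_le X (A ^ (1 / 5 : ℝ)) hX0 (by positivity) s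
    have hY : (A ^ (1 / 5 : ℝ)) ^ 2 = A ^ (2 / 5 : ℝ) := by
      rw [← Real.rpow_natCast, ← Real.rpow_mul hA0.le]; norm_num
    have hone : 1 ≤ A ^ (2 / 5 : ℝ) := Real.one_le_rpow h5 (by norm_num)
    have hsη : A ^ ((s : ℝ) - η) ≤ A ^ s := by
      rw [← Real.rpow_natCast]
      exact Real.rpow_le_rpow_of_exponent_le h5 (by linarith)
    have hI : ∫ α in Set.Ioc (0 : ℝ) 1, ‖expSum a k α X‖ ^ s ≤
        (C + 4) * A ^ s * A ^ (2 / 5 : ℝ) / X ^ k := by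
      rw [hsplit]
      rw [hY, ← hA] at hM
      calc _ ≤ A ^ s * (4 * A ^ (2 / 5 : ℝ) / X ^ k) + C * (A ^ ((s : ℝ) - η) / X ^ k) :=
            add_le_add hM hm0
        _ ≤ A ^ s * (4 * A ^ (2 / 5 : ℝ) / X ^ k) + C * (A ^ s * A ^ (2 / 5 : ℝ) / X ^ k) := by
            gcongr
            exact hsη.trans (le_mul_of_one_le_right (by positivity) hone)
        _ = _ := by ring
    have hI2 : ∫ α in Set.Ioc (0 : ℝ) 1, ‖expSum a k α X‖ ^ 2 ≤
        A ^ (2 - s) * ∫ α in Set.Ioc (0 : ℝ) 1, ‖expSum a k α X‖ ^ s := by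
      rw [← integral_const_mul]
      refine setIntegral_mono_on ?_ ?_ measurableSet_Ioc fun α _ => ?_
      · simpa using integrableOn_norm_expSum_pow 2 X 0 Set.univ
      · have := integrableOn_norm_expSum_pow (a := a) (k := k) s X 0 Set.univ
        simp only [zero_add, Set.inter_univ] at this
        exact this.const_mul _
      · have : ‖expSum a k α X‖ ^ 2 = ‖expSum a k α X‖ ^ (2 - s) * ‖expSum a k α X‖ ^ s := by
          rw [← pow_add]; congr 1; omega
        rw [this]
        gcongr
        exact norm_expSum_le H.nonneg _ _
    have h7 : A ^ 2 ≤ A ^ 2 * (X * ((C + 4) * A ^ (2 / 5 : ℝ) / X ^ k)) := by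
      calc A ^ 2 ≤ X * (A ^ (2 - s) * ((C + 4) * A ^ s * A ^ (2 / 5 : ℝ) / X ^ k)) := by
            refine hP.trans ?_
            gcongr
            refine hI2.trans ?_
            gcongr
        _ = (A ^ (2 - s) * A ^ s) * (X * ((C + 4) * A ^ (2 / 5 : ℝ) / X ^ k)) := by ring
        _ = _ := by rw [← pow_add]; congr 2; omega
    have h8 : X * ((C + 4) * A ^ (2 / 5 : ℝ) / X ^ k) ≤ 1 / 2 := by
      rw [Real.rpow_one] at h6
      have hXk : X ^ 2 ≤ X ^ k := pow_le_pow_right₀ h3 H.two_le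
      rw [mul_div_assoc', div_le_iff₀ (by positivity)]
      nlinarith
    nlinarith
  exact hev.exists.elim fun _ h => h

/-- Jensen's inequality with the tangent line at m, supplied by Bernoulli's inequality. -/
theorem one_le_integral_rpow_of_integral {f : ℝ → ℝ} (hf : Continuous f) (hf0 : ∀ x, 0 ≤ f x)
    {p m : ℝ} (hp : 1 ≤ p) (hm0 : 0 < m) (hm : m ≤ ∫ x in (0 : ℝ)..1, f x) :
    m ^ p ≤ ∫ x in (0 : ℝ)..1, f x ^ p := by
  have hcont : Continuous fun x => f x ^ p :=
    hf.rpow_const fun _ => Or.inr (by linarith)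
  have h1 : ∀ x, m ^ p * (1 + p * (f x / m - 1)) ≤ f x ^ p := by
    intro x
    have h2 : (-1 : ℝ) ≤ f x / m - 1 := by have := div_nonneg (hf0 x) hm0.le; linarith
    have h3 := one_add_mul_self_le_rpow_one_add h2 hp
    have h4 : f x ^ p = m ^ p * (1 + (f x / m - 1)) ^ p := by
      rw [← Real.mul_rpow hm0.le (by linarith)]
      congr 1; field_simp; ring
    rw [h4]
    gcongr
  have h5 : ∫ x in (0 : ℝ)..1, m ^ p * (1 + p * (f x / m - 1)) ≤ ∫ x in (0 : ℝ)..1, f x ^ p :=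
    intervalIntegral.integral_mono_on zero_le_one
      ((by fun_prop : Continuous _).intervalIntegrable _ _) (hcont.intervalIntegrable _ _)
      fun x _ => h1 x
  refine le_trans ?_ h5
  have hfi : IntervalIntegrable (fun x => f x / m) volume 0 1 :=
    (hf.div_const m).intervalIntegrable _ _
  rw [intervalIntegral.integral_const_mul, intervalIntegral.integral_add (by simp)
    ((hfi.sub (by simp)).const_mul p), intervalIntegral.integral_const_mul,
    intervalIntegral.integral_sub hfi (by simp), intervalIntegral.integral_div]
  simp only [intervalIntegral.integral_const, sub_zero, smul_eq_mul, mul_one]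
  have : 1 ≤ (∫ x in (0 : ℝ)..1, f x) / m := by rwa [one_le_div hm0]
  have hmp : 0 < m ^ p := by positivity
  refine le_mul_of_one_le_right hmp.le ?_
  nlinarith

/-- A single non-zero weight keeps the p-th moment away from 0, so the mean value bound yields X^k ≪
A^{p+ω} with p = max(2t₀, 1). It makes bounded error terms admissible. -/
theorem exists_pow_le_count (H : Regular a k κ t₀ ϱ ω) {s : ℕ} (hs : 2 * t₀ + 5 * ω / ϱ < s) :
    ∃ η C : ℝ, 0 < η ∧ 0 ≤ C ∧ ∀ᶠ X : ℝ in atTop, X ^ k ≤ C * count a X ^ (s - η) := by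
  have hϱ := H.ϱ_pos
  have hϱ2 := H.ϱ_le_two
  have hω := H.ω_nonneg
  set p := max (2 * t₀) 1 with hp
  obtain ⟨m, hm1, hm⟩ : ∃ m : ℕ, 1 ≤ m ∧ 0 < a m := by
    by_contra hcon
    push Not at hcon
    have h0 : ∀ X, count a X ≤ 0 := fun X =>
      Finset.sum_nonpos fun n hn => hcon n (Finset.mem_Icc.1 hn).1
    obtain ⟨X, hX⟩ := (H.top.eventually_gt_atTop 0).exists
    linarith [h0 X]
  obtain ⟨C, hC, hmean⟩ := H.mean (p / 2) (by
    have := le_max_left (2 * t₀) 1; linarith)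
  have hlow : ∀ᶠ X : ℝ in atTop, X ^ k ≤ C / a m ^ p * count a X ^ (p + ω) := by
    filter_upwards [hmean, eventually_ge_atTop (max m 1 : ℝ)] with X h1 h2
    have hX0 : 0 < X := by linarith [le_max_right (m : ℝ) 1]
    have h3 := coeff_le_integral_norm (a := a) H.ne_zero (X := X) (m := m)
      (Finset.mem_Icc.2 ⟨hm1, Nat.le_floor ((le_max_left _ _).trans h2)⟩)
    have h4 := one_le_integral_rpow_of_integral (continuous_expSum (a := a) (k := k) X).norm
      (fun _ => norm_nonneg _) (le_max_right (2 * t₀) 1) hm h3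
    have h5 : meanValue a k (p / 2) X = ∫ x in (0 : ℝ)..1, ‖expSum a k x X‖ ^ p := by
      rw [meanValue]; congr 1; ext x; congr 1; ring
    rw [h5, show 2 * (p / 2) + ω = p + ω by ring] at h1
    have h6 := h4.trans h1
    have hap : 0 < a m ^ p := by positivity
    rw [mul_div_assoc', le_div_iff₀ (by positivity)] at h6
    rw [div_mul_eq_mul_div, le_div_iff₀ hap]
    linarith
  have hlt : p + ω < s := by
    -- As ϱ ≤ 2, the condition on s gives s > 2t₀ + 5ω/2, which settles the case 2t₀ ≥ 1.
    have h5 : ω * (5 / 2) ≤ 5 * ω / ϱ := by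
      rw [le_div_iff₀ hϱ]; nlinarith
    rcases le_total 1 (2 * t₀) with h | h
    · rw [hp, max_eq_left h]; nlinarith
    · rw [hp, max_eq_right h] at hlow ⊢
      -- When p = 1, an ω below 1 would make X^k ≪ A^{1+ω} fail, since A ≪ X and k ≥ 2. With ω ≥ 1
      -- one has 1 + ω ≤ 2ω < s.
      have hω1 : 1 ≤ ω := by
        by_contra hcon
        push Not at hcon
        have hev : ∀ᶠ X : ℝ in atTop, False := by
          filter_upwards [hlow, H.eventually_mul_count_rpow_le (p := 1 + ω) (q := 2)
            (by positivity) (by linarith) (2 * (C / a m ^ (1 : ℝ))),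
            eventually_ge_atTop (1 : ℝ)] with X h1 h2 h3
          have hXk : X ^ 2 ≤ X ^ k := pow_le_pow_right₀ h3 H.two_le
          have : X ^ (2 : ℝ) = X ^ 2 := by norm_cast
          rw [this] at h2
          nlinarith
        exact hev.exists.elim fun _ h => h
      have := H.t_nonneg
      nlinarith
  refine ⟨s - (p + ω), C / a m ^ p, by linarith, by positivity, ?_⟩
  simpa using hlow

end Regular

theorem sum_fractions {E : Type*} [AddCommMonoid E] (t : Finset ℕ) (F : (Σ _ : ℕ, ℕ) → E) :
    ∑ x ∈ fractions t, F x = ∑ q ∈ t, ∑ b ∈ reducedResidues q, F ⟨q, b⟩ :=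
  Finset.sum_sigma _ _ _

theorem card_fractions_le {t : Finset ℕ} {N : ℕ} (hN : ∀ q ∈ t, q ≤ N) :
    (fractions t).card ≤ t.card * N := by
  rw [fractions, Finset.card_sigma]
  exact Finset.sum_le_card_nsmul _ _ _ fun q hq => (card_reducedResidues_le q).trans (hN q hq)

/-! ### Absolute convergence of the singular series. -/

namespace Regular
variable {a : ℕ → ℝ} {k : ℕ} {κ : (q : ℕ) → ZMod q → ℝ} {t₀ ϱ ω : ℝ}

/-- Bounded weights mean that A has no jump larger than B, so it comes close to any prescribed
positive value. -/
theorem exists_natCast_count_near (H : Regular a k κ t₀ ϱ ω) {B : ℝ}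
    (hB : ∀ n, 1 ≤ n → a n ≤ B) {T : ℝ} (hT : 0 < T) :
    ∃ N : ℕ, T ≤ count a N ∧ count a N ≤ T + B := by
  classical
  have hex : ∃ N : ℕ, T ≤ count a N :=
    ((H.top.comp tendsto_natCast_atTop_atTop).eventually_ge_atTop T).exists
  refine ⟨Nat.find hex, Nat.find_spec hex, ?_⟩
  rcases hN : Nat.find hex with _ | m
  · have := Nat.find_spec hex
    rw [hN] at this
    simp [count] at this
    linarith
  · have h1 := Nat.find_min hex (m := m) (by omega)
    push Not at h1
    rw [count_succ]
    have := hB (m + 1) (by omega)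
    linarith

/-- For |β| ≤ r all phases β n^k are so small that |f(β)| ≥ A/2. Hence |S(q,b)| A/2 is at most
|f(b/q + β)| plus an error O(m), and the s-th power is averaged over β. -/
theorem norm_completeSum_pow_le (H : Regular a k κ t₀ ϱ ω) {D : ℝ} (hD0 : 0 < D)
    (hD : ∀ q : ℕ, 1 ≤ q → ∀ (b : ZMod q) (X : ℝ),
      |countMod a q b X - κ q b * count a X| ≤ D) (s : ℕ) {m N r : ℝ} (hN0 : 0 < N)
    (hA0 : 0 < count a N) (hr : r = 1 / (4 * Real.pi * N ^ k)) (x : Σ _ : ℕ, ℕ)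
    (hx1 : 1 ≤ x.1) (hxm : (x.1 : ℝ) ≤ 2 * m) :
    ‖completeSum κ k x.1 x.2‖ ^ s ≤
      4 ^ s * ((∫ β in Set.Icc (-r) r, ‖expSum a k (fracPt x + β) N‖ ^ s) *
        (2 * Real.pi * N ^ k) / count a N ^ s + (4 * D * m) ^ s / count a N ^ s) := by
  have hpi := Real.pi_gt_three
  have hXk0 : (0 : ℝ) < N ^ k := by positivity
  have hr0 : 0 < r := by rw [hr]; positivity
  have hm0 : 0 < m := by
    have : (1 : ℝ) ≤ x.1 := by exact_mod_cast hx1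
    linarith
  set A := count a N with hA
  have hpt : ∀ β ∈ Set.Icc (-r) r, ‖completeSum κ k x.1 x.2‖ ^ s * (A / 2) ^ s ≤
      2 ^ s * (‖expSum a k (fracPt x + β) N‖ ^ s + (4 * D * m) ^ s) := by
    intro β hβ
    have hβr : |β| ≤ r := abs_le.2 hβ
    have hβk : |β| * N ^ k ≤ r * N ^ k := by gcongr
    have h2π : 2 * Real.pi * (|β| * N ^ k) ≤ 1 / 2 := by
      calc _ ≤ 2 * Real.pi * (r * N ^ k) := by gcongr
        _ = 1 / 2 := by rw [hr]; field_simp; norm_num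
    have h1 := norm_expSum_sub_le H.ne_zero hD hx1 x.2 β hN0.le
    have h2 := norm_expSum_sub_count_le (k := k) H.nonneg β hN0.le
    rw [← hA] at h2
    have h3 : A / 2 ≤ ‖expSum a k β N‖ := by
      have h4 := norm_sub_norm_le (A : ℂ) (A - expSum a k β N)
      rw [sub_sub_cancel, norm_sub_rev, Complex.norm_real, Real.norm_of_nonneg hA0.le] at h4
      have : A * (2 * Real.pi * (|β| * N ^ k)) ≤ A * (1 / 2) := by gcongr
      linarith
    have h5 : ‖completeSum κ k x.1 x.2‖ * (A / 2) ≤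
        ‖expSum a k (fracPt x + β) N‖ + 4 * D * m := by
      calc ‖completeSum κ k x.1 x.2‖ * (A / 2) ≤
          ‖completeSum κ k x.1 x.2‖ * ‖expSum a k β N‖ := by gcongr
        _ = ‖completeSum κ k x.1 x.2 * expSum a k β N‖ := (norm_mul _ _).symm
        _ ≤ ‖expSum a k (fracPt x + β) N‖ + ‖expSum a k (fracPt x + β) N -
            completeSum κ k x.1 x.2 * expSum a k β N‖ := by
          have := norm_sub_le (expSum a k (fracPt x + β) N) (expSum a k (fracPt x + β) N -
            completeSum κ k x.1 x.2 * expSum a k β N)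
          rwa [sub_sub_cancel] at this
        _ ≤ ‖expSum a k (fracPt x + β) N‖ + D * x.1 * (1 + 1 / 2) := by
          gcongr
          exact h1.trans (by gcongr)
        -- The error D q (1 + 1/2) with q ≤ 2m is 3Dm, rounded up to 4Dm.
        _ ≤ _ := by nlinarith
    rw [← mul_pow]
    refine (pow_le_pow_left₀ (by positivity) h5 s).trans ?_
    exact add_pow_le_two_pow_mul (norm_nonneg _) (by positivity) s
  have hcont : Continuous fun β => ‖expSum a k (fracPt x + β) N‖ ^ s :=
    (((continuous_expSum (a := a) (k := k) (N : ℝ)).comp (by fun_prop :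
      Continuous fun β => fracPt x + β)).norm.pow s)
  have hi1 : IntegrableOn (fun β => ‖expSum a k (fracPt x + β) N‖ ^ s) (Set.Icc (-r) r) :=
    hcont.continuousOn.integrableOn_compact isCompact_Icc
  have hi2 : ∀ C : ℝ, IntegrableOn (fun _ : ℝ => C) (Set.Icc (-r) r) := fun C =>
    continuousOn_const.integrableOn_compact isCompact_Icc
  have hvol : ∀ C : ℝ, ∫ _ in Set.Icc (-r) r, C = 2 * r * C := by
    intro C
    rw [setIntegral_const, Real.volume_real_Icc_of_le (by linarith), smul_eq_mul]
    ring
  have hI := setIntegral_mono_on (hi2 _) ((hi1.add (hi2 _)).const_mul (2 ^ s)) measurableSet_Icc hpt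
  simp only [Pi.add_apply] at hI
  rw [hvol, integral_const_mul, integral_add hi1 (hi2 _), hvol] at hI
  have h2r : 2 * r * (2 * Real.pi * N ^ k) = 1 := by
    rw [hr]; field_simp; norm_num
  have hkey : ‖completeSum κ k x.1 x.2‖ ^ s * (A / 2) ^ s ≤ 2 ^ s *
      ((∫ β in Set.Icc (-r) r, ‖expSum a k (fracPt x + β) N‖ ^ s) *
        (2 * Real.pi * N ^ k) + (4 * D * m) ^ s) := by
    have := mul_le_mul_of_nonneg_right hI (by positivity : 0 ≤ 2 * Real.pi * N ^ k)
    calc _ = (2 * r * (2 * Real.pi * N ^ k)) *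
          (‖completeSum κ k x.1 x.2‖ ^ s * (A / 2) ^ s) := by rw [h2r, one_mul]
      _ ≤ 2 ^ s * ((∫ β in Set.Icc (-r) r, ‖expSum a k (fracPt x + β) N‖ ^ s) *
        (2 * Real.pi * N ^ k) + (2 * r * (2 * Real.pi * N ^ k)) * (4 * D * m) ^ s) := by
          linarith
      _ = _ := by rw [h2r, one_mul]
  have e1 : (4 : ℝ) ^ s = 2 ^ s * 2 ^ s := by rw [← mul_pow]; norm_num
  rw [div_pow, mul_div_assoc', div_le_iff₀ (by positivity), ← le_div_iff₀ (by positivity)] at hkey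
  refine hkey.trans (le_of_eq ?_)
  rw [e1]; ring

set_option maxHeartbeats 800000 in
-- At N with A(N) of size m², intervals of length about N^{-k} around the fractions with m < q ≤ 2m
-- are disjoint and lie on the minor arcs of level m. The minor arc moment gives
-- m^{2(ω+ε)-ϱ(s-2t₀)}, and the approximation error gives m² fractions times (m/m²)^s, which is at
-- most 1/m since s ≥ 3.
theorem exists_dyadic_bound (H : Regular a k κ t₀ ϱ ω) {s : ℕ} (hs : 2 * t₀ + 5 * ω / ϱ < s) :
    ∃ σ C : ℝ, ∃ m₀ : ℕ, 0 < σ ∧ (σ = 1 ∨ 3 * ω < σ) ∧ 0 ≤ C ∧ 1 ≤ m₀ ∧ ∀ m : ℕ, m₀ ≤ m →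
      ∑ x ∈ fractions (Finset.Ioc m (2 * m)), ‖completeSum κ k x.1 x.2‖ ^ s ≤
        C * (m : ℝ) ^ (-σ) := by
  have hϱ := H.ϱ_pos
  have hω := H.ω_nonneg
  have hs3 := H.three_le hs
  have h5 : 0 ≤ 5 * ω / ϱ := by positivity
  have hτ : 0 < ϱ * (s - 2 * t₀) - 5 * ω := by
    have : 5 * ω / ϱ < s - 2 * t₀ := by linarith
    rw [div_lt_iff₀ hϱ] at this
    linarith
  set τ := ϱ * (s - 2 * t₀) - 5 * ω with hτdef
  obtain ⟨B, hB0, hB⟩ := H.bound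
  obtain ⟨D, hD0, hD⟩ := H.disc
  obtain ⟨c, hc, hm⟩ := H.exists_minor_bound
  obtain ⟨C, hC, hm⟩ := hm s (τ / 4) (by linarith) (by linarith)
  obtain ⟨X₀, hX₀⟩ := eventually_atTop.1 hm
  -- With ϱ(s - 2t₀) = 5ω + τ and ε = τ/4 the exponent of the first contribution is -(3ω + τ/2). The
  -- resulting alternative, σ = 1 or σ > 3ω, is what the completion of the major arcs needs.
  refine ⟨min 1 (3 * ω + τ / 2), 4 ^ s * (2 * Real.pi * C * 2 ^ (ω + τ / 4) + 2 * (4 * D) ^ s),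
    max 2 ⌈max (max (B * |X₀|) B) (max (B / c) (16 * B ^ 2))⌉₊, ?_, ?_, ?_, ?_, ?_⟩
  · exact lt_min one_pos (by linarith)
  · rcases le_total 1 (3 * ω + τ / 2) with h | h
    · left; exact min_eq_left h
    · right; rw [min_eq_right h]; linarith
  · positivity
  · exact le_trans (by norm_num) (le_max_left _ _)
  intro m hmm
  have hm2 : 2 ≤ m := (le_max_left _ _).trans hmm
  have hmR : (2 : ℝ) ≤ m := by exact_mod_cast hm2
  have hmbig := (Nat.le_ceil _).trans (Nat.cast_le (α := ℝ).2 ((le_max_right _ _).trans hmm))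
  have hm_a : B * |X₀| ≤ m := ((le_max_left _ _).trans (le_max_left _ _)).trans hmbig
  have hm_b : B ≤ m := ((le_max_right _ _).trans (le_max_left _ _)).trans hmbig
  have hm_c : B / c ≤ m := ((le_max_left _ _).trans (le_max_right _ _)).trans hmbig
  have hm_d : 16 * B ^ 2 ≤ m := ((le_max_right _ _).trans (le_max_right _ _)).trans hmbig
  -- The lower bounds imposed on m give N ≥ X₀, m ≤ cN, A(N) ≤ 2m² and 16m³ ≤ N^k.
  obtain ⟨N, hN1, hN2⟩ := H.exists_natCast_count_near hB (T := (m : ℝ) ^ 2) (by positivity)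
  have hNB := count_le_mul hB hB0.le (Nat.cast_nonneg (α := ℝ) N)
  set A := count a N with hA
  have hN0 : (0 : ℝ) < N := by
    by_contra h
    have : (N : ℝ) = 0 := le_antisymm (not_lt.1 h) (Nat.cast_nonneg _)
    rw [this] at hNB
    nlinarith
  have hA0 : 0 < A := by nlinarith
  have hBN : (m : ℝ) ^ 2 ≤ B * N := hN1.trans hNB
  have hNm : (m : ℝ) ≤ c * N := by
    rw [div_le_iff₀ hc] at hm_c
    have : B * m ≤ B * (c * N) := by nlinarith
    exact le_of_mul_le_mul_left this hB0
  have hNX : X₀ ≤ N := by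
    have : B * |X₀| ≤ B * N := by nlinarith
    exact (le_abs_self _).trans (le_of_mul_le_mul_left this hB0)
  have hXk : 16 * (m : ℝ) ^ 3 ≤ (N : ℝ) ^ k := by
    have h1 : (m : ℝ) ^ 4 ≤ B ^ 2 * (N : ℝ) ^ 2 := by
      have := pow_le_pow_left₀ (by positivity) hBN 2
      calc (m : ℝ) ^ 4 = ((m : ℝ) ^ 2) ^ 2 := by ring
        _ ≤ (B * N) ^ 2 := this
        _ = _ := by ring
    have h2 : B ^ 2 * (16 * (m : ℝ) ^ 3) ≤ B ^ 2 * (N : ℝ) ^ 2 := by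
      refine le_trans ?_ h1
      have : (0 : ℝ) < m ^ 3 := by positivity
      nlinarith
    have h3 := le_of_mul_le_mul_left h2 (by positivity)
    refine h3.trans (pow_le_pow_right₀ ?_ H.two_le)
    have : 1 ≤ N := by
      have : 0 < N := by exact_mod_cast hN0
      omega
    exact_mod_cast this
  have hpi := Real.pi_gt_three
  set r : ℝ := 1 / (4 * Real.pi * (N : ℝ) ^ k) with hr
  have hXk0 : (0 : ℝ) < (N : ℝ) ^ k := by positivity
  have hr0 : 0 < r := by positivity
  have hr12 : r * (N : ℝ) ^ k ≤ 1 / 12 := by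
    rw [hr, div_mul_eq_mul_div, one_mul, div_le_iff₀ (by positivity)]
    nlinarith
  have hm3 : (m : ℝ) ^ 2 * 2 ≤ (m : ℝ) ^ 3 := by nlinarith [sq_nonneg (m : ℝ)]
  have hm4 : (m : ℝ) * 2 ≤ (m : ℝ) ^ 2 := by nlinarith
  have hrN : ∀ q ∈ Finset.Ioc m (2 * m), (q : ℝ) ≤ 2 * m := fun q hq => by
    exact_mod_cast (Finset.mem_Ioc.1 hq).2
  have hr4 : r * (16 * (m : ℝ) ^ 3) ≤ 1 / 12 := (mul_le_mul_of_nonneg_left hXk hr0.le).trans hr12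
  have hcoef : ∀ x ∈ fractions (Finset.Ioc m (2 * m)), ‖completeSum κ k x.1 x.2‖ ^ s ≤
      4 ^ s * ((∫ β in Set.Icc (-r) r, ‖expSum a k (fracPt x + β) N‖ ^ s) *
        (2 * Real.pi * (N : ℝ) ^ k) / A ^ s + (4 * D * m) ^ s / A ^ s) := by
    intro x hx
    rw [mem_fractions] at hx
    have hx1 := Finset.mem_Ioc.1 hx.1
    exact H.norm_completeSum_pow_le hD0 hD s hN0 hA0 hr x (by omega) (hrN _ hx.1)
  refine (Finset.sum_le_sum hcoef).trans ?_
  rw [← Finset.mul_sum, Finset.sum_add_distrib, ← Finset.sum_div, ← Finset.sum_mul]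
  have harcs : ∑ x ∈ fractions (Finset.Ioc m (2 * m)),
      ∫ β in Set.Icc (-r) r, ‖expSum a k (fracPt x + β) N‖ ^ s ≤
      ∫ α in Set.Ioc r (r + 1) ∩ minorArcs k N m, ‖expSum a k α N‖ ^ s := by
    refine sum_setIntegral_arcs_le (N := 2 * m) (r := r) hrN (by nlinarith)
      (D := fun _ => Set.Icc (-r) r) (fun _ => measurableSet_Icc)
      (fun x _ β hβ => abs_le.2 hβ) ((continuous_expSum _).norm.pow s) (fun α => pow_nonneg (norm_nonneg _) _)
      (integrableOn_norm_expSum_pow s _ _ _) ?_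
    intro x hx β hβ
    have hbd := fracPt_bounds hx hrN
    rw [mem_fractions] at hx
    have hxm : (x.1 : ℝ) ≤ 2 * m := hrN _ hx.1
    have hmx : (m : ℝ) < x.1 := by exact_mod_cast (Finset.mem_Ioc.1 hx.1).1
    refine ⟨⟨?_, by linarith [hβ.2]⟩, ?_⟩
    · have : 2 * r < 1 / (2 * m) := by
        rw [lt_div_iff₀ (by positivity)]
        nlinarith
      linarith [hβ.1]
    · have := mem_minorArcs_of_near (k := k) (X := N) (Q := m) (q := x.1) (b := x.2) (β := β) (r := r)
        (by omega) hx.2.2.2 (by positivity) hN0 (abs_le.2 hβ) (Or.inl hmx) ?_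
      · simpa [fracPt] using this
      · have h1 : (m : ℝ) / (N : ℝ) ^ k * (16 * (m : ℝ) ^ 3) ≤ m := by
          rw [div_mul_eq_mul_div, div_le_iff₀ hXk0]
          gcongr
        have h2 : (r + m / (N : ℝ) ^ k) * x.1 * m ≤ (r + m / (N : ℝ) ^ k) * (2 * m) * m := by
          gcongr
        have h3 : (m : ℝ) / (N : ℝ) ^ k * (m : ℝ) ^ 2 ≤ 1 / 16 := by
          have : (m : ℝ) / (N : ℝ) ^ k * (16 * (m : ℝ) ^ 3) =
            16 * m * ((m : ℝ) / (N : ℝ) ^ k * (m : ℝ) ^ 2) := by ring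
          rw [this] at h1
          have : (m : ℝ) * ((m : ℝ) / (N : ℝ) ^ k * (m : ℝ) ^ 2 * 16) ≤ m * 1 := by linarith
          have := le_of_mul_le_mul_left this (by linarith)
          linarith
        have h4 : r * (m : ℝ) ^ 2 ≤ 1 / 16 := by nlinarith
        have h5 : (r + m / (N : ℝ) ^ k) * (2 * m) * m =
          2 * (r * (m : ℝ) ^ 2) + 2 * (m / (N : ℝ) ^ k * (m : ℝ) ^ 2) := by ring
        linarith
  have hmin := hX₀ N hNX m (by linarith) hNm r
  have hcard : ((fractions (Finset.Ioc m (2 * m))).card : ℝ) ≤ 2 * (m : ℝ) ^ 2 := by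
    have := card_fractions_le (t := Finset.Ioc m (2 * m)) (N := 2 * m)
      fun q hq => (Finset.mem_Ioc.1 hq).2
    have h' : (Finset.Ioc m (2 * m)).card = m := by simp; omega
    rw [h'] at this
    calc ((fractions (Finset.Ioc m (2 * m))).card : ℝ) ≤ ((m * (2 * m) : ℕ) : ℝ) := by
          exact_mod_cast this
      _ = _ := by push_cast; ring
  have hm0 : (0 : ℝ) < m := by linarith
  have hone : (1 : ℝ) ≤ m := by linarith
  have hpart1 : (∑ x ∈ fractions (Finset.Ioc m (2 * m)),
      ∫ β in Set.Icc (-r) r, ‖expSum a k (fracPt x + β) N‖ ^ s) * (2 * Real.pi * (N : ℝ) ^ k) / A ^ s ≤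
      2 * Real.pi * C * 2 ^ (ω + τ / 4) * (m : ℝ) ^ (-min 1 (3 * ω + τ / 2)) := by
    have h1 := harcs.trans hmin
    rw [← hA] at h1
    have h2 : A ^ ((s : ℝ) + ω + τ / 4) = A ^ s * A ^ (ω + τ / 4) := by
      rw [add_assoc, Real.rpow_add hA0, Real.rpow_natCast]
    have h3 : A ^ (ω + τ / 4) ≤ 2 ^ (ω + τ / 4) * (m : ℝ) ^ (2 * (ω + τ / 4)) := by
      have hA2 : A ≤ 2 * (m : ℝ) ^ 2 := by nlinarith
      calc A ^ (ω + τ / 4) ≤ (2 * (m : ℝ) ^ 2) ^ (ω + τ / 4) := by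
            gcongr
        _ = _ := by
          rw [Real.mul_rpow (by norm_num) (by positivity), ← Real.rpow_natCast,
            ← Real.rpow_mul hm0.le]
          norm_num
    calc _ ≤ C * (A ^ ((s : ℝ) + ω + τ / 4) / (N : ℝ) ^ k) * (m : ℝ) ^ (-(ϱ * (s - 2 * t₀))) *
          (2 * Real.pi * (N : ℝ) ^ k) / A ^ s := by gcongr
      _ = 2 * Real.pi * C * A ^ (ω + τ / 4) * (m : ℝ) ^ (-(ϱ * (s - 2 * t₀))) := by
          rw [h2]; field_simp
      _ ≤ 2 * Real.pi * C * (2 ^ (ω + τ / 4) * (m : ℝ) ^ (2 * (ω + τ / 4))) *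
          (m : ℝ) ^ (-(ϱ * (s - 2 * t₀))) := by gcongr
      _ = 2 * Real.pi * C * 2 ^ (ω + τ / 4) * (m : ℝ) ^ (-(3 * ω + τ / 2)) := by
          have : (m : ℝ) ^ (-(3 * ω + τ / 2)) = (m : ℝ) ^ (2 * (ω + τ / 4)) *
            (m : ℝ) ^ (-(ϱ * (s - 2 * t₀))) := by
            rw [← Real.rpow_add hm0]; congr 1; rw [hτdef]; ring
          rw [this]; ring
      _ ≤ _ := by
        refine mul_le_mul_of_nonneg_left (Real.rpow_le_rpow_of_exponent_le hone ?_) (by positivity)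
        exact neg_le_neg (min_le_right _ _)
  have hpart2 : ∑ x ∈ fractions (Finset.Ioc m (2 * m)), (4 * D * m) ^ s / A ^ s ≤
      2 * (4 * D) ^ s * (m : ℝ) ^ (-min 1 (3 * ω + τ / 2)) := by
    rw [Finset.sum_const, nsmul_eq_mul]
    have hAs : ((m : ℝ) ^ 2) ^ s ≤ A ^ s := by gcongr
    calc _ ≤ 2 * (m : ℝ) ^ 2 * ((4 * D * m) ^ s / ((m : ℝ) ^ 2) ^ s) := by gcongr
      _ = 2 * (4 * D) ^ s * ((m : ℝ) ^ 2 / (m : ℝ) ^ s) := by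
        rw [mul_pow, ← pow_mul, mul_comm 2 s, pow_mul]
        field_simp
      _ ≤ 2 * (4 * D) ^ s * (m : ℝ) ^ (-1 : ℝ) := by
        gcongr
        rw [Real.rpow_neg_one, div_le_iff₀ (by positivity), inv_mul_eq_div, le_div_iff₀ hm0]
        rw [← pow_succ]
        exact pow_le_pow_right₀ hone hs3
      _ ≤ _ := by
        refine mul_le_mul_of_nonneg_left (Real.rpow_le_rpow_of_exponent_le hone ?_) (by positivity)
        exact neg_le_neg (min_le_left _ _)
  calc _ ≤ 4 ^ s * (2 * Real.pi * C * 2 ^ (ω + τ / 4) * (m : ℝ) ^ (-min 1 (3 * ω + τ / 2)) +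
        2 * (4 * D) ^ s * (m : ℝ) ^ (-min 1 (3 * ω + τ / 2))) := by
        gcongr
    _ = _ := by ring

/-- The local factors summed over the numerators. -/
theorem exists_tail_bound (H : Regular a k κ t₀ ϱ ω) {s : ℕ} (hs : 2 * t₀ + 5 * ω / ϱ < s) :
    ∃ σ C : ℝ, ∃ m₀ : ℕ, 0 < σ ∧ (σ = 1 ∨ 3 * ω < σ) ∧ 0 ≤ C ∧ 1 ≤ m₀ ∧
      ∀ m : ℕ, m₀ ≤ m → ∀ N : ℕ,
      ∑ q ∈ Finset.Ioc m N, ∑ b ∈ reducedResidues q, ‖completeSum κ k q b‖ ^ s ≤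
        C * (m : ℝ) ^ (-σ) := by
  obtain ⟨σ, C, m₀, hσ, hσ', hC, hm₀, h⟩ := H.exists_dyadic_bound hs
  have h2σ : (2 : ℝ) ^ (-σ) < 1 := Real.rpow_lt_one_of_one_lt_of_neg (by norm_num) (by linarith)
  have h2σ' : 0 < 1 - (2 : ℝ) ^ (-σ) := by linarith
  refine ⟨σ, C / (1 - (2 : ℝ) ^ (-σ)), m₀, hσ, hσ', by positivity, hm₀, ?_⟩
  simp only [sum_fractions] at h
  -- Doubling m multiplies the bound by 2^{-σ}; the blocks sum to a geometric series.
  have key : ∀ j : ℕ, ∀ m : ℕ, m₀ ≤ m → ∑ q ∈ Finset.Ioc m (2 ^ j * m),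
      ∑ b ∈ reducedResidues q, ‖completeSum κ k q b‖ ^ s ≤
        C / (1 - (2 : ℝ) ^ (-σ)) * (m : ℝ) ^ (-σ) := by
    intro j
    induction j with
    | zero => intro m _; simp; positivity
    | succ j ih =>
      intro m hm
      have e1 : 2 ^ (j + 1) * m = 2 ^ j * (2 * m) := by ring
      have h1 := ih (2 * m) (by omega)
      have h3 : 2 * m ≤ 2 ^ j * (2 * m) := Nat.le_mul_of_pos_left _ (by positivity)
      rw [e1, ← Finset.sum_Ioc_consecutive _ (by omega : m ≤ 2 * m) h3]
      refine (add_le_add (h m hm) h1).trans (le_of_eq ?_)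
      push_cast
      rw [Real.mul_rpow (by norm_num) (by positivity)]
      field_simp
      ring
  intro m hm N
  refine le_trans ?_ (key N m hm)
  refine Finset.sum_le_sum_of_subset_of_nonneg (Finset.Ioc_subset_Ioc le_rfl ?_)
    fun q _ _ => Finset.sum_nonneg fun b _ => by positivity
  calc N ≤ 2 ^ N := Nat.lt_two_pow_self.le
    _ ≤ 2 ^ N * m := Nat.le_mul_of_pos_right _ (by omega)

theorem summable_completeSum (H : Regular a k κ t₀ ϱ ω) {s : ℕ} (hs : 2 * t₀ + 5 * ω / ϱ < s) :
    Summable fun q : ℕ => ∑ b ∈ reducedResidues q, ‖completeSum κ k q b‖ ^ s := by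
  obtain ⟨σ, C, m₀, -, -, hC, -, h⟩ := H.exists_tail_bound hs
  have h0 : ∀ q : ℕ, 0 ≤ ∑ b ∈ reducedResidues q, ‖completeSum κ k q b‖ ^ s := fun q =>
    Finset.sum_nonneg fun b _ => by positivity
  refine summable_of_sum_range_le (c := ∑ q ∈ Finset.range (m₀ + 1),
    ∑ b ∈ reducedResidues q, ‖completeSum κ k q b‖ ^ s + C * (m₀ : ℝ) ^ (-σ)) h0 fun N => ?_
  refine le_trans ?_ (add_le_add_right (h m₀ le_rfl N) _)
  rw [← Finset.sum_union]
  · refine Finset.sum_le_sum_of_subset_of_nonneg ?_ fun q _ _ => h0 q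
    intro q hq
    simp only [Finset.mem_union, Finset.mem_range, Finset.mem_Ioc] at hq ⊢
    omega
  · rw [Finset.disjoint_left]
    intro q hq hq'
    simp only [Finset.mem_range, Finset.mem_Ioc] at hq hq'
    omega

theorem tsum_tail_le (H : Regular a k κ t₀ ϱ ω) {s : ℕ} (hs : 2 * t₀ + 5 * ω / ϱ < s) :
    ∃ σ C : ℝ, ∃ m₀ : ℕ, 0 < σ ∧ (σ = 1 ∨ 3 * ω < σ) ∧ 0 ≤ C ∧ 1 ≤ m₀ ∧
      ∀ m : ℕ, m₀ ≤ m →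
      ∑' q : ℕ, (if q ∈ Finset.Icc 1 m then 0 else
        ∑ b ∈ reducedResidues q, ‖completeSum κ k q b‖ ^ s) ≤ C * (m : ℝ) ^ (-σ) := by
  obtain ⟨σ, C, m₀, hσ, hσ', hC, hm₀, h⟩ := H.exists_tail_bound hs
  refine ⟨σ, C, m₀, hσ, hσ', hC, hm₀, fun m hm => ?_⟩
  refine Real.tsum_le_of_sum_range_le (fun q => ?_) fun N => ?_
  · split_ifs
    · exact le_rfl
    · exact Finset.sum_nonneg fun b _ => by positivity
  · refine le_trans ?_ (h m hm N)
    simp_rw [← ite_not (_ ∈ _)]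
    rw [← Finset.sum_filter]
    -- The index q = 0 is not removed by the condition 1 ≤ q ≤ m, but it has no reduced residues.
    refine (Finset.sum_le_sum_of_subset_of_nonneg (t := insert 0 (Finset.Ioc m N)) ?_
      fun q _ _ => Finset.sum_nonneg fun b _ => by positivity).trans (le_of_eq ?_)
    · intro q hq
      simp only [Finset.mem_filter, Finset.mem_range, Finset.mem_Icc, Finset.mem_insert,
        Finset.mem_Ioc] at hq ⊢
      omega
    · rw [Finset.sum_insert (by simp)]
      simp [reducedResidues]

end Regular

/-! ### The Poisson distribution -/

/-- The weight that the Poisson distribution of mean `z` gives to `i`. -/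
def poissonWeight (i : ℕ) (z : ℝ) : ℝ := z ^ i / i.factorial * Real.exp (-z)

theorem continuous_poissonWeight (i : ℕ) : Continuous (poissonWeight i) := by
  unfold poissonWeight; fun_prop

theorem poissonWeight_nonneg (i : ℕ) {z : ℝ} (hz : 0 ≤ z) : 0 ≤ poissonWeight i z := by
  unfold poissonWeight; positivity

theorem hasSum_poissonWeight (z : ℝ) : HasSum (fun i => poissonWeight i z) 1 := by
  have h := (NormedSpace.expSeries_div_hasSum_exp z).mul_right (Real.exp (-z))
  rwa [← Real.exp_eq_exp_ℝ, ← Real.exp_add, add_neg_cancel, Real.exp_zero] at h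

theorem succ_mul_poissonWeight_succ (i : ℕ) (z : ℝ) :
    ((i + 1 : ℕ) : ℝ) * poissonWeight (i + 1) z = z * poissonWeight i z := by
  unfold poissonWeight
  rw [Nat.factorial_succ, pow_succ]
  push_cast
  field_simp

theorem hasSum_mul_poissonWeight (z : ℝ) : HasSum (fun i : ℕ => (i : ℝ) * poissonWeight i z) z := by
  rw [← hasSum_nat_add_iff' 1]
  simp_rw [succ_mul_poissonWeight_succ]
  simpa using (hasSum_poissonWeight z).mul_left z

theorem hasSum_sq_mul_poissonWeight (z : ℝ) :
    HasSum (fun i : ℕ => ((i : ℝ) - z) ^ 2 * poissonWeight i z) z := by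
  have h1 : HasSum (fun i : ℕ => (i : ℝ) ^ 2 * poissonWeight i z) (z * (z + 1)) := by
    rw [← hasSum_nat_add_iff' 1]
    have := ((hasSum_mul_poissonWeight z).add (hasSum_poissonWeight z)).mul_left z
    have e1 : ∀ i : ℕ, ((i + 1 : ℕ) : ℝ) ^ 2 * poissonWeight (i + 1) z =
        z * (i * poissonWeight i z + poissonWeight i z) := fun i => by
      rw [pow_two, mul_assoc, succ_mul_poissonWeight_succ]
      push_cast; ring
    simp_rw [e1]
    simpa using this
  have h2 := (h1.sub ((hasSum_mul_poissonWeight z).mul_left (2 * z))).add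
    ((hasSum_poissonWeight z).mul_left (z ^ 2))
  have e2 : z * (z + 1) - 2 * z * z + z ^ 2 * 1 = z := by ring
  rw [e2] at h2
  have e3 : (fun i : ℕ => ((i : ℝ) - z) ^ 2 * poissonWeight i z) = fun i : ℕ =>
      (i : ℝ) ^ 2 * poissonWeight i z - 2 * z * (i * poissonWeight i z) +
        z ^ 2 * poissonWeight i z := by
    ext i; ring
  rw [e3]
  exact h2

theorem sum_range_poissonWeight_le_one {z : ℝ} (hz : 0 ≤ z) (j : ℕ) :
    ∑ i ∈ Finset.range j, poissonWeight i z ≤ 1 :=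
  sum_le_hasSum _ (fun i _ => poissonWeight_nonneg i hz) (hasSum_poissonWeight z)

theorem poissonWeight_le_tail {z : ℝ} (hz : 0 ≤ z) (j : ℕ) :
    poissonWeight j z ≤ 1 - ∑ i ∈ Finset.range j, poissonWeight i z := by
  have := sum_range_poissonWeight_le_one hz (j + 1)
  rw [Finset.sum_range_succ] at this
  linarith

/-- Chebyshev's inequality: the variance of the Poisson distribution of mean z is z. -/
theorem sum_range_poissonWeight_le {z : ℝ} (hz : 0 ≤ z) {j : ℕ} (hj : (j : ℝ) < z) :
    ∑ i ∈ Finset.range j, poissonWeight i z ≤ z / (z - j) ^ 2 := by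
  rw [le_div_iff₀ (by have : 0 < z - j := by linarith
                      positivity), Finset.sum_mul]
  refine le_trans (Finset.sum_le_sum fun i hi => ?_)
    (sum_le_hasSum (Finset.range j) (fun i _ => mul_nonneg (sq_nonneg _) (poissonWeight_nonneg i hz))
      (hasSum_sq_mul_poissonWeight z))
  rw [mul_comm]
  have hij : (i : ℝ) ≤ j := by exact_mod_cast (Finset.mem_range.1 hi).le
  refine mul_le_mul_of_nonneg_right ?_ (poissonWeight_nonneg i hz)
  nlinarith

/-- Chebyshev's inequality for the upper tail. -/
theorem one_sub_sum_range_poissonWeight_le {z : ℝ} (hz : 0 ≤ z) {j : ℕ} (hj : z < j) :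
    1 - ∑ i ∈ Finset.range j, poissonWeight i z ≤ z / (j - z) ^ 2 := by
  rw [le_div_iff₀ (by have : 0 < j - z := by linarith
                      positivity)]
  have h1 := ((hasSum_nat_add_iff' j).2 (hasSum_poissonWeight z)).mul_right ((j - z) ^ 2)
  have h2 := (hasSum_nat_add_iff' j).2 (hasSum_sq_mul_poissonWeight z)
  have h3 : 0 ≤ ∑ i ∈ Finset.range j, ((i : ℝ) - z) ^ 2 * poissonWeight i z :=
    Finset.sum_nonneg fun i _ => mul_nonneg (sq_nonneg _) (poissonWeight_nonneg i hz)
  refine (hasSum_le (fun i => ?_) h1 h2).trans (by linarith)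
  rw [mul_comm]
  refine mul_le_mul_of_nonneg_right ?_ (poissonWeight_nonneg _ hz)
  push_cast
  nlinarith [Nat.cast_nonneg (α := ℝ) i]

theorem hasDerivAt_poissonWeight_succ (i : ℕ) (z : ℝ) :
    HasDerivAt (poissonWeight (i + 1)) (poissonWeight i z - poissonWeight (i + 1) z) z := by
  have h1 : HasDerivAt (fun z : ℝ => z ^ (i + 1) / (i + 1).factorial)
      (((i + 1 : ℕ) : ℝ) * z ^ i / (i + 1).factorial) z := by
    simpa using (hasDerivAt_pow (i + 1) z).div_const ((i + 1).factorial : ℝ)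
  have h2 := h1.mul (hasDerivAt_neg z).exp
  refine h2.congr_deriv ?_
  simp only [poissonWeight]
  rw [Nat.factorial_succ]
  push_cast
  field_simp
  ring

theorem hasDerivAt_poissonWeight_zero (z : ℝ) :
    HasDerivAt (poissonWeight 0) (-poissonWeight 0 z) z := by
  have h2 := (hasDerivAt_neg z).exp
  have e1 : poissonWeight 0 = fun z => Real.exp (-z) := by ext; simp [poissonWeight]
  rw [e1]
  simpa using h2

theorem hasDerivAt_e_mul (β z : ℝ) :
    HasDerivAt (fun z : ℝ => e (β * z)) (2 * Real.pi * Complex.I * β * e (β * z)) z := by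
  have h1 : HasDerivAt (fun z : ℝ => 2 * Real.pi * Complex.I * ((β * z : ℝ) : ℂ))
      (2 * Real.pi * Complex.I * β) z := by
    have h := ((hasDerivAt_id z).const_mul β).ofReal_comp.const_mul (2 * Real.pi * Complex.I)
    simpa using h
  have := h1.cexp
  unfold e
  convert this using 1
  ring

/-- The value at `β` of the Fourier transform of the exponential density, `1 / (1 - 2 π i β)`. -/
def expTransform (β : ℝ) : ℂ := (1 - 2 * Real.pi * Complex.I * β)⁻¹

theorem one_sub_ne_zero (β : ℝ) : (1 - 2 * Real.pi * Complex.I * β : ℂ) ≠ 0 := by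
  intro h
  have := congrArg Complex.re h
  simp at this

theorem normSq_one_sub (β : ℝ) :
    Complex.normSq (1 - 2 * Real.pi * Complex.I * β) = 1 + (2 * Real.pi * β) ^ 2 := by
  simp [Complex.normSq_apply]
  ring

theorem norm_expTransform_sq (β : ℝ) : ‖expTransform β‖ ^ 2 = 1 / (1 + (2 * Real.pi * β) ^ 2) := by
  rw [expTransform, norm_inv, inv_pow, ← Complex.normSq_eq_norm_sq, normSq_one_sub, one_div]

theorem norm_expTransform_le_one (β : ℝ) : ‖expTransform β‖ ≤ 1 := by
  have h := norm_expTransform_sq β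
  have : 1 / (1 + (2 * Real.pi * β) ^ 2) ≤ 1 := by
    rw [div_le_one (by positivity)]; nlinarith [sq_nonneg (2 * Real.pi * β)]
  nlinarith [norm_nonneg (expTransform β)]

theorem expTransform_zero : expTransform 0 = 1 := by simp [expTransform]

/-- The truncated Fourier transform of a Poisson weight. -/
def poissonTransform (i : ℕ) (N β : ℝ) : ℂ :=
  ∫ z in (0 : ℝ)..N, (poissonWeight i z : ℂ) * e (β * z)

theorem continuous_poissonWeight_mul_e (i : ℕ) (β : ℝ) :
    Continuous fun z : ℝ => (poissonWeight i z : ℂ) * e (β * z) := by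
  have := continuous_poissonWeight i
  have := continuous_e
  fun_prop

theorem poissonTransform_zero (N β : ℝ) : poissonTransform 0 N β =
    expTransform β * (1 - poissonWeight 0 N * e (β * N)) := by
  have h := intervalIntegral.integral_eq_sub_of_hasDerivAt (a := 0) (b := N)
    (f := fun z => (poissonWeight 0 z : ℂ) * e (β * z))
    (fun z _ => (hasDerivAt_poissonWeight_zero z).ofReal_comp.mul (hasDerivAt_e_mul β z))
    (Continuous.intervalIntegrable (by
      have := continuous_poissonWeight 0
      have := continuous_e
      fun_prop) _ _)
  have e1 : ∀ z : ℝ, ((-poissonWeight 0 z : ℝ) : ℂ) * e (β * z) +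
      poissonWeight 0 z * (2 * Real.pi * Complex.I * β * e (β * z)) =
      -(1 - 2 * Real.pi * Complex.I * β) * (poissonWeight 0 z * e (β * z)) := fun z => by
    push_cast; ring
  simp_rw [e1] at h
  rw [intervalIntegral.integral_const_mul] at h
  have e2 : (poissonWeight 0 0 : ℂ) * e (β * 0) = 1 := by simp [poissonWeight, e_zero]
  rw [e2] at h
  rw [expTransform, eq_inv_mul_iff_mul_eq₀ (one_sub_ne_zero β), poissonTransform]
  linear_combination -h

theorem poissonTransform_succ (i : ℕ) (N β : ℝ) : poissonTransform (i + 1) N β =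
    expTransform β * (poissonTransform i N β - poissonWeight (i + 1) N * e (β * N)) := by
  have h := intervalIntegral.integral_eq_sub_of_hasDerivAt (a := 0) (b := N)
    (f := fun z => (poissonWeight (i + 1) z : ℂ) * e (β * z))
    (fun z _ => (hasDerivAt_poissonWeight_succ i z).ofReal_comp.mul (hasDerivAt_e_mul β z))
    (Continuous.intervalIntegrable (by
      have := continuous_poissonWeight i
      have := continuous_poissonWeight (i + 1)
      have := continuous_e
      fun_prop) _ _)
  have e1 : ∀ z : ℝ, ((poissonWeight i z - poissonWeight (i + 1) z : ℝ) : ℂ) * e (β * z) +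
      poissonWeight (i + 1) z * (2 * Real.pi * Complex.I * β * e (β * z)) =
      poissonWeight i z * e (β * z) -
      (1 - 2 * Real.pi * Complex.I * β) * (poissonWeight (i + 1) z * e (β * z)) := fun z => by
    push_cast; ring
  simp_rw [e1] at h
  rw [intervalIntegral.integral_sub ((continuous_poissonWeight_mul_e i β).intervalIntegrable _ _)
    (((continuous_poissonWeight_mul_e (i + 1) β).intervalIntegrable _ _).const_mul _),
    intervalIntegral.integral_const_mul] at h
  have e2 : (poissonWeight (i + 1) 0 : ℂ) = 0 := by simp [poissonWeight]
  rw [e2, zero_mul] at h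
  rw [expTransform, eq_inv_mul_iff_mul_eq₀ (one_sub_ne_zero β)]
  simp only [poissonTransform]
  linear_combination -h

/-- Repeated integration by parts. As a function of z, the weight with index i is the Gamma density
of shape i + 1, with full transform `expTransform β ^ (i + 1)`; the sum collects the boundary terms
at N. -/
theorem poissonTransform_eq (i : ℕ) (N β : ℝ) : poissonTransform i N β =
    expTransform β ^ (i + 1) - e (β * N) *
      ∑ l ∈ Finset.range (i + 1), expTransform β ^ (i + 1 - l) * poissonWeight l N := by
  induction i with
  | zero => rw [poissonTransform_zero]; simp; ring
  | succ i ih =>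
    rw [poissonTransform_succ, ih, Finset.sum_range_succ _ (i + 1)]
    have : ∑ l ∈ Finset.range (i + 1), expTransform β ^ (i + 1 + 1 - l) * (poissonWeight l N : ℂ) =
        expTransform β * ∑ l ∈ Finset.range (i + 1),
          expTransform β ^ (i + 1 - l) * (poissonWeight l N : ℂ) := by
      rw [Finset.mul_sum]
      refine Finset.sum_congr rfl fun l hl => ?_
      have := Finset.mem_range.1 hl
      rw [show i + 1 + 1 - l = (i + 1 - l) + 1 by omega, pow_succ]
      ring
    rw [this]
    simp
    ring

/-- For use when i + 1 = m^k is below N: then the Poisson mass of mean N below i + 1 is small, so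
truncation at N loses little. The factor `‖expTransform β‖` is kept for integrability in β. -/
theorem norm_poissonTransform_sub_le (i : ℕ) {N : ℝ} (hN : 0 ≤ N) (β : ℝ) :
    ‖poissonTransform i N β - expTransform β ^ (i + 1)‖ ≤
      ‖expTransform β‖ * ∑ l ∈ Finset.range (i + 1), poissonWeight l N := by
  rw [poissonTransform_eq, sub_sub_cancel_left, norm_neg, norm_mul, norm_e, one_mul, Finset.mul_sum]
  refine norm_sum_le_of_le _ fun l hl => ?_
  have := Finset.mem_range.1 hl
  rw [norm_mul, norm_pow, Complex.norm_real, Real.norm_of_nonneg (poissonWeight_nonneg l hN)]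
  refine mul_le_mul_of_nonneg_right ?_ (poissonWeight_nonneg l hN)
  exact pow_le_of_le_one (norm_nonneg _) (norm_expTransform_le_one β) (by omega)

theorem integral_poissonWeight (i : ℕ) (N : ℝ) : ∫ z in (0 : ℝ)..N, poissonWeight i z =
    1 - ∑ l ∈ Finset.range (i + 1), poissonWeight l N := by
  have h := poissonTransform_eq i N 0
  simp only [poissonTransform, zero_mul, e_zero, mul_one, expTransform_zero, one_pow, one_mul,
    intervalIntegral.integral_ofReal] at h
  exact_mod_cast h

theorem norm_poissonTransform_le (i : ℕ) {N : ℝ} (hN : 0 ≤ N) (β : ℝ) :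
    ‖poissonTransform i N β‖ ≤ 1 - ∑ l ∈ Finset.range (i + 1), poissonWeight l N := by
  rw [← integral_poissonWeight]
  refine intervalIntegral.norm_integral_le_of_norm_le hN (ae_of_all _ fun z hz => ?_)
    ((continuous_poissonWeight i).intervalIntegrable _ _)
  rw [norm_mul, norm_e, mul_one, Complex.norm_real,
    Real.norm_of_nonneg (poissonWeight_nonneg i hz.1.le)]

/-- For use when i exceeds N. One integration by parts trades one unit of the index for a factor
that decays in β. -/
theorem norm_poissonTransform_succ_le (i : ℕ) {N : ℝ} (hN : 0 ≤ N) (β : ℝ) :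
    ‖poissonTransform (i + 1) N β‖ ≤
      ‖expTransform β‖ * (2 * (1 - ∑ l ∈ Finset.range (i + 1), poissonWeight l N)) := by
  rw [poissonTransform_succ, norm_mul]
  refine mul_le_mul_of_nonneg_left ((norm_sub_le _ _).trans ?_) (norm_nonneg _)
  rw [norm_mul, norm_e, mul_one, Complex.norm_real,
    Real.norm_of_nonneg (poissonWeight_nonneg _ hN)]
  linarith [norm_poissonTransform_le i hN β, poissonWeight_le_tail hN (i + 1)]

/-! ### A smooth approximation to the counting function -/

/-- The density of the smoothed count in the variable `z = ξ ^ k`. -/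
def smoothDensity (a : ℕ → ℝ) (k : ℕ) (z : ℝ) : ℝ :=
  ∑' m : ℕ, a (m + 1) * poissonWeight ((m + 1) ^ k - 1) z

/-- The Fourier transform of the smoothed count up to `N ^ (1 / k)`. -/
def smoothTransform (a : ℕ → ℝ) (k : ℕ) (N β : ℝ) : ℂ :=
  ∫ z in (0 : ℝ)..N, (smoothDensity a k z : ℂ) * e (β * z)

/-- The derivative of the smoothed count. -/
def smoothDeriv (a : ℕ → ℝ) (k : ℕ) (ξ : ℝ) : ℝ :=
  -- The density can be negative at negative z; truncating ξ at 0 keeps the derivative non-negative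
  -- on the whole line.
  k * max ξ 0 ^ (k - 1) * smoothDensity a k (max ξ 0 ^ k)

/-- The smoothed count. -/
def smoothCount (a : ℕ → ℝ) (k : ℕ) (X : ℝ) : ℝ := ∫ ξ in (0 : ℝ)..X, smoothDeriv a k ξ

section
variable {a : ℕ → ℝ} {k : ℕ} {B : ℝ}

theorem injective_succ_pow_sub_one (hk : k ≠ 0) :
    Function.Injective fun m : ℕ => (m + 1) ^ k - 1 := by
  intro m n h
  have h1 : 1 ≤ (m + 1) ^ k := Nat.one_le_pow _ _ (by omega)
  have h2 : 1 ≤ (n + 1) ^ k := Nat.one_le_pow _ _ (by omega)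
  simp only at h
  have := Nat.pow_left_injective hk (show (m + 1) ^ k = (n + 1) ^ k by omega)
  simpa using this

theorem summable_majorant (hk : k ≠ 0) (R : ℝ) : Summable fun m : ℕ =>
    B * (R ^ ((m + 1) ^ k - 1) / (((m + 1) ^ k - 1).factorial : ℝ) * Real.exp R) :=
  (((Real.summable_pow_div_factorial R).mul_right _).comp_injective
    (injective_succ_pow_sub_one hk)).mul_left B

theorem abs_coeff_mul_poissonWeight_le (ha : ∀ n, 0 ≤ a n) (hB : ∀ n, 1 ≤ n → a n ≤ B) {R z : ℝ}
    (hz : |z| ≤ R) (m i : ℕ) : |a (m + 1) * poissonWeight i z| ≤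
      B * (R ^ i / (i.factorial : ℝ) * Real.exp R) := by
  rw [abs_mul, abs_of_nonneg (ha _), poissonWeight, abs_mul, abs_div, abs_pow, Real.abs_exp,
    Nat.abs_cast]
  have h1 := hB (m + 1) (by omega)
  have h2 := ha (m + 1)
  have h3 : -z ≤ R := (neg_le_abs z).trans hz
  have h4 : 0 ≤ R := (abs_nonneg z).trans hz
  have h5 := h2.trans h1
  gcongr

theorem hasSum_smoothDensity (hk : k ≠ 0) (ha : ∀ n, 0 ≤ a n) (hB : ∀ n, 1 ≤ n → a n ≤ B) (z : ℝ) :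
    HasSum (fun m : ℕ => a (m + 1) * poissonWeight ((m + 1) ^ k - 1) z) (smoothDensity a k z) := by
  refine Summable.hasSum (Summable.of_norm_bounded (summable_majorant (B := B) hk |z|) fun _ => ?_)
  exact abs_coeff_mul_poissonWeight_le ha hB le_rfl _ _

theorem smoothDensity_nonneg (ha : ∀ n, 0 ≤ a n) {z : ℝ} (hz : 0 ≤ z) : 0 ≤ smoothDensity a k z :=
  tsum_nonneg fun _ => mul_nonneg (ha _) (poissonWeight_nonneg _ hz)

theorem continuous_smoothDensity (hk : k ≠ 0) (ha : ∀ n, 0 ≤ a n) (hB : ∀ n, 1 ≤ n → a n ≤ B) :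
    Continuous (smoothDensity a k) := by
  rw [continuous_iff_continuousAt]
  intro z
  have h : ContinuousOn (smoothDensity a k) (Set.Icc (-(|z| + 1)) (|z| + 1)) :=
    continuousOn_tsum (fun m => ((continuous_poissonWeight _).const_mul _).continuousOn)
      (summable_majorant (B := B) hk (|z| + 1))
      fun m x hx => abs_coeff_mul_poissonWeight_le ha hB (abs_le.2 hx) _ _
  refine h.continuousAt (Icc_mem_nhds ?_ ?_)
  · linarith [neg_abs_le z]
  · linarith [le_abs_self z]

theorem continuous_smoothDeriv (hk : k ≠ 0) (ha : ∀ n, 0 ≤ a n) (hB : ∀ n, 1 ≤ n → a n ≤ B) :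
    Continuous (smoothDeriv a k) := by
  have := continuous_smoothDensity hk ha hB
  unfold smoothDeriv
  fun_prop

theorem smoothDeriv_nonneg (ha : ∀ n, 0 ≤ a n) (ξ : ℝ) : 0 ≤ smoothDeriv a k ξ := by
  have := smoothDensity_nonneg (k := k) ha (pow_nonneg (le_max_right ξ 0) k)
  unfold smoothDeriv
  positivity

theorem hasDerivAt_smoothCount (hk : k ≠ 0) (ha : ∀ n, 0 ≤ a n) (hB : ∀ n, 1 ≤ n → a n ≤ B) (X : ℝ) :
    HasDerivAt (smoothCount a k) (smoothDeriv a k X) X :=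
  (continuous_smoothDeriv hk ha hB).integral_hasStrictDerivAt 0 X |>.hasDerivAt

theorem contDiff_smoothCount (hk : k ≠ 0) (ha : ∀ n, 0 ≤ a n) (hB : ∀ n, 1 ≤ n → a n ≤ B) :
    ContDiff ℝ 1 (smoothCount a k) := by
  rw [contDiff_one_iff_deriv]
  have h := hasDerivAt_smoothCount hk ha hB
  refine ⟨fun X => (h X).differentiableAt, ?_⟩
  rw [show deriv (smoothCount a k) = smoothDeriv a k from funext fun X => (h X).deriv]
  exact continuous_smoothDeriv hk ha hB

theorem monotone_smoothCount (hk : k ≠ 0) (ha : ∀ n, 0 ≤ a n) (hB : ∀ n, 1 ≤ n → a n ≤ B) :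
    Monotone (smoothCount a k) :=
  monotone_of_hasDerivAt_nonneg (hasDerivAt_smoothCount hk ha hB) (smoothDeriv_nonneg ha)

theorem integral_smoothDeriv_mul_e (hk : k ≠ 0) (ha : ∀ n, 0 ≤ a n) (hB : ∀ n, 1 ≤ n → a n ≤ B)
    {X : ℝ} (hX : 0 ≤ X) (β : ℝ) : ∫ ξ in (0 : ℝ)..X, (smoothDeriv a k ξ : ℂ) * e (β * ξ ^ k) =
      smoothTransform a k (X ^ k) β := by
  have hg := continuous_smoothDensity hk ha hB
  have he := continuous_e
  have h := intervalIntegral.integral_deriv_smul_comp (a := 0) (b := X) (f := fun ξ : ℝ => ξ ^ k)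
    (f' := fun ξ => k * ξ ^ (k - 1)) (g := fun z => (smoothDensity a k z : ℂ) * e (β * z))
    (fun x _ => hasDerivAt_pow k x) (by fun_prop) (by fun_prop)
  rw [zero_pow hk] at h
  rw [smoothTransform, ← h]
  refine intervalIntegral.integral_congr fun ξ hξ => ?_
  rw [Set.uIcc_of_le hX] at hξ
  simp only [smoothDeriv, max_eq_left hξ.1, Function.comp_apply, Complex.real_smul]
  push_cast; ring

theorem smoothTransform_zero (hk : k ≠ 0) (ha : ∀ n, 0 ≤ a n) (hB : ∀ n, 1 ≤ n → a n ≤ B)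
    {X : ℝ} (hX : 0 ≤ X) : smoothTransform a k (X ^ k) 0 = smoothCount a k X := by
  rw [← integral_smoothDeriv_mul_e hk ha hB hX, smoothCount]
  simp only [zero_mul, e_zero, mul_one]
  rw [intervalIntegral.integral_ofReal]

theorem realIntegral_smoothCount (hk : k ≠ 0) (ha : ∀ n, 0 ≤ a n) (hB : ∀ n, 1 ≤ n → a n ≤ B)
    {X : ℝ} (hX : 0 ≤ X) (γ : ℝ) : realIntegral (smoothCount a k) k X γ =
      smoothTransform a k (X ^ k) (γ / X ^ k) / smoothCount a k X := by
  rw [realIntegral, ← integral_smoothDeriv_mul_e hk ha hB hX]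
  congr 1
  refine intervalIntegral.integral_congr fun ξ _ => ?_
  simp only [(hasDerivAt_smoothCount hk ha hB ξ).deriv, div_pow]
  congr 2
  ring

theorem hasSum_smoothTransform (hk : k ≠ 0) (ha : ∀ n, 0 ≤ a n) (hB : ∀ n, 1 ≤ n → a n ≤ B)
    {N : ℝ} (hN : 0 ≤ N) (β : ℝ) :
    HasSum (fun m : ℕ => (a (m + 1) : ℂ) * poissonTransform ((m + 1) ^ k - 1) N β)
      (smoothTransform a k N β) := by
  have h := intervalIntegral.hasSum_integral_of_dominated_convergence (μ := volume) (a := 0) (b := N)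
    (F := fun (m : ℕ) z => (a (m + 1) : ℂ) * ((poissonWeight ((m + 1) ^ k - 1) z : ℂ) * e (β * z)))
    (f := fun z => (smoothDensity a k z : ℂ) * e (β * z))
    (fun m _ => B * (N ^ ((m + 1) ^ k - 1) / (((m + 1) ^ k - 1).factorial : ℝ) * Real.exp N))
    (fun m => ((continuous_poissonWeight_mul_e _ β).const_mul _).aestronglyMeasurable)
    (fun m => ae_of_all _ fun z hz => ?_)
    (ae_of_all _ fun z _ => summable_majorant hk N) (by simp)
    (ae_of_all _ fun z _ => ?_)
  · simp_rw [intervalIntegral.integral_const_mul] at h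
    exact h
  · rw [Set.uIoc_of_le hN] at hz
    rw [← mul_assoc, norm_mul, norm_e, mul_one, ← Complex.ofReal_mul, Complex.norm_real]
    exact abs_coeff_mul_poissonWeight_le ha hB (by rw [abs_of_pos hz.1]; exact hz.2) _ _
  · have := (Complex.hasSum_ofReal.2 (hasSum_smoothDensity hk ha hB z)).mul_right (e (β * z))
    simpa [mul_assoc] using this

theorem sum_Icc_one_eq_sum_range {M : Type*} [AddCommMonoid M] (f : ℕ → M) (P : ℕ) :
    ∑ m ∈ Finset.Icc 1 P, f m = ∑ m ∈ Finset.range P, f (m + 1) := by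
  rw [Finset.range_eq_Ico, Finset.sum_Ico_add' f 0 P 1]
  rfl

/-- If m = ⌊X⌋ - l, then m^k lies at least l X^{k-1} below X^k. As k ≥ 2, this is at least l
standard deviations X^{k/2}, so Chebyshev gives a bound 1/l², uniform in X and summable in l. -/
theorem sum_range_poissonWeight_pow_le (hk : 2 ≤ k) {X : ℝ} (hX : 1 ≤ X) {m l : ℕ}
    (hm : m + l = ⌊X⌋₊) :
    ∑ i ∈ Finset.range (m ^ k), poissonWeight i (X ^ k) ≤ 4 / ((l : ℝ) + 1) ^ 2 := by
  have hN : 0 ≤ X ^ k := by positivity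
  rcases Nat.eq_zero_or_pos l with rfl | hl
  · refine (sum_range_poissonWeight_le_one hN _).trans (by norm_num)
  · have hl1 : (1 : ℝ) ≤ l := by exact_mod_cast hl
    have hmX : (m : ℝ) + l ≤ X := by
      have := Nat.floor_le (by linarith : 0 ≤ X)
      rw [← hm] at this
      exact_mod_cast this
    obtain ⟨j, rfl⟩ : ∃ j, k = j + 1 + 1 := ⟨k - 2, by omega⟩
    have hXj : 1 ≤ X ^ j := one_le_pow₀ hX
    have h1 : (m : ℝ) ^ (j + 1 + 1) ≤ m * X ^ (j + 1) := by
      rw [pow_succ, mul_comm]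
      gcongr
      linarith
    have h2 : l * X ^ (j + 1) ≤ X ^ (j + 1 + 1) - ((m ^ (j + 1 + 1) : ℕ) : ℝ) := by
      have : (m + l) * X ^ (j + 1) ≤ X * X ^ (j + 1) := by gcongr
      push_cast
      rw [pow_succ X (j + 1)]
      linarith
    have h0 : 0 < l * X ^ (j + 1) := by positivity
    refine (sum_range_poissonWeight_le hN (by linarith)).trans ?_
    calc _ ≤ X ^ (j + 1 + 1) / (l * X ^ (j + 1)) ^ 2 := by gcongr
      _ ≤ 1 / (l : ℝ) ^ 2 := by
        rw [div_le_div_iff₀ (by positivity) (by positivity), mul_pow, one_mul, mul_comm]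
        gcongr
        rw [← pow_mul]
        exact pow_le_pow_right₀ hX (by omega)
      _ ≤ _ := by
        rw [div_le_div_iff₀ (by positivity) (by positivity)]
        nlinarith

theorem one_sub_sum_range_poissonWeight_pow_le (hk : 2 ≤ k) {X : ℝ} (hX : 1 ≤ X) (l : ℕ) :
    1 - ∑ i ∈ Finset.range ((l + ⌊X⌋₊ + 1) ^ k - 1), poissonWeight i (X ^ k) ≤
      4 / ((l : ℝ) + 1) ^ 2 := by
  have hN : 0 ≤ X ^ k := by positivity
  rcases Nat.eq_zero_or_pos l with rfl | hl
  · have : 0 ≤ ∑ i ∈ Finset.range ((0 + ⌊X⌋₊ + 1) ^ k - 1), poissonWeight i (X ^ k) :=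
      Finset.sum_nonneg fun i _ => poissonWeight_nonneg i hN
    norm_num at this ⊢
    linarith
  · have hl1 : (1 : ℝ) ≤ l := by exact_mod_cast hl
    set m := l + ⌊X⌋₊ + 1 with hm
    have hmX : X + l ≤ m := by
      have := (Nat.lt_floor_add_one X).le
      rw [hm]; push_cast; linarith
    obtain ⟨j, rfl⟩ : ∃ j, k = j + 1 + 1 := ⟨k - 2, by omega⟩
    have hXj : 1 ≤ X ^ j := one_le_pow₀ hX
    -- The additional 1 pays for the index m^k - 1 in place of m^k.
    have h1 : X ^ (j + 1) + 1 ≤ (m : ℝ) ^ (j + 1) := by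
      calc X ^ (j + 1) + 1 ≤ X ^ j * X + X ^ j * l := by
            rw [pow_succ]; nlinarith
        _ = X ^ j * (X + l) := by ring
        _ ≤ (m : ℝ) ^ j * m := by gcongr; linarith
        _ = _ := (pow_succ _ _).symm
    have h2 : l * X ^ (j + 1) ≤ ((m ^ (j + 1 + 1) - 1 : ℕ) : ℝ) - X ^ (j + 1 + 1) := by
      have h3 : 1 ≤ m ^ (j + 1 + 1) := Nat.one_le_pow _ _ (by omega)
      push_cast [Nat.cast_sub h3]
      have : (X + l) * X ^ (j + 1) ≤ m * X ^ (j + 1) := by gcongr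
      have h4 : (m : ℝ) * (X ^ (j + 1) + 1) ≤ m * (m : ℝ) ^ (j + 1) := by gcongr
      rw [pow_succ X (j + 1), pow_succ (m : ℝ) (j + 1)]
      nlinarith
    have h0 : 0 < l * X ^ (j + 1) := by positivity
    refine (one_sub_sum_range_poissonWeight_le hN (by linarith)).trans ?_
    calc _ ≤ X ^ (j + 1 + 1) / (l * X ^ (j + 1)) ^ 2 := by gcongr
      _ ≤ 1 / (l : ℝ) ^ 2 := by
        rw [div_le_div_iff₀ (by positivity) (by positivity), mul_pow, one_mul, mul_comm]
        gcongr
        rw [← pow_mul]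
        exact pow_le_pow_right₀ hX (by omega)
      _ ≤ _ := by
        rw [div_le_div_iff₀ (by positivity) (by positivity)]
        nlinarith

theorem summable_four_div_sq : Summable fun l : ℕ => 4 / ((l : ℝ) + 1) ^ 2 := by
  have h := (summable_nat_add_iff 1).2 (Real.summable_one_div_nat_pow.2 (by norm_num : 1 < 2))
  have := h.mul_left 4
  refine this.congr fun l => ?_
  push_cast; ring

/-- The polynomial `∑ a_m ζ ^ (m ^ k)`. -/
def powerSum (a : ℕ → ℝ) (k : ℕ) (X : ℝ) (ζ : ℂ) : ℂ :=
  ∑ m ∈ Finset.Icc 1 ⌊X⌋₊, (a m : ℂ) * ζ ^ m ^ k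

/-- The terms m ≤ X are almost untouched by truncation and those with m > X are almost removed. Both
errors are summable in the distance from m to X, and every one carries the factor `‖expTransform
β‖`. -/
theorem exists_norm_smoothTransform_sub_le (hk : 2 ≤ k) (ha : ∀ n, 0 ≤ a n)
    (hB : ∀ n, 1 ≤ n → a n ≤ B) : ∃ C : ℝ, 0 ≤ C ∧ ∀ X : ℝ, 1 ≤ X → ∀ β : ℝ,
      ‖smoothTransform a k (X ^ k) β - powerSum a k X (expTransform β)‖ ≤ C * ‖expTransform β‖ := by
  have hk0 : k ≠ 0 := by omega
  have hB0 : 0 ≤ B := (ha 1).trans (hB 1 le_rfl)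
  set S := ∑' l : ℕ, 4 / ((l : ℝ) + 1) ^ 2 with hS
  have hsum := summable_four_div_sq
  have hS0 : 0 ≤ S := tsum_nonneg fun l => by positivity
  refine ⟨3 * B * S, by positivity, fun X hX β => ?_⟩
  have hN : 0 ≤ X ^ k := by positivity
  have hP : 1 ≤ ⌊X⌋₊ := Nat.le_floor (by simpa using hX)
  set P := ⌊X⌋₊ with hPdef
  have hh := (hasSum_nat_add_iff' P).2 (hasSum_smoothTransform hk0 ha hB hN β)
  have hone : ∀ m : ℕ, 1 ≤ (m + 1) ^ k := fun m => Nat.one_le_pow _ _ (by omega)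
  have htail : ‖smoothTransform a k (X ^ k) β - ∑ m ∈ Finset.range P,
      (a (m + 1) : ℂ) * poissonTransform ((m + 1) ^ k - 1) (X ^ k) β‖ ≤
      2 * B * ‖expTransform β‖ * S := by
    rw [← hh.tsum_eq]
    refine tsum_of_norm_bounded (hsum.hasSum.mul_left (2 * B * ‖expTransform β‖)) fun l => ?_
    have h2 : 2 ≤ (l + P + 1) ^ k := by
      calc 2 ≤ l + P + 1 := by omega
        _ ≤ _ := Nat.le_self_pow hk0 _
    have h1 := norm_poissonTransform_succ_le ((l + P + 1) ^ k - 2) hN β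
    rw [show (l + P + 1) ^ k - 2 + 1 = (l + P + 1) ^ k - 1 by omega] at h1
    have h3 := one_sub_sum_range_poissonWeight_pow_le hk hX l
    rw [norm_mul, Complex.norm_real, Real.norm_of_nonneg (ha _)]
    calc _ ≤ B * (‖expTransform β‖ * (2 * (4 / ((l : ℝ) + 1) ^ 2))) := by
          refine mul_le_mul (hB _ (by omega)) (h1.trans ?_) (norm_nonneg _) hB0
          gcongr
      _ = _ := by ring
  have hhead : ‖∑ m ∈ Finset.range P,
      (a (m + 1) : ℂ) * poissonTransform ((m + 1) ^ k - 1) (X ^ k) β -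
      powerSum a k X (expTransform β)‖ ≤ B * ‖expTransform β‖ * S := by
    rw [powerSum, sum_Icc_one_eq_sum_range, ← Finset.sum_sub_distrib]
    -- The terms are reindexed by the distance to the end point ⌊X⌋, which is the variable the tail
    -- bound decays in.
    have h1 : ∑ m ∈ Finset.range P, B * ‖expTransform β‖ * (4 / (((P - 1 - m : ℕ) : ℝ) + 1) ^ 2) ≤
        B * ‖expTransform β‖ * S := by
      rw [← Finset.mul_sum, Finset.sum_range_reflect (fun l => 4 / ((l : ℝ) + 1) ^ 2) P]
      gcongr
      exact hsum.sum_le_tsum _ fun l _ => by positivity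
    refine le_trans (norm_sum_le_of_le _ fun m hm => ?_) h1
    have hmP := Finset.mem_range.1 hm
    have h2 := norm_poissonTransform_sub_le ((m + 1) ^ k - 1) hN β
    rw [show (m + 1) ^ k - 1 + 1 = (m + 1) ^ k by have := hone m; omega] at h2
    have h3 := sum_range_poissonWeight_pow_le hk hX (m := m + 1) (l := P - 1 - m) (by omega)
    rw [← mul_sub, norm_mul, Complex.norm_real, Real.norm_of_nonneg (ha _), mul_assoc]
    refine mul_le_mul (hB _ (by omega)) (h2.trans ?_) (norm_nonneg _) hB0
    gcongr
  calc _ ≤ 2 * B * ‖expTransform β‖ * S + B * ‖expTransform β‖ * S :=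
        (norm_sub_le_norm_sub_add_norm_sub _ _ _).trans (add_le_add htail hhead)
    _ = _ := by ring

theorem powerSum_one (X : ℝ) : powerSum a k X 1 = count a X := by
  simp [powerSum, count]

/-- The comparison of transforms at β = 0 is the comparison of total masses. -/
theorem approximates_smoothCount (hk : 2 ≤ k) (ha : ∀ n, 0 ≤ a n)
    (hB : ∀ n, 1 ≤ n → a n ≤ B) : Approximates (smoothCount a k) a := by
  have hk0 : k ≠ 0 := by omega
  refine ⟨contDiff_smoothCount hk0 ha hB, monotone_smoothCount hk0 ha hB, by simp [smoothCount], ?_⟩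
  obtain ⟨C, -, h⟩ := exists_norm_smoothTransform_sub_le hk ha hB
  refine IsBigO.of_bound C ?_
  filter_upwards [eventually_ge_atTop (1 : ℝ)] with X hX
  have := h X hX 0
  rw [smoothTransform_zero hk0 ha hB (by linarith), expTransform_zero, powerSum_one,
    ← Complex.ofReal_sub, Complex.norm_real] at this
  simpa using this

end

/-! ### The Poisson kernel on a tangent circle -/

/-- The Poisson kernel of the unit circle at the point `1 / (1 - 2 π i β)`. -/
def tangentKernel (β y : ℝ) : ℝ :=
  (2 * Real.pi * β) ^ 2 / ((1 - Real.cos (2 * Real.pi * y)) ^ 2 +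
    (2 * Real.pi * β - Real.sin (2 * Real.pi * y)) ^ 2)

theorem tangentKernel_nonneg (β y : ℝ) : 0 ≤ tangentKernel β y := by
  unfold tangentKernel; positivity

theorem circleMap_two_pi_mul (y : ℝ) : circleMap 0 1 (2 * Real.pi * y) = e y := by
  rw [circleMap, e]
  push_cast
  simp only [one_mul, zero_add]
  ring_nf

theorem e_eq_cos_add_sin (y : ℝ) : e y = ⟨Real.cos (2 * Real.pi * y), Real.sin (2 * Real.pi * y)⟩ := by
  have h : e y = Complex.exp ((2 * Real.pi * y : ℝ) * Complex.I) := by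
    rw [e]; push_cast; ring_nf
  rw [h]
  apply Complex.ext
  · rw [Complex.exp_ofReal_mul_I_re]
  · rw [Complex.exp_ofReal_mul_I_im]

theorem tangentKernel_eq {β : ℝ} (hβ : β ≠ 0) (y : ℝ) :
    (‖e y‖ ^ 2 - ‖expTransform β‖ ^ 2) / ‖e y - expTransform β‖ ^ 2 = tangentKernel β y := by
  have hz := one_sub_ne_zero β
  have h1 : e y - expTransform β = (e y * (1 - 2 * Real.pi * Complex.I * β) - 1) * expTransform β := by
    rw [sub_mul, mul_assoc, expTransform, mul_inv_cancel₀ hz]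
    ring
  have h2 : ‖e y * (1 - 2 * Real.pi * Complex.I * β) - 1‖ ^ 2 = (1 - Real.cos (2 * Real.pi * y)) ^ 2 +
    (2 * Real.pi * β - Real.sin (2 * Real.pi * y)) ^ 2 := by
    rw [← Complex.normSq_eq_norm_sq, e_eq_cos_add_sin, Complex.normSq_apply]
    simp
    linear_combination (2 * Real.pi * β) ^ 2 * Real.sin_sq_add_cos_sq (2 * Real.pi * y)
  rw [h1, norm_mul, mul_pow, h2, norm_e, norm_expTransform_sq, tangentKernel]
  have h3 : (0 : ℝ) < 1 + (2 * Real.pi * β) ^ 2 := by positivity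
  have h4 : (1 : ℝ) ^ 2 - 1 / (1 + (2 * Real.pi * β) ^ 2) =
      (2 * Real.pi * β) ^ 2 * (1 / (1 + (2 * Real.pi * β) ^ 2)) := by
    field_simp; ring
  rw [h4, mul_div_mul_right _ _ (by positivity)]

theorem norm_expTransform_lt_one {β : ℝ} (hβ : β ≠ 0) : ‖expTransform β‖ < 1 := by
  have h := norm_expTransform_sq β
  have : 1 / (1 + (2 * Real.pi * β) ^ 2) < 1 := by
    rw [div_lt_one (by positivity)]
    have : 0 < (2 * Real.pi * β) ^ 2 := by positivity
    linarith
  nlinarith [norm_nonneg (expTransform β)]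

/-- Poisson's integral formula for an entire function; β ≠ 0 puts the point strictly inside the
disc. -/
theorem integral_tangentKernel_mul {F : ℂ → ℂ} (hF : Differentiable ℂ F) {β : ℝ} (hβ : β ≠ 0) :
    ∫ y in (0 : ℝ)..1, (tangentKernel β y : ℂ) * F (e y) = F (expTransform β) := by
  have h := hF.diffContOnCl.circleAverage_poissonKernel_smul' (c := 0) (R := 1)
    (w := expTransform β) (by simpa using norm_expTransform_lt_one hβ)
  rw [Real.circleAverage_def] at h
  have hpi : 2 * Real.pi ≠ 0 := by positivity
  have h2 := intervalIntegral.integral_comp_mul_left (a := 0) (b := 1) (fun θ => (fun z : ℂ =>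
    ((‖z - 0‖ ^ 2 - ‖expTransform β - 0‖ ^ 2) / ‖(z - 0) - (expTransform β - 0)‖ ^ 2) • F z)
      (circleMap 0 1 θ)) hpi
  rw [mul_zero, mul_one, h] at h2
  rw [← h2]
  refine intervalIntegral.integral_congr fun y _ => ?_
  simp only [circleMap_two_pi_mul, sub_zero, tangentKernel_eq hβ, Complex.real_smul]

theorem tangentKernel_denom_pos {β : ℝ} (hβ : β ≠ 0) (y : ℝ) :
    0 < (1 - Real.cos (2 * Real.pi * y)) ^ 2 +
      (2 * Real.pi * β - Real.sin (2 * Real.pi * y)) ^ 2 := by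
  rcases eq_or_ne (1 - Real.cos (2 * Real.pi * y)) 0 with h | h
  · have hs : Real.sin (2 * Real.pi * y) = 0 := by
      have := Real.sin_sq_add_cos_sq (2 * Real.pi * y)
      have hc : Real.cos (2 * Real.pi * y) = 1 := by linarith
      rw [hc] at this
      nlinarith
    rw [h, hs, sub_zero]
    positivity
  · positivity

theorem continuousOn_tangentKernel :
    ContinuousOn (fun x : ℝ × ℝ => tangentKernel x.1 x.2) {x | x.1 ≠ 0} := by
  unfold tangentKernel
  refine ContinuousOn.div (by fun_prop) (by fun_prop) fun x hx => ?_
  exact (tangentKernel_denom_pos hx x.2).ne'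

theorem continuous_tangentKernel {β : ℝ} (hβ : β ≠ 0) : Continuous (tangentKernel β) := by
  unfold tangentKernel
  exact Continuous.div (by fun_prop) (by fun_prop) fun y => (tangentKernel_denom_pos hβ y).ne'

theorem integral_tangentKernel {β : ℝ} (hβ : β ≠ 0) : ∫ y in (0 : ℝ)..1, tangentKernel β y = 1 := by
  have h := integral_tangentKernel_mul (F := fun _ => 1) (by fun_prop) hβ
  simp only [mul_one, intervalIntegral.integral_ofReal] at h
  exact_mod_cast h

theorem sin_sq_le_two_mul (θ : ℝ) : Real.sin θ ^ 2 ≤ 2 * (1 - Real.cos θ) := by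
  nlinarith [Real.sin_sq_add_cos_sq θ, sq_nonneg (1 - Real.cos θ)]

/-- From x² ≤ 2(x - v)² + 2v² and sin² ≤ 2(1 - cos). For fixed y the right side is a constant plus a
multiple of a Cauchy density in β, whose integral does not depend on y. -/
theorem tangentKernel_le (β y : ℝ) : tangentKernel β y ≤ 2 + 4 * ((1 - Real.cos (2 * Real.pi * y)) /
    ((1 - Real.cos (2 * Real.pi * y)) ^ 2 +
      (2 * Real.pi * β - Real.sin (2 * Real.pi * y)) ^ 2)) := by
  have h1 := sin_sq_le_two_mul (2 * Real.pi * y)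
  unfold tangentKernel
  set p := 1 - Real.cos (2 * Real.pi * y) with hp
  set x := 2 * Real.pi * β
  set v := Real.sin (2 * Real.pi * y)
  rcases (by positivity : 0 ≤ p ^ 2 + (x - v) ^ 2).eq_or_lt with h | h
  · rw [← h]; simp
  · rw [div_le_iff₀ h, add_mul, mul_assoc, div_mul_cancel₀ _ h.ne']
    nlinarith [sq_nonneg p, sq_nonneg (x - v - v)]

/-- Bound for y away from the integers, hence for e(y) away from the point of tangency. -/
theorem tangentKernel_le_of_cos {Y β y : ℝ} (hY : 1 ≤ Y)
    (h : 2 / Y ^ 2 ≤ 1 - Real.cos (2 * Real.pi * y)) : tangentKernel β y ≤ 4 * Y ^ 2 := by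
  refine (tangentKernel_le β y).trans ?_
  set p := 1 - Real.cos (2 * Real.pi * y) with hp
  have hY2 : 1 ≤ Y ^ 2 := one_le_pow₀ hY
  have hp0 : 0 < p := lt_of_lt_of_le (by positivity) h
  have h2 : p / (p ^ 2 + (2 * Real.pi * β - Real.sin (2 * Real.pi * y)) ^ 2) ≤ Y ^ 2 / 2 := by
    rw [div_le_div_iff₀ (by positivity) (by positivity)]
    rw [div_le_iff₀ (by positivity)] at h
    nlinarith [mul_le_mul_of_nonneg_left h hp0.le,
      mul_nonneg (by positivity : 0 ≤ Y ^ 2)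
        (sq_nonneg (2 * Real.pi * β - Real.sin (2 * Real.pi * y)))]
  linarith

/-- Bound for y so close to an integer that its distance is small compared with β. -/
theorem tangentKernel_le_of_sin {β y : ℝ} (hβ : β ≠ 0)
    (h : 3 * |Real.sin (2 * Real.pi * y)| ≤ |2 * Real.pi * β|) : tangentKernel β y ≤ 4 := by
  unfold tangentKernel
  rw [div_le_iff₀ (tangentKernel_denom_pos hβ y)]
  set x := 2 * Real.pi * β
  set v := Real.sin (2 * Real.pi * y)
  have h1 : |x| ≤ 2 * |x - v| := by
    have := abs_sub_abs_le_abs_sub x v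
    have := abs_nonneg x
    linarith
  have h2 := sq_le_sq' (by linarith [abs_nonneg x, abs_nonneg (x - v)]) h1
  rw [mul_pow, sq_abs, sq_abs] at h2
  nlinarith [sq_nonneg (1 - Real.cos (2 * Real.pi * y))]

theorem eight_mul_sq_le_one_sub_cos {y d : ℝ} (hd : 0 ≤ d) (hy : ∀ j : ℤ, d ≤ |y - j|) :
    8 * d ^ 2 ≤ 1 - Real.cos (2 * Real.pi * y) := by
  set j := round y
  have h1 := abs_sub_round y
  have h2 : Real.cos (2 * Real.pi * y) = Real.cos (2 * Real.pi * (y - j)) := by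
    rw [mul_sub, mul_comm (2 * Real.pi) (j : ℝ), Real.cos_sub_int_mul_two_pi]
  have h3 := hy j
  set u := y - j
  have hpi := Real.pi_pos
  have h4 : 2 * |u| ≤ Real.sin (Real.pi * |u|) := by
    have := Real.mul_le_sin (x := Real.pi * |u|) (by positivity) (by nlinarith)
    calc 2 * |u| = 2 / Real.pi * (Real.pi * |u|) := by field_simp
      _ ≤ _ := this
  have h5 : Real.cos (2 * Real.pi * u) = 1 - 2 * Real.sin (Real.pi * |u|) ^ 2 := by
    rw [← Real.cos_abs, abs_mul, abs_of_pos (by positivity : 0 < 2 * Real.pi), mul_assoc,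
      Real.cos_two_mul, Real.cos_sq']
    ring
  rw [h2, h5]
  nlinarith [abs_nonneg u]

/-- The kernel is small on the major arcs as soon as `β` is outside a neighbourhood of zero. -/
theorem tangentKernel_le_of_mem_majorArcs {k : ℕ} {X Y β y : ℝ} (hX : 0 < X) (hY : 1 ≤ Y)
    (hYX : 2 * Y ^ 2 ≤ X ^ k) (hβ : 3 * (Y / X ^ k) ≤ |β|) (hy : y ∈ majorArcs k X Y) :
    tangentKernel β y ≤ 4 * Y ^ 2 := by
  rw [mem_majorArcs_iff] at hy
  obtain ⟨q, hq, hqY, b, hb⟩ := hy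
  have hXk : 0 < X ^ k := by positivity
  have hq1 : (1 : ℝ) ≤ q := by exact_mod_cast hq
  have hr0 : 0 < Y / X ^ k := by positivity
  have hβ0 : β ≠ 0 := by
    rintro rfl
    rw [abs_zero] at hβ
    linarith
  have hdist : |y - b / q| ≤ Y / X ^ k := by
    have : y - b / q = (y * q - b) / q := by field_simp
    rw [this, abs_div, Nat.abs_cast, div_le_iff₀ (by linarith)]
    nlinarith
  -- If b/q is an integer, then y is within Y/X^k of it while |β| is at least three times that.
  -- Otherwise b/q is at least 1/Y from every integer, so y is at least 1/(2Y) away.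
  by_cases hdvd : (q : ℤ) ∣ b
  · obtain ⟨j, rfl⟩ := hdvd
    have e1 : ((((q : ℤ) * j : ℤ) : ℝ)) / q = j := by push_cast; field_simp
    rw [e1] at hdist
    refine (tangentKernel_le_of_sin hβ0 ?_).trans (by nlinarith [one_le_pow₀ hY (n := 2)])
    have h2 : Real.sin (2 * Real.pi * y) = Real.sin (2 * Real.pi * (y - j)) := by
      rw [mul_sub, mul_comm (2 * Real.pi) (j : ℝ), Real.sin_sub_int_mul_two_pi]
    have h3 : |Real.sin (2 * Real.pi * y)| ≤ 2 * Real.pi * |y - j| := by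
      rw [h2]
      refine Real.abs_sin_le_abs.trans ?_
      rw [abs_mul, abs_of_pos (by positivity : 0 < 2 * Real.pi)]
    rw [abs_mul, abs_of_pos (by positivity : 0 < 2 * Real.pi)]
    have hpi := Real.pi_pos
    calc 3 * |Real.sin (2 * Real.pi * y)| ≤ 3 * (2 * Real.pi * (Y / X ^ k)) := by
          gcongr
          exact h3.trans (by gcongr)
      _ = 2 * Real.pi * (3 * (Y / X ^ k)) := by ring
      _ ≤ _ := by gcongr
  · refine tangentKernel_le_of_cos hY ?_
    have h := eight_mul_sq_le_one_sub_cos (y := y) (d := 1 / (2 * Y)) (by positivity) fun j => ?_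
    · refine le_trans (le_of_eq ?_) h
      field_simp; norm_num
    · have h1 : 1 / (q : ℝ) ≤ |(b : ℝ) / q - j| := by
        have hne : b - j * q ≠ 0 := fun h0 => hdvd ⟨j, by linarith⟩
        have h2 : (1 : ℝ) ≤ |((b - j * q : ℤ) : ℝ)| := by
          rw [← Int.cast_abs]
          exact_mod_cast Int.one_le_abs hne
        have h3 : (b : ℝ) / q - j = ((b - j * q : ℤ) : ℝ) / q := by push_cast; field_simp
        rw [h3, abs_div, Nat.abs_cast]
        gcongr
      have h4 : 1 / Y ≤ 1 / (q : ℝ) := by gcongr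
      have h5 : Y / X ^ k ≤ 1 / (2 * Y) := by
        rw [div_le_div_iff₀ hXk (by positivity)]
        nlinarith
      have h6 : |(b : ℝ) / q - j| ≤ |y - b / q| + |y - j| := by
        rw [abs_sub_comm y (b / q)]
        have := abs_sub_le ((b : ℝ) / q) y j
        linarith
      have h7 : 1 / Y = 1 / (2 * Y) + 1 / (2 * Y) := by field_simp; norm_num
      linarith

theorem integrable_cauchyDensity {p : ℝ} (hp : 0 < p) (v : ℝ) :
    Integrable (fun β : ℝ => p / (p ^ 2 + (2 * Real.pi * β - v) ^ 2)) ∧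
      ∫ β : ℝ, p / (p ^ 2 + (2 * Real.pi * β - v) ^ 2) = 1 / 2 := by
  have hpi := Real.pi_pos
  have e1 : (fun β : ℝ => p / (p ^ 2 + (2 * Real.pi * β - v) ^ 2)) =
      fun β => p⁻¹ * (fun x : ℝ => (1 + x ^ 2)⁻¹) ((2 * Real.pi / p) * (β - v / (2 * Real.pi))) := by
    ext β
    have : 0 < p ^ 2 + (2 * Real.pi * β - v) ^ 2 := by positivity
    have h2 : 2 * Real.pi / p * (β - v / (2 * Real.pi)) = (2 * Real.pi * β - v) / p := by
      field_simp
    have h3 : 1 + ((2 * Real.pi * β - v) / p) ^ 2 = (p ^ 2 + (2 * Real.pi * β - v) ^ 2) / p ^ 2 := by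
      field_simp
    simp only [h2, h3, inv_div]
    field_simp
  have hne : 2 * Real.pi / p ≠ 0 := by positivity
  rw [e1]
  constructor
  · refine Integrable.const_mul ?_ _
    exact (integrable_inv_one_add_sq.comp_mul_left' hne).comp_sub_right (v / (2 * Real.pi))
  · rw [integral_const_mul, integral_sub_right_eq_self (fun β : ℝ => (1 + (2 * Real.pi / p * β) ^ 2)⁻¹),
      Measure.integral_comp_mul_left (fun x : ℝ => (1 + x ^ 2)⁻¹), integral_univ_inv_one_add_sq,
      abs_of_pos (by positivity), smul_eq_mul]
    field_simp

/-- The kernel has mean 1 in y; the same kernel integrated in β is also bounded, which is what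
allows the order of integration to be exchanged. The 6 is 2 · 2 from the constant and 4 · 1/2 from
the Cauchy density. -/
theorem setIntegral_tangentKernel_le {S : Set ℝ} (hS : MeasurableSet S) (hS1 : S ⊆ Set.Icc (-1) 1)
    (y : ℝ) (hint : IntegrableOn (fun β => tangentKernel β y) S) :
    ∫ β in S, tangentKernel β y ≤ 6 := by
  set p := 1 - Real.cos (2 * Real.pi * y) with hp
  set v := Real.sin (2 * Real.pi * y) with hv
  have hp0 : 0 ≤ p := by linarith [Real.cos_le_one (2 * Real.pi * y)]
  have hfin : volume S < ⊤ := (measure_mono hS1).trans_lt (by simp)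
  have hvol : volume.real S ≤ 2 := by
    have := measureReal_mono (μ := volume) hS1 (by simp)
    rwa [Real.volume_real_Icc_of_le (by norm_num), show (1 : ℝ) - -1 = 2 by norm_num] at this
  have hc : IntegrableOn (fun _ : ℝ => (2 : ℝ)) S := integrableOn_const hfin.ne
  have hg : Integrable (fun β : ℝ => p / (p ^ 2 + (2 * Real.pi * β - v) ^ 2)) ∧
      ∫ β : ℝ, p / (p ^ 2 + (2 * Real.pi * β - v) ^ 2) ≤ 1 / 2 := by
    rcases hp0.eq_or_lt with h | h
    · rw [← h]; simp
    · exact ⟨(integrable_cauchyDensity h v).1, (integrable_cauchyDensity h v).2.le⟩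
  calc ∫ β in S, tangentKernel β y
      ≤ ∫ β in S, (2 + 4 * (p / (p ^ 2 + (2 * Real.pi * β - v) ^ 2))) :=
        setIntegral_mono_on hint (hc.add (hg.1.integrableOn.const_mul 4)) hS
          fun β _ => tangentKernel_le β y
    _ = 2 * volume.real S + 4 * ∫ β in S, p / (p ^ 2 + (2 * Real.pi * β - v) ^ 2) := by
        rw [integral_add hc (hg.1.integrableOn.const_mul 4), integral_const_mul, setIntegral_const,
          smul_eq_mul, mul_comm]
    _ ≤ 2 * 2 + 4 * (1 / 2) := by
        gcongr
        exact (setIntegral_le_integral hg.1 (ae_of_all _ fun β => by positivity)).trans hg.2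
    _ = 6 := by norm_num

/-- Jensen's inequality for the powers of a non-negative function. -/
theorem pow_integral_mul_le {K g : ℝ → ℝ} {μ : Measure ℝ} (hK : ∀ y, 0 ≤ K y) (hg : ∀ y, 0 ≤ g y)
    (hK1 : ∫ y, K y ∂μ = 1) (s : ℕ) (hs : 1 ≤ s) (hKi : Integrable K μ)
    (hKg : Integrable (fun y => K y * g y) μ) (hKgs : Integrable (fun y => K y * g y ^ s) μ) :
    (∫ y, K y * g y ∂μ) ^ s ≤ ∫ y, K y * g y ^ s ∂μ := by
  set c := ∫ y, K y * g y ∂μ with hc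
  have hc0 : 0 ≤ c := integral_nonneg fun y => mul_nonneg (hK y) (hg y)
  obtain ⟨j, rfl⟩ : ∃ j, s = j + 1 := ⟨s - 1, by omega⟩
  -- The tangent line to x^{j+1} at the mean c.
  have htan : ∀ x : ℝ, 0 ≤ x → (j + 1) * c ^ j * x - j * c ^ (j + 1) ≤ x ^ (j + 1) := by
    intro x hx
    rcases hc0.eq_or_lt with h | h
    · rw [← h]
      rcases Nat.eq_zero_or_pos j with rfl | hj
      · simp
      · rw [zero_pow (by omega), zero_pow (by omega)]
        have : 0 ≤ x ^ (j + 1) := by positivity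
        linarith
    · have h1 := one_add_mul_le_pow (a := x / c - 1) (by have := div_nonneg hx h.le; linarith) (j + 1)
      rw [add_sub_cancel, div_pow, le_div_iff₀ (by positivity)] at h1
      refine le_trans (le_of_eq ?_) h1
      push_cast
      rw [pow_succ]
      field_simp
      ring
  have h1 : ∫ y, ((j + 1) * c ^ j * (K y * g y) - j * c ^ (j + 1) * K y) ∂μ ≤
      ∫ y, K y * g y ^ (j + 1) ∂μ := by
    refine integral_mono ((hKg.const_mul _).sub (hKi.const_mul _)) hKgs fun y => ?_
    have := mul_le_mul_of_nonneg_left (htan (g y) (hg y)) (hK y)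
    simp only
    linarith
  rw [integral_sub (hKg.const_mul _) (hKi.const_mul _), integral_const_mul, integral_const_mul,
    hK1, ← hc] at h1
  refine le_trans (le_of_eq ?_) h1
  ring

/-! ### The tail of the singular integral -/

section
variable {a : ℕ → ℝ} {k : ℕ} {B : ℝ}

theorem differentiable_powerSum (X : ℝ) : Differentiable ℂ (powerSum a k X) := by
  unfold powerSum; fun_prop

theorem powerSum_e (X y : ℝ) : powerSum a k X (e y) = expSum a k y X := by
  refine Finset.sum_congr rfl fun m _ => ?_
  rw [← e_nat_mul]
  push_cast
  rw [mul_comm y]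

theorem norm_powerSum_le (ha : ∀ n, 0 ≤ a n) (X : ℝ) {ζ : ℂ} (hζ : ‖ζ‖ ≤ 1) :
    ‖powerSum a k X ζ‖ ≤ count a X * ‖ζ‖ := by
  rw [count, Finset.sum_mul]
  refine norm_sum_le_of_le _ fun m hm => ?_
  rw [norm_mul, norm_pow, Complex.norm_real, Real.norm_of_nonneg (ha m)]
  have : m ^ k ≠ 0 := pow_ne_zero _ (by have := (Finset.mem_Icc.1 hm).1; omega)
  exact mul_le_mul_of_nonneg_left (pow_le_of_le_one (norm_nonneg _) hζ this) (ha m)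

/-- For |ζ| ≤ 1/2 a geometric series gives a bound independent of X. It covers |β| ≥ 1. -/
theorem norm_powerSum_le_of_small (hk : k ≠ 0) (ha : ∀ n, 0 ≤ a n) (hB : ∀ n, 1 ≤ n → a n ≤ B)
    (X : ℝ) {ζ : ℂ} (hζ : ‖ζ‖ ≤ 1 / 2) : ‖powerSum a k X ζ‖ ≤ 2 * B * ‖ζ‖ := by
  have hB0 : 0 ≤ B := (ha 1).trans (hB 1 le_rfl)
  have h0 := norm_nonneg ζ
  rw [powerSum, sum_Icc_one_eq_sum_range]
  have h1 : ∑ m ∈ Finset.range ⌊X⌋₊, B * ‖ζ‖ * ‖ζ‖ ^ m ≤ B * ‖ζ‖ * 2 := by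
    rw [← Finset.mul_sum]
    gcongr
    refine ((summable_geometric_of_lt_one h0 (by linarith)).sum_le_tsum _
      fun m _ => by positivity).trans ?_
    rw [tsum_geometric_of_lt_one h0 (by linarith), inv_le_comm₀ (by linarith) (by norm_num)]
    linarith
  refine (norm_sum_le_of_le _ fun m _ => ?_).trans (h1.trans (by linarith))
  rw [norm_mul, norm_pow, Complex.norm_real, Real.norm_of_nonneg (ha _), mul_assoc, ← pow_succ']
  refine mul_le_mul (hB _ (by omega)) ?_ (by positivity) hB0
  exact pow_le_pow_of_le_one h0 (by linarith) (Nat.le_self_pow hk _)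

theorem continuous_expTransform : Continuous expTransform := by
  unfold expTransform
  exact Continuous.inv₀ (by fun_prop) one_sub_ne_zero

theorem norm_expTransform_le_half {β : ℝ} (hβ : 1 ≤ |β|) : ‖expTransform β‖ ≤ 1 / 2 := by
  have h := norm_expTransform_sq β
  have hpi := Real.pi_gt_three
  have h1 : (1 : ℝ) ≤ β ^ 2 := by rw [← sq_abs]; exact one_le_pow₀ hβ
  have : 1 / (1 + (2 * Real.pi * β) ^ 2) ≤ 1 / 4 := by
    refine one_div_le_one_div_of_le (by norm_num) ?_
    rw [mul_pow]
    nlinarith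
  nlinarith [norm_nonneg (expTransform β)]

theorem integrable_norm_expTransform_sq : Integrable fun β => ‖expTransform β‖ ^ 2 := by
  have := integrable_inv_one_add_sq.comp_mul_left' (by positivity : 2 * Real.pi ≠ 0)
  refine this.congr (ae_of_all _ fun β => ?_)
  simp only [norm_expTransform_sq, one_div]

theorem norm_expTransform_pow_le {s : ℕ} (hs : 2 ≤ s) (β : ℝ) :
    ‖expTransform β‖ ^ s ≤ ‖expTransform β‖ ^ 2 :=
  pow_le_pow_of_le_one (norm_nonneg _) (norm_expTransform_le_one β) hs

theorem integrable_pow_of_norm_le {E : Type*} [NormedAddCommGroup E] {h : ℝ → E} {C : ℝ} {s : ℕ}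
    (hs : 2 ≤ s) (hh : Continuous h) (hC : ∀ β, ‖h β‖ ≤ C * ‖expTransform β‖) :
    Integrable fun β => ‖h β‖ ^ s := by
  refine (integrable_norm_expTransform_sq.const_mul (C ^ s)).mono'
    (hh.norm.pow s).aestronglyMeasurable (ae_of_all _ fun β => ?_)
  rw [norm_pow, norm_norm]
  have hC0 : 0 ≤ C := by
    have h0 : 0 < ‖expTransform β‖ := by
      rw [norm_pos_iff]
      exact inv_ne_zero (one_sub_ne_zero β)
    have := (norm_nonneg _).trans (hC β)
    exact nonneg_of_mul_nonneg_left this h0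
  calc ‖h β‖ ^ s ≤ (C * ‖expTransform β‖) ^ s := by gcongr; exact hC β
    _ = C ^ s * ‖expTransform β‖ ^ s := mul_pow _ _ _
    _ ≤ _ := by
      gcongr ?_ * ?_
      exact norm_expTransform_pow_le hs β

/-- F(ζ) is an average of f against the tangent kernel. On the major arcs the kernel is at most 4Y²,
|f| ≤ A, and the measure is at most 4Y²/X^k; on the minor arcs Jensen's inequality followed by an
integration over β leaves the minor arc moment of f. Points near β = 0 must be excluded, since there
the kernel concentrates at y = 0. -/
theorem setIntegral_norm_powerSum_le (ha : ∀ n, 0 ≤ a n) {X Y : ℝ} (hX : 0 < X) (hY : 1 ≤ Y)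
    (hYX : 2 * Y ^ 2 ≤ X ^ k) {s : ℕ} (hs : 1 ≤ s) :
    ∫ β in {β : ℝ | 3 * (Y / X ^ k) ≤ |β|} ∩ Set.Icc (-1) 1, ‖powerSum a k X (expTransform β)‖ ^ s ≤
      2 ^ s * (2 * (16 * count a X * Y ^ 4 / X ^ k) ^ s +
        6 * ∫ y in Set.Ioc (0 : ℝ) (0 + 1) ∩ minorArcs k X Y, ‖expSum a k y X‖ ^ s) := by
  set A := count a X with hA
  have hA0 : 0 ≤ A := count_nonneg ha X
  have hXk : 0 < X ^ k := by positivity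
  have hY0 : 0 < Y := by linarith
  rw [zero_add]
  set D := {β : ℝ | 3 * (Y / X ^ k) ≤ |β|} ∩ Set.Icc (-1) 1 with hD
  set I := Set.Ioc (0 : ℝ) 1 with hI
  have hDc : IsCompact D :=
    isCompact_Icc.inter_left (isClosed_le continuous_const continuous_abs)
  have hDm : MeasurableSet D := hDc.isClosed.measurableSet
  have hDfin : volume D < ⊤ := hDc.measure_lt_top
  have hDvol : volume.real D ≤ 2 := by
    have := measureReal_mono (μ := volume) (Set.inter_subset_right : D ⊆ Set.Icc (-1) 1) (by simp)
    rwa [Real.volume_real_Icc_of_le (by norm_num), show (1 : ℝ) - -1 = 2 by norm_num] at this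
  have hD0 : ∀ β ∈ D, β ≠ 0 := by
    rintro β ⟨h1, -⟩ rfl
    have : 0 < Y / X ^ k := by positivity
    simp only [Set.mem_ofPred_eq, abs_zero] at h1
    linarith
  set M := majorArcs k X Y with hM
  set m := minorArcs k X Y with hm
  have hMm : MeasurableSet M := measurableSet_majorArcs
  have hmm : MeasurableSet m := measurableSet_minorArcs
  set f := fun y => ‖expSum a k y X‖ with hf
  have hfc : Continuous f := (continuous_expSum X).norm
  have hf0 : ∀ y, 0 ≤ f y := fun y => norm_nonneg _
  have hfA : ∀ y, f y ≤ A := fun y => norm_expSum_le ha _ _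
  have hii : ∀ {g : ℝ → ℝ}, Continuous g → IntegrableOn g I := fun hg =>
    (hg.continuousOn.integrableOn_compact isCompact_Icc).mono_set Set.Ioc_subset_Icc_self
  have hpt : ∀ β ∈ D, ‖powerSum a k X (expTransform β)‖ ^ s ≤
      2 ^ s * ((16 * A * Y ^ 4 / X ^ k) ^ s + ∫ y in I ∩ m, tangentKernel β y * f y ^ s) := by
    intro β hβ
    have hβ0 := hD0 β hβ
    have hKc := continuous_tangentKernel hβ0
    have hK0 := tangentKernel_nonneg β
    have h1 : ‖powerSum a k X (expTransform β)‖ ≤ ∫ y in I, tangentKernel β y * f y := by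
      rw [← integral_tangentKernel_mul (differentiable_powerSum X) hβ0]
      refine (intervalIntegral.norm_integral_le_integral_norm zero_le_one).trans (le_of_eq ?_)
      rw [intervalIntegral.integral_of_le zero_le_one]
      refine integral_congr_ae (ae_of_all _ fun y => ?_)
      simp only [norm_mul, powerSum_e, Complex.norm_real, Real.norm_of_nonneg (hK0 y), hf]
    have hsplit : ∫ y in I, tangentKernel β y * f y =
        (∫ y in I ∩ M, tangentKernel β y * f y) + ∫ y in I ∩ m, tangentKernel β y * f y := by
      exact (integral_inter_add_sdiff hMm (hii (hKc.mul hfc))).symm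
    have hmaj : ∫ y in I ∩ M, tangentKernel β y * f y ≤ 16 * A * Y ^ 4 / X ^ k := by
      have hfin : volume (I ∩ M) < ⊤ := (measure_mono Set.inter_subset_left).trans_lt (by simp [hI])
      have h2 := norm_setIntegral_le_of_norm_le_const (f := fun y => tangentKernel β y * f y)
        (C := 4 * Y ^ 2 * A) hfin fun y hy => by
          rw [Real.norm_of_nonneg (mul_nonneg (hK0 y) (hf0 y))]
          exact mul_le_mul (tangentKernel_le_of_mem_majorArcs hX hY hYX hβ.1 hy.2) (hfA y) (hf0 y)
            (by positivity)
      refine (le_abs_self _).trans (h2.trans ?_)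
      rw [Set.inter_comm]
      refine (mul_le_mul_of_nonneg_left (volume_majorArcs_inter_le hX hY0.le)
        (by positivity)).trans (le_of_eq ?_)
      ring
    have hmin : (∫ y in I ∩ m, tangentKernel β y * f y) ^ s ≤
        ∫ y in I ∩ m, tangentKernel β y * f y ^ s := by
      have hKm := hii hKc
      have e0 : ∀ p : ℕ, p ≠ 0 → (fun y => tangentKernel β y * m.indicator f y ^ p) =
          m.indicator fun y => tangentKernel β y * f y ^ p := by
        intro p hp
        ext y
        by_cases hy : y ∈ m <;> simp [hy, hp]
      have e1 := e0 1 one_ne_zero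
      simp only [pow_one] at e1
      -- Jensen's inequality needs a kernel of total mass 1, so the minor arc integral is written
      -- over the whole period with an indicator on f.
      have h2 := pow_integral_mul_le (μ := volume.restrict I) (K := tangentKernel β)
        (g := m.indicator f) hK0 (fun y => Set.indicator_nonneg (fun y _ => hf0 y) y)
        (by rw [← intervalIntegral.integral_of_le zero_le_one, integral_tangentKernel hβ0]) s hs hKm
        (by rw [e1]; exact (hii (hKc.mul hfc)).indicator hmm)
        (by rw [e0 s (by omega)]; exact (hii (hKc.mul (hfc.pow s))).indicator hmm)
      rw [e1, e0 s (by omega), setIntegral_indicator hmm, setIntegral_indicator hmm] at h2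
      exact h2
    have hmaj0 : 0 ≤ ∫ y in I ∩ M, tangentKernel β y * f y :=
      integral_nonneg fun y => mul_nonneg (hK0 y) (hf0 y)
    have hmin0 : 0 ≤ ∫ y in I ∩ m, tangentKernel β y * f y :=
      integral_nonneg fun y => mul_nonneg (hK0 y) (hf0 y)
    calc _ ≤ ((∫ y in I ∩ M, tangentKernel β y * f y) +
          ∫ y in I ∩ m, tangentKernel β y * f y) ^ s := by
          rw [← hsplit]
          exact pow_le_pow_left₀ (norm_nonneg _) h1 s
      _ ≤ 2 ^ s * ((∫ y in I ∩ M, tangentKernel β y * f y) ^ s +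
          (∫ y in I ∩ m, tangentKernel β y * f y) ^ s) := add_pow_le_two_pow_mul hmaj0 hmin0 s
      _ ≤ _ := by gcongr
  have hprod : Integrable (fun x : ℝ × ℝ => tangentKernel x.1 x.2 * f x.2 ^ s)
      ((volume.restrict D).prod (volume.restrict (I ∩ m))) := by
    rw [Measure.prod_restrict, ← Measure.volume_eq_prod]
    have hc : ContinuousOn (fun x : ℝ × ℝ => tangentKernel x.1 x.2 * f x.2 ^ s)
        (D ×ˢ Set.Icc (0 : ℝ) 1) := by
      refine (continuousOn_tangentKernel.mono fun x hx => hD0 x.1 hx.1).mul ?_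
      exact ((hfc.comp continuous_snd).pow s).continuousOn
    refine (hc.integrableOn_compact (hDc.prod isCompact_Icc)).mono_set ?_
    exact Set.prod_mono le_rfl (Set.inter_subset_left.trans Set.Ioc_subset_Icc_self)
  -- The order is exchanged so that, for each y, only the kernel is integrated over β.
  have hswap : ∫ β in D, ∫ y in I ∩ m, tangentKernel β y * f y ^ s ≤
      6 * ∫ y in I ∩ m, f y ^ s := by
    rw [integral_integral_swap hprod, ← integral_const_mul]
    refine setIntegral_mono_on hprod.integral_prod_right
      (((hii (hfc.pow s)).mono_set Set.inter_subset_left).const_mul 6)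
      (measurableSet_Ioc.inter hmm) fun y _ => ?_
    rw [integral_mul_const]
    refine mul_le_mul_of_nonneg_right (setIntegral_tangentKernel_le hDm Set.inter_subset_right y ?_)
      (pow_nonneg (hf0 y) s)
    refine ContinuousOn.integrableOn_compact hDc ?_
    exact continuousOn_tangentKernel.comp (by fun_prop : Continuous fun β : ℝ => (β, y)).continuousOn
      fun β hβ => hD0 β hβ
  have hcF : Continuous fun β => ‖powerSum a k X (expTransform β)‖ ^ s :=
    (((differentiable_powerSum X).continuous.comp continuous_expTransform).norm).pow s
  have hcst : IntegrableOn (fun _ : ℝ => (16 * A * Y ^ 4 / X ^ k) ^ s) D :=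
    integrableOn_const hDfin.ne
  have hfin := setIntegral_mono_on (hcF.continuousOn.integrableOn_compact hDc)
    ((hcst.add hprod.integral_prod_left).const_mul (2 ^ s)) hDm hpt
  refine hfin.trans ?_
  rw [integral_const_mul]
  simp only [Pi.add_apply]
  rw [integral_add hcst hprod.integral_prod_left, setIntegral_const, smul_eq_mul]
  gcongr

theorem continuous_smoothTransform (hk : k ≠ 0) (ha : ∀ n, 0 ≤ a n) (hB : ∀ n, 1 ≤ n → a n ≤ B)
    (N : ℝ) : Continuous (smoothTransform a k N) := by
  have hg := continuous_smoothDensity hk ha hB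
  have he := continuous_e
  unfold smoothTransform
  exact intervalIntegral.continuous_parametric_intervalIntegral_of_continuous' (by fun_prop) _ _

/-- The constant may depend on X: the bound serves for absolute convergence of the singular integral
at fixed X, which needs only s ≥ 2. -/
theorem exists_norm_smoothTransform_le (hk : 2 ≤ k) (ha : ∀ n, 0 ≤ a n)
    (hB : ∀ n, 1 ≤ n → a n ≤ B) {X : ℝ} (hX : 1 ≤ X) : ∃ C : ℝ, ∀ β : ℝ,
      ‖smoothTransform a k (X ^ k) β‖ ≤ C * ‖expTransform β‖ := by
  obtain ⟨C, -, h⟩ := exists_norm_smoothTransform_sub_le hk ha hB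
  refine ⟨C + count a X, fun β => ?_⟩
  have h1 := norm_powerSum_le (k := k) ha X (norm_expTransform_le_one β)
  have h2 := norm_sub_norm_le (smoothTransform a k (X ^ k) β) (powerSum a k X (expTransform β))
  linarith [h X hX β]

theorem integrable_norm_smoothTransform_pow (hk : 2 ≤ k) (ha : ∀ n, 0 ≤ a n)
    (hB : ∀ n, 1 ≤ n → a n ≤ B) {X : ℝ} (hX : 1 ≤ X) {s : ℕ} (hs : 2 ≤ s) :
    Integrable fun β => ‖smoothTransform a k (X ^ k) β‖ ^ s := by
  obtain ⟨C, hC⟩ := exists_norm_smoothTransform_le hk ha hB hX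
  exact integrable_pow_of_norm_le hs (continuous_smoothTransform (by omega) ha hB _) hC

end

namespace Regular
variable {a : ℕ → ℝ} {k : ℕ} {κ : (q : ℕ) → ZMod q → ℝ} {t₀ ϱ ω : ℝ}

/-- For |β| ≤ 1 the tangent kernel reduces the tail to the minor arc moment. For |β| ≥ 1, and for
the error of the smoothing, the contribution is O(1), which `exists_pow_le_count` makes admissible.
-/
theorem exists_tail_saving (H : Regular a k κ t₀ ϱ ω) {s : ℕ} (hs : 2 * t₀ + 5 * ω / ϱ < s) :
    ∃ η C : ℝ, 0 < η ∧ 0 ≤ C ∧ ∀ᶠ X : ℝ in atTop,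
      ∫ β in {β : ℝ | 3 * (count a X ^ (1 / 5 : ℝ) / X ^ k) ≤ |β|},
        ‖smoothTransform a k (X ^ k) β‖ ^ s ≤ C * (count a X ^ (s - η) / X ^ k) := by
  have hs3 := H.three_le hs
  obtain ⟨B, hB0, hB⟩ := H.bound
  obtain ⟨E, hE0, hE⟩ := exists_norm_smoothTransform_sub_le H.two_le H.nonneg hB
  obtain ⟨η₁, C₁, hη₁, hC₁, hmin⟩ := H.exists_minor_saving hs
  obtain ⟨η₂, C₂, hη₂, hC₂, hpow⟩ := H.exists_pow_le_count hs
  set G := ∫ β, ‖expTransform β‖ ^ 2 with hG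
  have hG0 : 0 ≤ G := integral_nonneg fun β => by positivity
  set η := min (min η₁ η₂) 1 with hη
  refine ⟨η, 2 ^ s * (2 ^ s * (2 * 16 ^ s + 6 * C₁) + (2 * B) ^ s * G * C₂ + E ^ s * G * C₂),
    lt_min (lt_min hη₁ hη₂) one_pos, by positivity, ?_⟩
  have hsR : (3 : ℝ) ≤ s := by exact_mod_cast hs3
  have hkR : (2 : ℝ) ≤ k := by exact_mod_cast H.two_le
  filter_upwards [hmin, hpow, eventually_ge_atTop (1 : ℝ), H.top.eventually_ge_atTop 1,
    H.eventually_mul_count_rpow_le (p := 2 / 5) (q := 2) (by norm_num) (by norm_num) 2,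
    -- The major arc part of the kernel bound is (A Y⁴/X^k)^s, with A^{9s/5} in the numerator. The
    -- comparison 4s/5 + 1 < k(s - 1) uses k ≥ 2 and s ≥ 3.
    H.eventually_mul_count_rpow_le (p := 4 * s / 5 + 1) (q := k * (s - 1)) (by positivity)
      (by nlinarith) 1] with X h1 h2 h3 h4 h5 h6
  have hX0 : 0 < X := by linarith
  set A := count a X with hA
  have hA0 : 0 < A := by linarith
  set Y := A ^ (1 / 5 : ℝ) with hY
  have hY1 : 1 ≤ Y := Real.one_le_rpow h4 (by norm_num)
  have hXk : 0 < X ^ k := by positivity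
  have hYX : 2 * Y ^ 2 ≤ X ^ k := by
    have e1 : Y ^ 2 = A ^ (2 / 5 : ℝ) := by
      rw [hY, ← Real.rpow_natCast, ← Real.rpow_mul hA0.le]; norm_num
    rw [e1]
    refine h5.trans ?_
    rw [show X ^ (2 : ℝ) = X ^ 2 by norm_cast]
    exact pow_le_pow_right₀ h3 H.two_le
  set S := {β : ℝ | 3 * (Y / X ^ k) ≤ |β|} with hS
  have hSm : MeasurableSet S := (isClosed_le continuous_const continuous_abs).measurableSet
  have hF := differentiable_powerSum (a := a) (k := k) X
  have hFi : Integrable fun β => ‖powerSum a k X (expTransform β)‖ ^ s :=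
    integrable_pow_of_norm_le (by omega) (hF.continuous.comp continuous_expTransform)
      fun β => norm_powerSum_le H.nonneg X (norm_expTransform_le_one β)
  have hnear := setIntegral_norm_powerSum_le H.nonneg hX0 hY1 hYX (s := s) (by omega)
  have hfar : ∫ β in S \ Set.Icc (-1) 1, ‖powerSum a k X (expTransform β)‖ ^ s ≤
      (2 * B) ^ s * G := by
    calc _ ≤ ∫ β in S \ Set.Icc (-1) 1, (2 * B) ^ s * ‖expTransform β‖ ^ 2 := by
          refine setIntegral_mono_on hFi.integrableOn
            (integrable_norm_expTransform_sq.const_mul _).integrableOn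
            (hSm.diff measurableSet_Icc) fun β hβ => ?_
          have hβ1 : 1 ≤ |β| := by
            by_contra hlt
            exact hβ.2 (abs_le.1 (not_le.1 hlt).le)
          refine (pow_le_pow_left₀ (norm_nonneg _) (norm_powerSum_le_of_small H.ne_zero H.nonneg hB X
            (norm_expTransform_le_half hβ1)) s).trans ?_
          rw [mul_pow]
          exact mul_le_mul_of_nonneg_left (norm_expTransform_pow_le (by omega) β) (by positivity)
      _ ≤ ∫ β, (2 * B) ^ s * ‖expTransform β‖ ^ 2 :=
          setIntegral_le_integral (integrable_norm_expTransform_sq.const_mul _)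
            (ae_of_all _ fun β => by positivity)
      _ = _ := integral_const_mul _ _
  have hFS : ∫ β in S, ‖powerSum a k X (expTransform β)‖ ^ s ≤
      2 ^ s * (2 * (16 * A * Y ^ 4 / X ^ k) ^ s + 6 * (C₁ * (A ^ (s - η₁) / X ^ k))) +
        (2 * B) ^ s * G := by
    rw [← integral_inter_add_sdiff measurableSet_Icc hFi.integrableOn]
    refine add_le_add (hnear.trans ?_) hfar
    have := h1 0
    gcongr
  have hES : ∫ β in S, E ^ s * ‖expTransform β‖ ^ 2 ≤ E ^ s * G := by
    rw [hG, ← integral_const_mul]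
    exact setIntegral_le_integral (integrable_norm_expTransform_sq.const_mul _)
      (ae_of_all _ fun β => by positivity)
  have hmain : ∫ β in S, ‖smoothTransform a k (X ^ k) β‖ ^ s ≤
      2 ^ s * ((∫ β in S, ‖powerSum a k X (expTransform β)‖ ^ s) +
        ∫ β in S, E ^ s * ‖expTransform β‖ ^ 2) := by
    rw [← integral_add hFi.integrableOn (integrable_norm_expTransform_sq.const_mul _).integrableOn,
      ← integral_const_mul]
    refine setIntegral_mono_on
      (integrable_norm_smoothTransform_pow H.two_le H.nonneg hB h3 (by omega)).integrableOn
      ((hFi.add (integrable_norm_expTransform_sq.const_mul _)).const_mul _).integrableOn hSm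
      fun β _ => ?_
    have h7 := norm_sub_norm_le (smoothTransform a k (X ^ k) β) (powerSum a k X (expTransform β))
    have h8 := hE X h3 β
    calc _ ≤ (‖powerSum a k X (expTransform β)‖ + E * ‖expTransform β‖) ^ s := by
          gcongr; linarith
      _ ≤ 2 ^ s * (‖powerSum a k X (expTransform β)‖ ^ s + (E * ‖expTransform β‖) ^ s) :=
          add_pow_le_two_pow_mul (norm_nonneg _) (by positivity) s
      _ ≤ _ := by
          rw [mul_pow E]
          have := norm_expTransform_pow_le (s := s) (by omega) β
          gcongr
  have hone : 1 ≤ C₂ * (A ^ ((s : ℝ) - η) / X ^ k) := by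
    rw [mul_div_assoc', le_div_iff₀ hXk, one_mul]
    refine h2.trans ?_
    gcongr
    exact (min_le_left _ _).trans (min_le_right _ _)
  have hmaj : (16 * A * Y ^ 4 / X ^ k) ^ s ≤ 16 ^ s * (A ^ ((s : ℝ) - η) / X ^ k) := by
    have e1 : (A * Y ^ 4) ^ s = A ^ ((s : ℝ) - η) * A ^ (4 * s / 5 + η) := by
      rw [← Real.rpow_add hA0, hY, ← Real.rpow_natCast (A ^ (1 / 5 : ℝ)), ← Real.rpow_mul hA0.le,
        ← Real.rpow_one_add' hA0.le (by norm_num), ← Real.rpow_natCast, ← Real.rpow_mul hA0.le]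
      congr 1; push_cast; ring
    have e2 : A ^ (4 * s / 5 + η) ≤ (X ^ k) ^ (s - 1) := by
      rw [one_mul] at h6
      calc A ^ (4 * s / 5 + η) ≤ A ^ (4 * (s : ℝ) / 5 + 1) :=
            Real.rpow_le_rpow_of_exponent_le h4 (by linarith [min_le_right (min η₁ η₂) 1])
        _ ≤ X ^ ((k : ℝ) * (s - 1)) := h6
        _ = _ := by
          rw [← pow_mul, ← Real.rpow_natCast]
          push_cast [Nat.cast_sub (by omega : 1 ≤ s)]
          rfl
    have e3 : (X ^ k) ^ s = (X ^ k) ^ (s - 1) * X ^ k := by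
      rw [← pow_succ]; congr 1; omega
    rw [mul_assoc, mul_div_assoc, mul_pow, div_pow, e1, e3]
    refine mul_le_mul_of_nonneg_left ?_ (by positivity)
    rw [div_le_div_iff₀ (by positivity) (by positivity)]
    calc A ^ ((s : ℝ) - η) * A ^ (4 * s / 5 + η) * X ^ k ≤
        A ^ ((s : ℝ) - η) * (X ^ k) ^ (s - 1) * X ^ k := by gcongr
      _ = _ := by ring
  refine hmain.trans ?_
  set T := A ^ ((s : ℝ) - η) / X ^ k with hT
  calc _ ≤ 2 ^ s * ((2 ^ s * (2 * (16 ^ s * T) + 6 * (C₁ * T)) + (2 * B) ^ s * G * (C₂ * T)) +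
        E ^ s * G * (C₂ * T)) := by
        gcongr
        · refine hFS.trans ?_
          have hT1 : A ^ ((s : ℝ) - η₁) / X ^ k ≤ T := by
            rw [hT]
            gcongr
            exact (min_le_left _ _).trans (min_le_left _ _)
          refine add_le_add ?_ (le_mul_of_one_le_right (by positivity) hone)
          gcongr
        · exact hES.trans (le_mul_of_one_le_right (by positivity) hone)
    _ = _ := by ring

end Regular

/-! ### The singular series and the singular integral are non-negative -/

/-- The non-negative real numbers inside the complex numbers. -/
def nonnegReals : Set ℂ := Complex.ofReal '' Set.Ici 0

theorem isClosed_nonnegReals : IsClosed nonnegReals :=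
  Complex.isometry_ofReal.isClosedEmbedding.isClosedMap _ isClosed_Ici

theorem ofReal_mem_nonnegReals {r : ℝ} (hr : 0 ≤ r) : (r : ℂ) ∈ nonnegReals := ⟨r, hr, rfl⟩

theorem mul_mem_nonnegReals {z w : ℂ} (hz : z ∈ nonnegReals) (hw : w ∈ nonnegReals) :
    z * w ∈ nonnegReals := by
  obtain ⟨x, hx, rfl⟩ := hz
  obtain ⟨y, hy, rfl⟩ := hw
  exact ⟨x * y, Set.mem_Ici.2 (mul_nonneg hx hy), by push_cast; rfl⟩

theorem sum_mem_nonnegReals {ι : Type*} {t : Finset ι} {f : ι → ℂ}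
    (h : ∀ i ∈ t, f i ∈ nonnegReals) : ∑ i ∈ t, f i ∈ nonnegReals := by
  classical
  induction t using Finset.induction_on with
  | empty => exact ⟨0, Set.mem_Ici.2 le_rfl, by simp⟩
  | insert i t hi ih =>
    rw [Finset.sum_insert hi]
    obtain ⟨x, hx, hx'⟩ := h i (Finset.mem_insert_self _ _)
    obtain ⟨y, hy, hy'⟩ := ih fun j hj => h j (Finset.mem_insert_of_mem hj)
    rw [← hx', ← hy']
    exact ⟨x + y, Set.mem_Ici.2 (add_nonneg hx hy), by push_cast; rfl⟩

theorem integral_e_mul_gaussian {b : ℝ} (hb : 0 < b) (v : ℝ) :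
    ∫ γ : ℝ, e (γ * v) * (Real.exp (-b * γ ^ 2) : ℂ) =
      ((Real.pi / b) ^ (1 / 2 : ℝ) * Real.exp (-(2 * Real.pi * v) ^ 2 / (4 * b)) : ℝ) := by
  have h := fourierIntegral_gaussian (b := (b : ℂ)) (by simpa using hb) (2 * Real.pi * v : ℝ)
  push_cast [Complex.ofReal_cpow (by positivity : 0 ≤ Real.pi / b)]
  rw [neg_div]
  push_cast at h
  rw [neg_div] at h
  rw [← h]
  refine integral_congr_ae (ae_of_all _ fun γ => ?_)
  simp only [e]
  push_cast
  ring_nf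

/-- The inverse Fourier transform at `0` of a non-negative measure is non-negative. -/
theorem integral_transform_mem_nonnegReals {Ω : Type*} [MeasurableSpace Ω] {ν : Measure Ω} [SFinite ν]
    {W u : Ω → ℝ} (hW : Integrable W ν) (hW0 : ∀ x, 0 ≤ W x) (hu : Measurable u) {G : ℝ → ℂ}
    (hG : Integrable G) (hGe : ∀ γ, G γ = ∫ x, (W x : ℂ) * e (γ * u x) ∂ν) :
    ∫ γ, G γ ∈ nonnegReals := by
  set b : ℕ → ℝ := fun j => 1 / ((j : ℝ) + 1) with hb
  have hb0 : ∀ j, 0 < b j := fun j => by rw [hb]; positivity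
  have hblim : Tendsto b atTop (nhds 0) := tendsto_one_div_add_atTop_nhds_zero_nat
  -- Gaussian damping: the damped integrals tend to the original one, and after exchanging the
  -- integrals each is an integral of the measure against a positive Gaussian.
  have hlim : Tendsto (fun j => ∫ γ, G γ * (Real.exp (-b j * γ ^ 2) : ℂ)) atTop (nhds (∫ γ, G γ)) := by
    refine tendsto_integral_of_dominated_convergence (fun γ => ‖G γ‖) (fun j => ?_) hG.norm
      (fun j => ae_of_all _ fun γ => ?_) (ae_of_all _ fun γ => ?_)
    · exact hG.aestronglyMeasurable.mul (by fun_prop : Continuous _).aestronglyMeasurable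
    · rw [norm_mul, Complex.norm_real, Real.norm_of_nonneg (Real.exp_pos _).le]
      refine mul_le_of_le_one_right (norm_nonneg _) (Real.exp_le_one_iff.2 ?_)
      nlinarith [mul_nonneg (hb0 j).le (sq_nonneg γ)]
    · have h1 : Tendsto (fun j => ((Real.exp (-b j * γ ^ 2) : ℝ) : ℂ)) atTop
          (nhds ((Real.exp (-0 * γ ^ 2) : ℝ) : ℂ)) :=
        (Complex.continuous_ofReal.tendsto _).comp
          ((Real.continuous_exp.tendsto _).comp (hblim.neg.mul_const _))
      simpa using h1.const_mul (G γ)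
  refine isClosed_nonnegReals.mem_of_tendsto hlim (Eventually.of_forall fun j => ?_)
  have hgauss : Integrable fun γ : ℝ => Real.exp (-b j * γ ^ 2) := integrable_exp_neg_mul_sq (hb0 j)
  have hprod : Integrable (fun p : ℝ × Ω =>
      (W p.2 : ℂ) * e (p.1 * u p.2) * (Real.exp (-b j * p.1 ^ 2) : ℂ)) (volume.prod ν) := by
    have h1 := hgauss.ofReal (𝕜 := ℂ) |>.mul_prod (hW.ofReal (𝕜 := ℂ))
    have hm : Measurable fun p : ℝ × Ω => e (p.1 * u p.2) :=
      continuous_e.measurable.comp (measurable_fst.mul (hu.comp measurable_snd))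
    have h2 := h1.bdd_mul (c := 1) hm.aestronglyMeasurable
      (ae_of_all _ fun p => (norm_e _).le)
    refine h2.congr (ae_of_all _ fun p => ?_)
    simp only [RCLike.ofReal_eq_complex_ofReal]
    ring
  have hswap : ∫ γ, G γ * (Real.exp (-b j * γ ^ 2) : ℂ) =
      ∫ x, (W x : ℂ) * (∫ γ : ℝ, e (γ * u x) * (Real.exp (-b j * γ ^ 2) : ℂ)) ∂ν := by
    simp_rw [hGe, ← integral_mul_const]
    rw [integral_integral_swap hprod]
    simp_rw [← integral_const_mul, mul_assoc]
  rw [hswap]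
  simp_rw [integral_e_mul_gaussian (hb0 j), ← Complex.ofReal_mul]
  rw [integral_complex_ofReal]
  refine ofReal_mem_nonnegReals (integral_nonneg fun x => mul_nonneg (hW0 x) ?_)
  positivity

section
variable {a : ℕ → ℝ} {k : ℕ} {B : ℝ}

theorem singularIntegrand_smoothCount (hk : k ≠ 0) (ha : ∀ n, 0 ≤ a n) (hB : ∀ n, 1 ≤ n → a n ≤ B)
    (s n : ℕ) (γ : ℝ) : singularIntegrand (smoothCount a k) k s n γ =
      (smoothTransform a k n (γ / n) / smoothCount a k ((n : ℝ) ^ (1 / k : ℝ))) ^ s * e (-γ) := by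
  have hX : ((n : ℝ) ^ (1 / k : ℝ)) ^ k = n := by
    rw [one_div, Real.rpow_inv_natCast_pow (Nat.cast_nonneg n) hk]
  rw [singularIntegrand, realIntegral_smoothCount hk ha hB (by positivity), hX]

theorem integrable_smoothTransform_div (hk : 2 ≤ k) (ha : ∀ n, 0 ≤ a n)
    (hB : ∀ n, 1 ≤ n → a n ≤ B) {s n : ℕ} (hs : 2 ≤ s) (hn : 1 ≤ n) :
    Integrable fun γ : ℝ => smoothTransform a k n (γ / n) ^ s * e (-γ) := by
  have hk0 : k ≠ 0 := by omega
  have hX : ((n : ℝ) ^ (1 / k : ℝ)) ^ k = n := by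
    rw [one_div, Real.rpow_inv_natCast_pow (Nat.cast_nonneg n) hk0]
  have hn1 : (1 : ℝ) ≤ n := by exact_mod_cast hn
  have h1 := integrable_norm_smoothTransform_pow hk ha hB (X := (n : ℝ) ^ (1 / k : ℝ))
    (Real.one_le_rpow hn1 (by positivity)) hs
  rw [hX] at h1
  have h2 := h1.comp_div (R := (n : ℝ)) (by positivity)
  have hc := continuous_smoothTransform hk0 ha hB (n : ℝ)
  have he := continuous_e
  refine h2.mono' (by fun_prop : Continuous _).aestronglyMeasurable (ae_of_all _ fun γ => ?_)
  rw [norm_mul, norm_e, mul_one, norm_pow]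

theorem integrable_singularIntegrand (hk : 2 ≤ k) (ha : ∀ n, 0 ≤ a n)
    (hB : ∀ n, 1 ≤ n → a n ≤ B) {s n : ℕ} (hs : 2 ≤ s) (hn : 1 ≤ n) :
    Integrable (singularIntegrand (smoothCount a k) k s n) := by
  have hk0 : k ≠ 0 := by omega
  have h := (integrable_smoothTransform_div hk ha hB hs hn).const_mul
    (((smoothCount a k ((n : ℝ) ^ (1 / k : ℝ)) : ℂ) ^ s)⁻¹)
  refine h.congr (ae_of_all _ fun γ => ?_)
  simp only [singularIntegrand_smoothCount hk0 ha hB, div_pow]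
  ring

/-- The s-th power is the transform of the s-fold product density on (0, n]^s in the variable (x₁ +
⋯ + x_s)/n, and the factor e(-γ) shifts this variable by 1. -/
theorem integral_smoothTransform_mem_nonnegReals (hk : 2 ≤ k) (ha : ∀ n, 0 ≤ a n)
    (hB : ∀ n, 1 ≤ n → a n ≤ B) {s n : ℕ} (hs : 2 ≤ s) (hn : 1 ≤ n) :
    ∫ γ : ℝ, smoothTransform a k n (γ / n) ^ s * e (-γ) ∈ nonnegReals := by
  have hk0 : k ≠ 0 := by omega
  have hn0 : (0 : ℝ) < n := by exact_mod_cast hn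
  have hg := continuous_smoothDensity hk0 ha hB
  set g : ℝ → ℝ := fun z => smoothDensity a k (max z 0) with hgdef
  have hgc : Continuous g := by fun_prop
  have hg0 : ∀ z, 0 ≤ g z := fun z => smoothDensity_nonneg ha (le_max_right _ _)
  have hgi : Integrable g (volume.restrict (Set.Ioc (0 : ℝ) n)) :=
    (hgc.continuousOn.integrableOn_compact isCompact_Icc).mono_set Set.Ioc_subset_Icc_self
  refine integral_transform_mem_nonnegReals (Ω := Fin s → ℝ)
    (ν := Measure.pi fun _ => volume.restrict (Set.Ioc (0 : ℝ) n))
    (W := fun x => ∏ i, g (x i)) (u := fun x => (∑ i, x i) / n - 1)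
    (Integrable.fintype_prod fun _ => hgi) (fun x => Finset.prod_nonneg fun i _ => hg0 _)
    (by fun_prop) (integrable_smoothTransform_div hk ha hB hs hn) fun γ => ?_
  have h1 := integral_fintype_prod_eq_pow (ι := Fin s) (𝕜 := ℂ)
    (μ := volume.restrict (Set.Ioc (0 : ℝ) n)) (fun z => (g z : ℂ) * e (γ / n * z))
  rw [Fintype.card_fin] at h1
  have h2 : ∫ z in Set.Ioc (0 : ℝ) n, (g z : ℂ) * e (γ / n * z) = smoothTransform a k n (γ / n) := by
    rw [smoothTransform, intervalIntegral.integral_of_le hn0.le]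
    refine setIntegral_congr_fun measurableSet_Ioc fun z hz => ?_
    simp only [hgdef, max_eq_left hz.1.le]
  rw [h2] at h1
  rw [← h1, ← integral_mul_const]
  refine integral_congr_ae (ae_of_all _ fun x => ?_)
  simp only
  rw [Finset.prod_mul_distrib, ← e_sum, mul_assoc, ← e_add, Complex.ofReal_prod]
  congr 2
  rw [← Finset.mul_sum]
  ring

theorem singularIntegral_mem_nonnegReals (hk : 2 ≤ k) (ha : ∀ n, 0 ≤ a n)
    (hB : ∀ n, 1 ≤ n → a n ≤ B) {s n : ℕ} (hs : 2 ≤ s) (hn : 1 ≤ n) :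
    singularIntegral (smoothCount a k) k s n ∈ nonnegReals := by
  have h := mul_mem_nonnegReals (ofReal_mem_nonnegReals (r :=
    (smoothCount a k ((n : ℝ) ^ (1 / k : ℝ)) ^ s)⁻¹) ?_)
    (integral_smoothTransform_mem_nonnegReals hk ha hB hs hn)
  · rw [← integral_const_mul] at h
    rw [singularIntegral]
    have e1 : singularIntegrand (smoothCount a k) k s n = fun γ : ℝ =>
        (((smoothCount a k ((n : ℝ) ^ (1 / k : ℝ)) ^ s)⁻¹ : ℝ) : ℂ) *
          (smoothTransform a k n (γ / n) ^ s * e (-γ)) := by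
      ext γ
      rw [singularIntegrand_smoothCount (by omega) ha hB, div_pow]
      push_cast
      ring
    rw [e1]
    exact h
  · have : 0 ≤ smoothCount a k ((n : ℝ) ^ (1 / k : ℝ)) :=
      intervalIntegral.integral_nonneg (by positivity) fun ξ _ => smoothDeriv_nonneg ha ξ
    positivity

/-- Each c/N has a unique form in lowest terms, whose denominator divides N. -/
theorem sum_divisors_reducedResidues {M : Type*} [AddCommMonoid M] (Φ : ℝ → M) {N : ℕ} (hN : 1 ≤ N) :
    ∑ q ∈ N.divisors, ∑ b ∈ reducedResidues q, Φ ((b : ℝ) / q) =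
      ∑ c ∈ Finset.Icc 1 N, Φ ((c : ℝ) / N) := by
  have h := sum_fractions N.divisors fun x => Φ (fracPt x)
  simp only [fracPt] at h
  rw [← h]
  have hpos : ∀ x ∈ fractions N.divisors, 1 ≤ x.1 ∧ x.1 ∣ N := fun x hx => by
    have h1 := (mem_fractions.1 hx).1
    exact ⟨Nat.pos_of_mem_divisors h1, Nat.dvd_of_mem_divisors h1⟩
  have hval : ∀ x ∈ fractions N.divisors, (((x.2 * (N / x.1) : ℕ)) : ℝ) / N = (x.2 : ℝ) / x.1 := by
    intro x hx
    obtain ⟨h1, d, hd⟩ := hpos x hx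
    have hx1 : (x.1 : ℝ) ≠ 0 := by
      have : x.1 ≠ 0 := by omega
      exact_mod_cast this
    have hd0 : (d : ℝ) ≠ 0 := by
      rintro h0
      have : d = 0 := by exact_mod_cast h0
      rw [this] at hd
      omega
    rw [hd, Nat.mul_div_cancel_left _ (by omega)]
    push_cast
    field_simp
  refine Finset.sum_bij (fun x _ => x.2 * (N / x.1)) ?_ ?_ ?_ ?_
  · intro x hx
    obtain ⟨h1, h2⟩ := hpos x hx
    obtain ⟨-, h3, h4, -⟩ := mem_fractions.1 hx
    rw [Finset.mem_Icc]
    constructor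
    · exact Nat.mul_pos h3 (Nat.div_pos (Nat.le_of_dvd hN h2) h1)
    · calc x.2 * (N / x.1) ≤ x.1 * (N / x.1) := Nat.mul_le_mul_right _ h4
        _ = N := Nat.mul_div_cancel' h2
  · intro x hx y hy hxy
    have h1 := hval x hx
    rw [hxy, hval y hy] at h1
    obtain ⟨h2, h3⟩ := eq_of_coprime_div_eq (hpos x hx).1 (hpos y hy).1
      (mem_fractions.1 hx).2.2.2 (mem_fractions.1 hy).2.2.2 (by push_cast; exact h1.symm)
    refine Sigma.ext h2 (heq_of_eq ?_)
    exact_mod_cast h3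
  · intro c hc
    rw [Finset.mem_Icc] at hc
    have hg : 0 < Nat.gcd c N := Nat.gcd_pos_of_pos_left _ hc.1
    have hgN := Nat.gcd_dvd_right c N
    have hgc := Nat.gcd_dvd_left c N
    refine ⟨⟨N / Nat.gcd c N, c / Nat.gcd c N⟩, ?_, ?_⟩
    · rw [mem_fractions]
      refine ⟨Nat.mem_divisors.2 ⟨Nat.div_dvd_of_dvd hgN, by omega⟩,
        Nat.div_pos (Nat.le_of_dvd hc.1 hgc) hg, Nat.div_le_div_right hc.2, ?_⟩
      rw [Nat.isCoprime_iff_coprime]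
      exact Nat.coprime_div_gcd_div_gcd hg
    · simp only
      rw [Nat.div_div_self hgN (by omega), Nat.div_mul_cancel hgc]
  · intro x hx
    rw [hval x hx]

theorem sum_Icc_eq_sum_range_of_periodic {M : Type*} [AddCommGroup M] (Φ : ℝ → M) (h : Φ 1 = Φ 0)
    {N : ℕ} (hN : 1 ≤ N) :
    ∑ c ∈ Finset.Icc 1 N, Φ ((c : ℝ) / N) = ∑ c ∈ Finset.range N, Φ ((c : ℝ) / N) := by
  have hN0 : (N : ℝ) ≠ 0 := by
    have : N ≠ 0 := by omega
    exact_mod_cast this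
  have h1 := Finset.sum_range_succ (fun c : ℕ => Φ ((c : ℝ) / N)) N
  have h2 := Finset.sum_range_succ' (fun c : ℕ => Φ ((c : ℝ) / N)) N
  rw [h1, div_self hN0, Nat.cast_zero, zero_div, h, add_left_inj] at h2
  rw [sum_Icc_one_eq_sum_range, ← h2]

/-- By orthogonality this is N times the weighted number of solutions of the congruence modulo N. -/
theorem sum_range_expSum_pow_mem_nonnegReals (ha : ∀ n, 0 ≤ a n) (s n : ℕ) (X : ℝ) {N : ℕ}
    (hN : 1 ≤ N) : ∑ c ∈ Finset.range N, expSum a k ((c : ℝ) / N) X ^ s * e (-((c : ℝ) / N * n)) ∈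
      nonnegReals := by
  simp_rw [expSum_pow, Finset.sum_mul]
  rw [Finset.sum_comm]
  refine sum_mem_nonnegReals fun x _ => ?_
  simp_rw [mul_assoc]
  rw [← Finset.mul_sum, sum_e_div_eq N hN]
  refine mul_mem_nonnegReals (ofReal_mem_nonnegReals (Finset.prod_nonneg fun i _ => ha _)) ?_
  split_ifs
  · simpa using ofReal_mem_nonnegReals (r := N) (by positivity)
  · simpa using ofReal_mem_nonnegReals (r := 0) le_rfl

end

/-! ### Non-negativity of the singular series. -/

namespace Regular
variable {a : ℕ → ℝ} {k : ℕ} {κ : (q : ℕ) → ZMod q → ℝ} {t₀ ϱ ω : ℝ}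

/-- S(q, b) is the limit of f(b/q)/A, so the sum over divisors is a limit of normalised congruence
counts. -/
theorem sum_divisors_mem_nonnegReals (H : Regular a k κ t₀ ϱ ω) (s n : ℕ) {N : ℕ} (hN : 1 ≤ N) :
    ∑ q ∈ N.divisors, ∑ b ∈ reducedResidues q, completeSum κ k q b ^ s * e (-((b : ℝ) * n / q)) ∈
      nonnegReals := by
  obtain ⟨D, -, hD⟩ := H.disc
  have hlim : Tendsto (fun X : ℝ => ∑ q ∈ N.divisors, ∑ b ∈ reducedResidues q,
      (expSum a k ((b : ℝ) / q) X / (count a X : ℂ)) ^ s * e (-((b : ℝ) * n / q))) atTop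
      (nhds (∑ q ∈ N.divisors, ∑ b ∈ reducedResidues q,
        completeSum κ k q b ^ s * e (-((b : ℝ) * n / q)))) := by
    refine tendsto_finsetSum _ fun q hq => tendsto_finsetSum _ fun b _ => ?_
    exact ((tendsto_expSum_div_count H.ne_zero hD H.top
      (Nat.pos_of_mem_divisors hq) b).pow s).mul_const _
  refine isClosed_nonnegReals.mem_of_tendsto hlim (Eventually.of_forall fun X => ?_)
  set Φ : ℝ → ℂ := fun α => expSum a k α X ^ s * e (-(α * n)) with hΦ
  have h1 : Φ 1 = Φ 0 := by
    have h2 := periodic_expSum (a := a) (k := k) X 0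
    simp only [zero_add] at h2
    simp only [hΦ, h2, one_mul, zero_mul, e_zero, e_neg, e_natCast, map_one]
  have h3 := (sum_divisors_reducedResidues Φ hN).trans (sum_Icc_eq_sum_range_of_periodic Φ h1 hN)
  have h4 := mul_mem_nonnegReals
    (ofReal_mem_nonnegReals (inv_nonneg.2 (pow_nonneg (count_nonneg H.nonneg X) s)))
    (sum_range_expSum_pow_mem_nonnegReals (k := k) H.nonneg s n X hN)
  rw [← h3, Finset.mul_sum] at h4
  convert h4 using 2 with q _
  rw [Finset.mul_sum]
  refine Finset.sum_congr rfl fun b _ => ?_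
  simp only [hΦ, div_pow]
  push_cast
  rw [div_mul_eq_mul_div (b : ℝ)]
  ring

theorem summable_singularSeries (H : Regular a k κ t₀ ϱ ω) {s : ℕ} (hs : 2 * t₀ + 5 * ω / ϱ < s)
    (n : ℕ) : Summable fun q : ℕ =>
      ∑ b ∈ reducedResidues q, completeSum κ k q b ^ s * e (-((b : ℝ) * n / q)) := by
  refine Summable.of_norm_bounded (H.summable_completeSum hs) fun q => ?_
  refine norm_sum_le_of_le _ fun b _ => ?_
  rw [norm_mul, norm_e, mul_one, norm_pow]

/-- The divisors of M! exhaust the positive integers, and the series converges absolutely, so the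
divisor sums converge to it. -/
theorem singularSeries_mem_nonnegReals (H : Regular a k κ t₀ ϱ ω) {s : ℕ}
    (hs : 2 * t₀ + 5 * ω / ϱ < s) (n : ℕ) : singularSeries κ k s n ∈ nonnegReals := by
  have hsum := (H.summable_singularSeries hs n).hasSum
  -- The index 0, whose term is empty, is inserted because it divides no factorial and yet belongs
  -- to the index set of the series.
  have hmono : Monotone fun M : ℕ => insert 0 (M.factorial.divisors) := fun M M' h =>
    Finset.insert_subset_insert _ (Nat.divisors_subset_of_dvd (Nat.factorial_ne_zero _)
      (Nat.factorial_dvd_factorial h))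
  have htend := tendsto_atTop_finset_of_monotone hmono fun q => ⟨q, by
    rcases Nat.eq_zero_or_pos q with rfl | hq
    · simp
    · exact Finset.mem_insert_of_mem (Nat.mem_divisors.2
        ⟨Nat.dvd_factorial hq le_rfl, Nat.factorial_ne_zero _⟩)⟩
  refine isClosed_nonnegReals.mem_of_tendsto (hsum.comp htend) (Eventually.of_forall fun M => ?_)
  simp only [Function.comp_apply]
  rw [Finset.sum_insert (by simp)]
  have h0 : reducedResidues 0 = ∅ := by simp [reducedResidues]
  rw [h0, Finset.sum_empty, zero_add]
  exact H.sum_divisors_mem_nonnegReals s n (Nat.factorial_pos M)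

end Regular

/-! ### Approximation on the major arcs -/

theorem norm_pow_succ_sub_pow_succ_le {z w : ℂ} {M : ℝ} (hz : ‖z‖ ≤ M) (hw : ‖w‖ ≤ M) (j : ℕ) :
    ‖z ^ (j + 1) - w ^ (j + 1)‖ ≤ (j + 1) * M ^ j * ‖z - w‖ := by
  have hM : 0 ≤ M := (norm_nonneg z).trans hz
  induction j with
  | zero => simp
  | succ j ih =>
    have e1 : z ^ (j + 1 + 1) - w ^ (j + 1 + 1) =
        z ^ (j + 1) * (z - w) + (z ^ (j + 1) - w ^ (j + 1)) * w := by ring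
    rw [e1]
    refine (norm_add_le _ _).trans ?_
    rw [norm_mul, norm_mul, norm_pow]
    calc _ ≤ M ^ (j + 1) * ‖z - w‖ + (j + 1) * M ^ j * ‖z - w‖ * M := by gcongr
      _ = _ := by push_cast; ring

/-- The inverse of 1 - ix and exp(ix) agree to first order in x = 2πβ: the circle is tangent. -/
theorem norm_expTransform_sub_e_le {β : ℝ} (hβ : 2 * Real.pi * |β| ≤ 1) :
    ‖expTransform β - e β‖ ≤ (2 * Real.pi * β) ^ 2 := by
  have hz := one_sub_ne_zero β
  set z : ℂ := -(2 * Real.pi * Complex.I * β) with hzdef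
  have hnz : ‖z‖ = 2 * Real.pi * |β| := by
    rw [hzdef, norm_neg]
    simp [abs_of_pos Real.pi_pos]
  have h1 : Complex.exp z * e β = 1 := by
    rw [hzdef, e, ← Complex.exp_add]; simp
  have h2 : expTransform β - e β = expTransform β * (e β * (Complex.exp z - 1 - z)) := by
    have h3 : expTransform β * (1 + z) = 1 := by
      rw [expTransform, hzdef, ← sub_eq_add_neg, inv_mul_cancel₀ hz]
    linear_combination e β * h3 - expTransform β * h1
  rw [h2, norm_mul, norm_mul, norm_e, one_mul]
  have h4 := Complex.norm_exp_sub_one_sub_id_le (x := z) (by rw [hnz]; exact hβ)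
  calc _ ≤ 1 * ‖z‖ ^ 2 := by
        gcongr
        exact norm_expTransform_le_one β
    _ = _ := by rw [hnz, one_mul, mul_pow, sq_abs, ← mul_pow]

theorem norm_powerSum_sub_expSum_le {a : ℕ → ℝ} {k : ℕ} (ha : ∀ n, 0 ≤ a n) {X : ℝ} (hX : 0 ≤ X)
    {β : ℝ} (hβ : 2 * Real.pi * |β| ≤ 1) : ‖powerSum a k X (expTransform β) - expSum a k β X‖ ≤
      count a X * (X ^ k * (2 * Real.pi * β) ^ 2) := by
  rw [← powerSum_e, powerSum, powerSum, ← Finset.sum_sub_distrib, count, Finset.sum_mul]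
  refine norm_sum_le_of_le _ fun m hm => ?_
  obtain ⟨h1, h2⟩ := Finset.mem_Icc.1 hm
  rw [← mul_sub, norm_mul, Complex.norm_real, Real.norm_of_nonneg (ha m)]
  refine mul_le_mul_of_nonneg_left ?_ (ha m)
  obtain ⟨j, hj⟩ : ∃ j, m ^ k = j + 1 := ⟨m ^ k - 1, by have := Nat.pow_pos (n := k) h1; omega⟩
  have h3 := norm_pow_succ_sub_pow_succ_le (norm_expTransform_le_one β) (norm_e β).le j
  rw [one_pow, mul_one] at h3
  have h4 : ((j : ℝ) + 1) ≤ X ^ k := by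
    have : ((m ^ k : ℕ) : ℝ) = j + 1 := by rw [hj]; push_cast; rfl
    rw [← this]
    push_cast
    exact pow_le_pow_left₀ (Nat.cast_nonneg _) ((Nat.le_floor_iff hX).1 h2) k
  rw [hj]
  refine h3.trans ?_
  have := norm_expTransform_sub_e_le hβ
  gcongr

section
variable {a : ℕ → ℝ} {k : ℕ} {B : ℝ}

theorem norm_smoothTransform_le (hk : k ≠ 0) (ha : ∀ n, 0 ≤ a n) (hB : ∀ n, 1 ≤ n → a n ≤ B)
    {X : ℝ} (hX : 0 ≤ X) (β : ℝ) : ‖smoothTransform a k (X ^ k) β‖ ≤ smoothCount a k X := by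
  have hg := continuous_smoothDensity hk ha hB
  have h0 : smoothCount a k X = ∫ z in (0 : ℝ)..X ^ k, smoothDensity a k z := by
    have h := smoothTransform_zero hk ha hB hX
    simp only [smoothTransform, zero_mul, e_zero, mul_one, intervalIntegral.integral_ofReal] at h
    exact_mod_cast h.symm
  rw [h0]
  refine intervalIntegral.norm_integral_le_of_norm_le (by positivity) (ae_of_all _ fun z hz => ?_)
    (hg.intervalIntegrable _ _)
  rw [norm_mul, norm_e, mul_one, Complex.norm_real,
    Real.norm_of_nonneg (smoothDensity_nonneg ha hz.1.le)]

end

/-- An error term that is smaller than the main term by a power of the count. -/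
def Saves (a : ℕ → ℝ) (k s : ℕ) (G : ℝ → ℝ) : Prop :=
  ∃ η C : ℝ, 0 < η ∧ 0 ≤ C ∧ ∀ᶠ X : ℝ in atTop, G X ≤ C * (count a X ^ (s - η) / X ^ k)

namespace Saves
variable {a : ℕ → ℝ} {k s : ℕ} {G G' : ℝ → ℝ}

theorem add (htop : Tendsto (count a) atTop atTop) (h : Saves a k s G) (h' : Saves a k s G') :
    Saves a k s fun X => G X + G' X := by
  obtain ⟨η, C, hη, hC, h⟩ := h
  obtain ⟨η', C', hη', hC', h'⟩ := h'
  refine ⟨min η η', C + C', lt_min hη hη', by positivity, ?_⟩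
  filter_upwards [h, h', htop.eventually_ge_atTop 1, eventually_gt_atTop (0 : ℝ)] with X h1 h2 h3 h4
  rw [add_mul]
  refine add_le_add (h1.trans ?_) (h2.trans ?_)
  · gcongr
    exact min_le_left _ _
  · gcongr
    exact min_le_right _ _

theorem mono (h : Saves a k s G) (hG : ∀ᶠ X in atTop, G' X ≤ G X) : Saves a k s G' := by
  obtain ⟨η, C, hη, hC, h⟩ := h
  refine ⟨η, C, hη, hC, ?_⟩
  filter_upwards [h, hG] with X h1 h2
  exact h2.trans h1

theorem const_mul {c : ℝ} (hc : 0 ≤ c) (h : Saves a k s G) : Saves a k s fun X => c * G X := by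
  obtain ⟨η, C, hη, hC, h⟩ := h
  refine ⟨η, c * C, hη, by positivity, ?_⟩
  filter_upwards [h] with X h1
  rw [mul_assoc]
  gcongr

theorem of_exponent {η C : ℝ} (hη : 0 < η) (hC : 0 ≤ C)
    (h : ∀ᶠ X in atTop, G X ≤ C * (count a X ^ (s - η) / X ^ k)) : Saves a k s G :=
  ⟨η, C, hη, hC, h⟩

end Saves

namespace Regular
variable {a : ℕ → ℝ} {k : ℕ} {κ : (q : ℕ) → ZMod q → ℝ} {t₀ ϱ ω : ℝ}

/-- A ≪ X and k ≥ 2. The exponent 7/5 is that of A Y², the largest power of A compared with X^k on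
the major arcs. -/
theorem eventually_scale (H : Regular a k κ t₀ ϱ ω) : ∀ᶠ X : ℝ in atTop,
    1 ≤ X ∧ 1 ≤ count a X ∧ 100 * count a X ^ (7 / 5 : ℝ) ≤ X ^ k := by
  filter_upwards [eventually_ge_atTop (1 : ℝ), H.top.eventually_ge_atTop 1,
    H.eventually_mul_count_rpow_le (p := 7 / 5) (q := 2) (by norm_num) (by norm_num) 100]
    with X h1 h2 h3
  refine ⟨h1, h2, h3.trans ?_⟩
  rw [show X ^ (2 : ℝ) = X ^ 2 by norm_cast]
  exact pow_le_pow_right₀ h1 H.two_le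

/-- Replacing ζ^{m^k} by e(β m^k) costs O(m^k β²) for each m, in total A X^k β² ≪ A Y²/X^k, which is
bounded. -/
theorem exists_transform_near (H : Regular a k κ t₀ ϱ ω) : ∃ C : ℝ, 0 ≤ C ∧ ∀ᶠ X : ℝ in atTop,
    ∀ β : ℝ, |β| ≤ 3 * (count a X ^ (1 / 5 : ℝ) / X ^ k) →
      ‖expSum a k β X - smoothTransform a k (X ^ k) β‖ ≤ C := by
  obtain ⟨B, -, hB⟩ := H.bound
  obtain ⟨E, hE0, hE⟩ := exists_norm_smoothTransform_sub_le H.two_le H.nonneg hB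
  refine ⟨16 + E, by positivity, ?_⟩
  filter_upwards [H.eventually_scale] with X ⟨hX, hA, hscale⟩ β hβ
  set A := count a X with hAdef
  have hA0 : 0 < A := by linarith
  have hX0 : 0 < X := by linarith
  have hXk : 0 < X ^ k := by positivity
  have hpi := Real.pi_lt_four
  have hpi0 := Real.pi_pos
  set Y := A ^ (1 / 5 : ℝ) with hY
  have hYle : Y ≤ A ^ (7 / 5 : ℝ) := Real.rpow_le_rpow_of_exponent_le hA (by norm_num)
  have hY0 : 0 ≤ Y := by positivity
  have hA7 : A * Y ^ 2 = A ^ (7 / 5 : ℝ) := by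
    rw [hY, ← Real.rpow_natCast (A ^ (1 / 5 : ℝ)), ← Real.rpow_mul hA0.le,
      ← Real.rpow_one_add' hA0.le (by norm_num)]
    norm_num
  have hβ1 : 2 * Real.pi * |β| ≤ 1 := by
    calc 2 * Real.pi * |β| ≤ 2 * 4 * (3 * (Y / X ^ k)) := by gcongr
      _ = 24 * Y / X ^ k := by ring
      _ ≤ 1 := by rw [div_le_one hXk]; linarith
  have h1 := norm_powerSum_sub_expSum_le (k := k) H.nonneg hX0.le hβ1
  have h2 := hE X hX β
  have h3 : A * (X ^ k * (2 * Real.pi * β) ^ 2) ≤ 16 := by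
    have hb : β ^ 2 ≤ 9 * Y ^ 2 / (X ^ k) ^ 2 := by
      rw [← sq_abs]
      calc |β| ^ 2 ≤ (3 * (Y / X ^ k)) ^ 2 := by gcongr
        _ = _ := by rw [mul_pow, div_pow]; ring
    have hp2 : Real.pi ^ 2 ≤ 10 := by
      have := Real.pi_lt_d2
      nlinarith
    calc A * (X ^ k * (2 * Real.pi * β) ^ 2) = A * X ^ k * (4 * Real.pi ^ 2 * β ^ 2) := by ring
      _ ≤ A * X ^ k * (4 * 10 * (9 * Y ^ 2 / (X ^ k) ^ 2)) := by gcongr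
      _ = 360 * (A * Y ^ 2) / X ^ k := by field_simp; ring
      _ ≤ 16 := by rw [hA7, div_le_iff₀ hXk]; linarith
  have h4 := norm_expTransform_le_one β
  have h5 : E * ‖expTransform β‖ ≤ E := mul_le_of_le_one_right hE0 h4
  rw [norm_sub_rev] at h1 h2
  have := norm_sub_le_norm_sub_add_norm_sub (expSum a k β X) (powerSum a k X (expTransform β))
    (smoothTransform a k (X ^ k) β)
  linarith

theorem exists_approximation (H : Regular a k κ t₀ ϱ ω) : ∃ C : ℝ, 0 ≤ C ∧ ∀ᶠ X : ℝ in atTop,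
    ∀ x : Σ _ : ℕ, ℕ, 1 ≤ x.1 → ∀ β : ℝ, |β| ≤ 3 * (count a X ^ (1 / 5 : ℝ) / X ^ k) →
      ‖expSum a k (fracPt x + β) X - completeSum κ k x.1 x.2 * smoothTransform a k (X ^ k) β‖ ≤
        C * (x.1 * (1 + |β| * X ^ k)) := by
  obtain ⟨D, hD0, hD⟩ := H.disc
  obtain ⟨E, hE0, hE⟩ := H.exists_transform_near
  refine ⟨7 * D + E, by positivity, ?_⟩
  filter_upwards [hE, eventually_ge_atTop (1 : ℝ)] with X h1 hX x hx β hβ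
  have hq : (1 : ℝ) ≤ x.1 := by exact_mod_cast hx
  have h2 := norm_expSum_sub_le H.ne_zero hD hx x.2 β (by linarith : 0 ≤ X)
  have h3 := norm_completeSum_le_one H.ne_zero H.nonneg hD H.top hx x.2
  have h4 := h1 β hβ
  have hpi := Real.pi_lt_d2
  have hv : 0 ≤ |β| * X ^ k := by positivity
  have h5 : D * x.1 * (1 + 2 * Real.pi * (|β| * X ^ k)) ≤ D * x.1 * (7 * (1 + |β| * X ^ k)) := by
    gcongr
    nlinarith
  have h6 : ‖completeSum κ k x.1 x.2 * expSum a k β X -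
      completeSum κ k x.1 x.2 * smoothTransform a k (X ^ k) β‖ ≤ E := by
    rw [← mul_sub, norm_mul]
    calc _ ≤ 1 * E := by gcongr
      _ = E := one_mul E
  have h7 := norm_sub_le_norm_sub_add_norm_sub (expSum a k (fracPt x + β) X)
    (completeSum κ k x.1 x.2 * expSum a k β X)
    (completeSum κ k x.1 x.2 * smoothTransform a k (X ^ k) β)
  have h8 : 1 ≤ (x.1 : ℝ) * (1 + |β| * X ^ k) := by nlinarith
  have h9 : E ≤ E * ((x.1 : ℝ) * (1 + |β| * X ^ k)) := le_mul_of_one_le_right hE0 h8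
  simp only [fracPt] at h7 ⊢
  linarith

theorem eventually_smoothCount (H : Regular a k κ t₀ ϱ ω) : ∃ C : ℝ, 0 ≤ C ∧ ∀ᶠ X : ℝ in atTop,
    |smoothCount a k X - count a X| ≤ C ∧ count a X / 2 ≤ smoothCount a k X ∧
      smoothCount a k X ≤ 2 * count a X := by
  obtain ⟨B, -, hB⟩ := H.bound
  obtain ⟨C, hC⟩ := (approximates_smoothCount H.two_le H.nonneg hB).2.2.2.bound
  refine ⟨|C|, abs_nonneg _, ?_⟩
  filter_upwards [hC, H.top.eventually_ge_atTop (2 * |C|)] with X h1 h2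
  simp only [norm_one, mul_one, Real.norm_eq_abs] at h1
  have h3 := h1.trans (le_abs_self C)
  have h4 := abs_le.1 h3
  exact ⟨h3, by linarith, by linarith⟩

/-- The measure of the central part of the singular integral. -/
theorem volume_near (r : ℝ) (hr : 0 ≤ r) : volume.real {β : ℝ | |β| < r} = 2 * r := by
  have : {β : ℝ | |β| < r} = Set.Ioo (-r) r := by ext β; simp [abs_lt]
  rw [this, Real.volume_real_Ioo_of_le (by linarith)]
  ring

theorem measurableSet_near (r : ℝ) : MeasurableSet {β : ℝ | |β| < r} :=
  (isOpen_lt continuous_abs continuous_const).measurableSet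

theorem volume_near_lt_top (r : ℝ) : volume {β : ℝ | |β| < r} < ⊤ := by
  have : {β : ℝ | |β| < r} = Set.Ioo (-r) r := by ext β; simp [abs_lt]
  rw [this]
  exact measure_Ioo_lt_top

/-- The first bound is the trivial one, on a set of measure 6Y/X^k; the second comes from the mean
value, after replacing the transform by f. Which one is needed depends on the rate of decay of the
singular series. -/
theorem exists_near_le (H : Regular a k κ t₀ ϱ ω) {s : ℕ} (hs : 2 * t₀ + 5 * ω / ϱ < s) :
    ∃ C : ℝ, 0 ≤ C ∧ ∀ᶠ X : ℝ in atTop,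
      ∫ β in {β : ℝ | |β| < 3 * (count a X ^ (1 / 5 : ℝ) / X ^ k)},
        ‖smoothTransform a k (X ^ k) β‖ ^ s ≤ C * (count a X ^ ((s : ℝ) + 1 / 5) / X ^ k) ∧
      ∫ β in {β : ℝ | |β| < 3 * (count a X ^ (1 / 5 : ℝ) / X ^ k)},
        ‖smoothTransform a k (X ^ k) β‖ ^ s ≤ C * (count a X ^ ((s : ℝ) + ω) / X ^ k) := by
  have hs3 := H.three_le hs
  have hω := H.ω_nonneg
  have ht := H.t_nonneg
  have hst : 0 ≤ (s : ℝ) - 2 * t₀ := by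
    have : 0 ≤ 5 * ω / ϱ := div_nonneg (by positivity) H.ϱ_pos.le
    linarith
  obtain ⟨B, -, hB⟩ := H.bound
  obtain ⟨E, hE0, hE⟩ := H.exists_transform_near
  obtain ⟨C₁, -, hΨ⟩ := H.eventually_smoothCount
  obtain ⟨C₂, hC₂, hmean⟩ := H.mean t₀ le_rfl
  refine ⟨6 * 2 ^ s + 2 ^ s * (C₂ + 6 * E ^ s), by positivity, ?_⟩
  filter_upwards [hE, hΨ, hmean, H.eventually_scale] with X h1 h2 h3 ⟨hX, hA, hscale⟩
  set A := count a X with hAdef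
  have hA0 : 0 < A := by linarith
  have hX0 : 0 < X := by linarith
  have hXk : 0 < X ^ k := by positivity
  set r := 3 * (A ^ (1 / 5 : ℝ) / X ^ k) with hr
  have hr0 : 0 ≤ r := by positivity
  have hr2 : r ≤ 1 / 4 := by
    have h4 : A ^ (1 / 5 : ℝ) ≤ A ^ (7 / 5 : ℝ) := Real.rpow_le_rpow_of_exponent_le hA (by norm_num)
    rw [hr, ← mul_div_assoc, div_le_iff₀ hXk]
    linarith
  set S := {β : ℝ | |β| < r} with hS
  have hSm := measurableSet_near r
  have hSfin := volume_near_lt_top r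
  have hSvol := volume_near r hr0
  have hcst : ∀ c : ℝ, IntegrableOn (fun _ : ℝ => c) S := fun c => integrableOn_const hSfin.ne
  have hhi := (integrable_norm_smoothTransform_pow H.two_le H.nonneg hB hX
    (s := s) (by omega)).integrableOn (s := S)
  have hcstint : ∀ c : ℝ, ∫ _ in S, c = 2 * r * c := fun c => by
    rw [setIntegral_const, hSvol, smul_eq_mul]
  constructor
  · have h5 : ∫ β in S, ‖smoothTransform a k (X ^ k) β‖ ^ s ≤ ∫ _ in S, (2 * A) ^ s := by
      refine setIntegral_mono_on hhi (hcst _) hSm fun β _ => ?_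
      gcongr
      exact (norm_smoothTransform_le H.ne_zero H.nonneg hB hX0.le β).trans h2.2.2
    rw [hcstint] at h5
    refine h5.trans ?_
    rw [Real.rpow_add hA0, Real.rpow_natCast, hr]
    calc 2 * (3 * (A ^ (1 / 5 : ℝ) / X ^ k)) * (2 * A) ^ s =
        (6 * 2 ^ s) * (A ^ s * A ^ (1 / 5 : ℝ) / X ^ k) := by rw [mul_pow]; ring
      _ ≤ _ := by
        gcongr
        exact le_add_of_nonneg_right (by positivity)
  · have hfc : Continuous fun β => ‖expSum a k β X‖ ^ (2 * t₀) :=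
      (continuous_expSum X).norm.rpow_const fun _ => Or.inr (by linarith)
    have hper : ∫ β in Set.Ioc (-(1 / 2) : ℝ) (-(1 / 2) + 1), ‖expSum a k β X‖ ^ (2 * t₀) =
        meanValue a k t₀ X := by
      rw [meanValue, ← intervalIntegral.integral_of_le (by linarith)]
      have hp : Function.Periodic (fun α => ‖expSum a k α X‖ ^ (2 * t₀)) 1 := fun α => by
        have := periodic_expSum (a := a) (k := k) X α
        simp only at this ⊢
        rw [this]
      have := hp.intervalIntegral_add_eq (-(1 / 2)) 0
      simpa using this
    have hfi : IntegrableOn (fun β => ‖expSum a k β X‖ ^ (2 * t₀))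
        (Set.Ioc (-(1 / 2) : ℝ) (-(1 / 2) + 1)) :=
      (hfc.continuousOn.integrableOn_compact isCompact_Icc).mono_set Set.Ioc_subset_Icc_self
    have hSsub : S ⊆ Set.Ioc (-(1 / 2) : ℝ) (-(1 / 2) + 1) := fun β hβ => by
      have := abs_lt.1 (show |β| < r from hβ)
      exact ⟨by linarith, by linarith⟩
    have h6 : ∫ β in S, ‖expSum a k β X‖ ^ (2 * t₀) ≤ meanValue a k t₀ X := by
      rw [← hper]
      exact setIntegral_mono_set hfi (ae_of_all _ fun β => by positivity) hSsub.eventuallyLE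
    have h7 : ∫ β in S, ‖smoothTransform a k (X ^ k) β‖ ^ s ≤
        ∫ β in S, 2 ^ s * (A ^ ((s : ℝ) - 2 * t₀) * ‖expSum a k β X‖ ^ (2 * t₀) + E ^ s) := by
      refine setIntegral_mono_on hhi ((((hfi.mono_set hSsub).const_mul _).add (hcst _)).const_mul _)
        hSm fun β hβ => ?_
      have h8 := h1 β (show |β| < r from hβ).le
      have h9 := norm_sub_norm_le (smoothTransform a k (X ^ k) β) (expSum a k β X)
      rw [norm_sub_rev] at h9
      calc _ ≤ (‖expSum a k β X‖ + E) ^ s := by gcongr; linarith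
        _ ≤ 2 ^ s * (‖expSum a k β X‖ ^ s + E ^ s) :=
          add_pow_le_two_pow_mul (norm_nonneg _) hE0 s
        _ ≤ _ := by
          gcongr
          have : ‖expSum a k β X‖ ^ s = ‖expSum a k β X‖ ^ ((s : ℝ) - 2 * t₀) *
              ‖expSum a k β X‖ ^ (2 * t₀) := by
            rw [← Real.rpow_add_of_nonneg (norm_nonneg _) hst (by linarith), ← Real.rpow_natCast]
            congr 1; ring
          rw [this]
          gcongr
          exact norm_expSum_le H.nonneg _ _
    refine h7.trans ?_
    rw [integral_const_mul, integral_add ((hfi.mono_set hSsub).const_mul _) (hcst _),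
      integral_const_mul, hcstint]
    have h10 : A ^ ((s : ℝ) - 2 * t₀) * (C₂ * (A ^ (2 * t₀ + ω) / X ^ k)) =
        C₂ * (A ^ ((s : ℝ) + ω) / X ^ k) := by
      rw [show (s : ℝ) + ω = (s - 2 * t₀) + (2 * t₀ + ω) by ring, Real.rpow_add hA0 (s - 2 * t₀)]
      ring
    have h11 : 2 * r * E ^ s ≤ 6 * E ^ s * (A ^ ((s : ℝ) + ω) / X ^ k) := by
      have : A ^ (1 / 5 : ℝ) ≤ A ^ ((s : ℝ) + ω) := by
        refine Real.rpow_le_rpow_of_exponent_le hA ?_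
        have : (3 : ℝ) ≤ s := by exact_mod_cast hs3
        linarith
      calc 2 * r * E ^ s = 6 * E ^ s * (A ^ (1 / 5 : ℝ) / X ^ k) := by rw [hr]; ring
        _ ≤ _ := by gcongr
    calc _ ≤ 2 ^ s * (A ^ ((s : ℝ) - 2 * t₀) * (C₂ * (A ^ (2 * t₀ + ω) / X ^ k)) +
          6 * E ^ s * (A ^ ((s : ℝ) + ω) / X ^ k)) := by
          gcongr
          exact h6.trans h3
      _ = 2 ^ s * (C₂ + 6 * E ^ s) * (A ^ ((s : ℝ) + ω) / X ^ k) := by rw [h10]; ring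
      _ ≤ _ := by
        gcongr
        exact le_add_of_nonneg_left (by positivity)

end Regular

/-! ### Completion of the major arcs -/

/-- The part of a neighbourhood of a fraction that belongs to the major arcs. -/
def majorPart (Y ρ : ℝ) (x : Σ _ : ℕ, ℕ) : Set ℝ := {β | (x.1 : ℝ) ≤ Y ∧ x.1 * |β| ≤ ρ}

/-- The part of a neighbourhood of a fraction that is outside the major arcs. -/
def gapPart (Y ρ r : ℝ) (x : Σ _ : ℕ, ℕ) : Set ℝ := {β | |β| < r ∧ (Y < x.1 ∨ ρ < x.1 * |β|)}

theorem measurableSet_majorPart (Y ρ : ℝ) (x : Σ _ : ℕ, ℕ) : MeasurableSet (majorPart Y ρ x) := by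
  have h : MeasurableSet {β : ℝ | (x.1 : ℝ) * |β| ≤ ρ} :=
    (isClosed_le (by fun_prop) continuous_const).measurableSet
  exact (MeasurableSet.const _).inter h

theorem near_diff_majorPart (Y ρ r : ℝ) (x : Σ _ : ℕ, ℕ) :
    {β : ℝ | |β| < r} \ majorPart Y ρ x = gapPart Y ρ r x := by
  ext β
  simp only [majorPart, gapPart, Set.mem_sdiff, Set.mem_ofPred_eq, not_and_or, not_le]

theorem measurableSet_gapPart (Y ρ r : ℝ) (x : Σ _ : ℕ, ℕ) : MeasurableSet (gapPart Y ρ r x) := by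
  rw [← near_diff_majorPart]
  exact (Regular.measurableSet_near r).diff (measurableSet_majorPart Y ρ x)

theorem abs_le_of_mem_majorPart {Y ρ : ℝ} {x : Σ _ : ℕ, ℕ} (hx : 1 ≤ x.1) {β : ℝ}
    (hβ : β ∈ majorPart Y ρ x) : |β| ≤ ρ := by
  have hq : (1 : ℝ) ≤ x.1 := by exact_mod_cast hx
  exact (le_mul_of_one_le_left (abs_nonneg β) hq).trans hβ.2

theorem integral_near_eq_add {F : ℝ → ℂ} (hF : Integrable F) {Y ρ r : ℝ} (hr : ρ < r)
    {x : Σ _ : ℕ, ℕ} (hx : 1 ≤ x.1) : ∫ β in {β : ℝ | |β| < r}, F β =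
      (∫ β in majorPart Y ρ x, F β) + ∫ β in gapPart Y ρ r x, F β := by
  have h := integral_inter_add_sdiff (s := {β : ℝ | |β| < r}) (measurableSet_majorPart Y ρ x)
    hF.integrableOn
  have h2 : {β : ℝ | |β| < r} ∩ majorPart Y ρ x = majorPart Y ρ x :=
    Set.inter_eq_right.2 fun β hβ => (abs_le_of_mem_majorPart hx hβ).trans_lt hr
  rw [near_diff_majorPart, h2] at h
  exact h.symm

theorem norm_phase_le (κ : (q : ℕ) → ZMod q → ℝ) (k s n q : ℕ) :
    ‖∑ b ∈ reducedResidues q, completeSum κ k q b ^ s * e (-((b : ℝ) * n / q))‖ ≤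
      ∑ b ∈ reducedResidues q, ‖completeSum κ k q b‖ ^ s :=
  norm_sum_le_of_le _ fun b _ => by rw [norm_mul, norm_e, mul_one, norm_pow]

/-- The error made by extending the major arcs to the singular series and integral. -/
theorem norm_series_mul_integral_sub_le {κ : (q : ℕ) → ZMod q → ℝ} {k s n : ℕ}
    (hsum : Summable fun q : ℕ => ∑ b ∈ reducedResidues q, ‖completeSum κ k q b‖ ^ s)
    {F : ℝ → ℂ} (hF : Integrable F) {Y ρ r : ℝ} (hr : ρ < r) (m : ℕ) :
    ‖singularSeries κ k s n * (∫ β, F β) - ∑ x ∈ fractions (Finset.Icc 1 m),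
      completeSum κ k x.1 x.2 ^ s * e (-((x.2 : ℝ) * n / x.1)) * ∫ β in majorPart Y ρ x, F β‖ ≤
      ∑ x ∈ fractions (Finset.Icc 1 m), ‖completeSum κ k x.1 x.2‖ ^ s *
        (∫ β in gapPart Y ρ r x, ‖F β‖) +
      (∑' q : ℕ, ∑ b ∈ reducedResidues q, ‖completeSum κ k q b‖ ^ s) *
        (∫ β in {β : ℝ | r ≤ |β|}, ‖F β‖) +
      (∑' q : ℕ, (if q ∈ Finset.Icc 1 m then 0 else
        ∑ b ∈ reducedResidues q, ‖completeSum κ k q b‖ ^ s)) *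
        ∫ β in {β : ℝ | |β| < r}, ‖F β‖ := by
  set ψ : ℕ → ℂ := fun q => ∑ b ∈ reducedResidues q,
    completeSum κ k q b ^ s * e (-((b : ℝ) * n / q)) with hψ
  set g : ℕ → ℝ := fun q => ∑ b ∈ reducedResidues q, ‖completeSum κ k q b‖ ^ s with hg
  have hψg : ∀ q, ‖ψ q‖ ≤ g q := norm_phase_le κ k s n
  have hg0 : ∀ q, 0 ≤ g q := fun q => (norm_nonneg _).trans (hψg q)
  have hψs : Summable ψ := Summable.of_norm_bounded hsum hψg
  have hS : singularSeries κ k s n = ∑' q, ψ q := rfl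
  have hg2 : Summable fun q => if q ∈ Finset.Icc 1 m then 0 else g q :=
    Summable.of_nonneg_of_le (fun q => by split_ifs; exacts [le_rfl, hg0 q])
      (fun q => by split_ifs; exacts [hg0 q, le_rfl]) hsum
  have hψ2 : ∀ q, ‖(if q ∈ Finset.Icc 1 m then 0 else ψ q)‖ ≤
      if q ∈ Finset.Icc 1 m then 0 else g q := fun q => by
    split_ifs
    · simp
    · exact hψg q
  have hT : ∑' q, ψ q = ∑ q ∈ Finset.Icc 1 m, ψ q +
      ∑' q, (if q ∈ Finset.Icc 1 m then 0 else ψ q) := by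
    have h1 : HasSum (fun q => if q ∈ Finset.Icc 1 m then ψ q else 0) (∑ q ∈ Finset.Icc 1 m, ψ q) := by
      have : HasSum (fun q => if q ∈ Finset.Icc 1 m then ψ q else 0)
          (∑ q ∈ Finset.Icc 1 m, if q ∈ Finset.Icc 1 m then ψ q else 0) :=
        hasSum_sum_of_ne_finset_zero fun q hq => if_neg hq
      rwa [Finset.sum_congr rfl fun q hq => if_pos hq] at this
    have h2 := (Summable.of_norm_bounded hg2 hψ2).hasSum
    have h3 := h1.add h2
    rw [← h3.tsum_eq]
    congr 1
    ext q
    split_ifs <;> simp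
  set T := ∑' q, (if q ∈ Finset.Icc 1 m then 0 else ψ q) with hTdef
  have hTle : ‖T‖ ≤ ∑' q, (if q ∈ Finset.Icc 1 m then 0 else g q) :=
    tsum_of_norm_bounded hg2.hasSum hψ2
  have hSle : ‖∑' q, ψ q‖ ≤ ∑' q, g q := tsum_of_norm_bounded hsum.hasSum hψg
  set φ : (Σ _ : ℕ, ℕ) → ℂ := fun x =>
    completeSum κ k x.1 x.2 ^ s * e (-((x.2 : ℝ) * n / x.1)) with hφ
  have hφsum : ∑ q ∈ Finset.Icc 1 m, ψ q = ∑ x ∈ fractions (Finset.Icc 1 m), φ x :=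
    (sum_fractions _ φ).symm
  have hK : ∫ β, F β = (∫ β in {β : ℝ | |β| < r}, F β) + ∫ β in {β : ℝ | r ≤ |β|}, F β := by
    rw [← integral_add_compl (Regular.measurableSet_near r) hF]
    congr 3
    ext β
    simp
  -- The series is cut at m and the line at r. For q ≤ m the central interval splits into the major
  -- part and the gap, which leaves the gap, the tail of the integral and the tail of the series.
  have hmain : (∑' q, ψ q) * (∫ β, F β) - ∑ x ∈ fractions (Finset.Icc 1 m),
      φ x * ∫ β in majorPart Y ρ x, F β =
      ∑ x ∈ fractions (Finset.Icc 1 m), φ x * (∫ β in gapPart Y ρ r x, F β) +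
      (∑' q, ψ q) * (∫ β in {β : ℝ | r ≤ |β|}, F β) + T * ∫ β in {β : ℝ | |β| < r}, F β := by
    have h1 : ∑ x ∈ fractions (Finset.Icc 1 m), φ x * (∫ β in gapPart Y ρ r x, F β) =
        (∑ x ∈ fractions (Finset.Icc 1 m), φ x) * (∫ β in {β : ℝ | |β| < r}, F β) -
        ∑ x ∈ fractions (Finset.Icc 1 m), φ x * ∫ β in majorPart Y ρ x, F β := by
      rw [Finset.sum_mul, ← Finset.sum_sub_distrib]
      refine Finset.sum_congr rfl fun x hx => ?_
      have hx1 : 1 ≤ x.1 := (Finset.mem_Icc.1 (mem_fractions.1 hx).1).1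
      rw [integral_near_eq_add hF hr hx1 (Y := Y)]
      ring
    rw [h1, ← hφsum, hK, hT]
    ring
  rw [hS, hmain]
  refine (norm_add_le _ _).trans (add_le_add ((norm_add_le _ _).trans (add_le_add ?_ ?_)) ?_)
  · refine norm_sum_le_of_le _ fun x _ => ?_
    rw [norm_mul, hφ]
    simp only [norm_mul, norm_e, mul_one, norm_pow]
    gcongr
    exact norm_integral_le_integral_norm _
  · rw [norm_mul]
    exact mul_le_mul hSle (norm_integral_le_integral_norm _) (norm_nonneg _) (tsum_nonneg hg0)
  · rw [norm_mul]
    exact mul_le_mul hTle (norm_integral_le_integral_norm _) (norm_nonneg _)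
      ((norm_nonneg _).trans hTle)

/-- Replacing the exponential sum by its approximation on the major arcs. -/
theorem norm_integral_major_sub_le {a : ℕ → ℝ} {κ : (q : ℕ) → ZMod q → ℝ} {k s n m : ℕ}
    {X Y t δ : ℝ} (hX : 0 < X) (hY : 0 ≤ Y) (hδ0 : 0 ≤ δ) (hm : ⌊Y⌋₊ ≤ m)
    (hsep : 2 * (Y / X ^ k) * Y ^ 2 < 1) (ht : Y / X ^ k < t) (ht' : t * Y + Y / X ^ k < 1)
    {h : ℝ → ℂ} (hh : Continuous h)
    (hδ : ∀ x ∈ fractions (Finset.Icc 1 ⌊Y⌋₊), ∀ β ∈ majorPart Y (Y / X ^ k) x,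
      ‖expSum a k (fracPt x + β) X ^ s - (completeSum κ k x.1 x.2 * h β) ^ s‖ ≤ δ) :
    ‖(∫ α in Set.Ioc t (t + 1) ∩ majorArcs k X Y, expSum a k α X ^ s * e (-(α * n))) -
      ∑ x ∈ fractions (Finset.Icc 1 m), completeSum κ k x.1 x.2 ^ s *
        e (-((x.2 : ℝ) * n / x.1)) * ∫ β in majorPart Y (Y / X ^ k) x, h β ^ s * e (-(β * n))‖ ≤
      2 * (Y / X ^ k) * Y * δ := by
  set ρ := Y / X ^ k with hρ
  have hρ0 : 0 ≤ ρ := by positivity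
  have hq : ∀ q ∈ Finset.Icc 1 ⌊Y⌋₊, (q : ℝ) ≤ Y := fun q hq =>
    (Nat.le_floor_iff hY).1 (Finset.mem_Icc.1 hq).2
  have hx1 : ∀ x ∈ fractions (Finset.Icc 1 ⌊Y⌋₊), 1 ≤ x.1 := fun x hx =>
    (Finset.mem_Icc.1 (mem_fractions.1 hx).1).1
  have hec := continuous_e
  have hfc := continuous_expSum (a := a) (k := k) X
  have hsub : ∑ x ∈ fractions (Finset.Icc 1 m), completeSum κ k x.1 x.2 ^ s *
      e (-((x.2 : ℝ) * n / x.1)) * ∫ β in majorPart Y ρ x, h β ^ s * e (-(β * n)) =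
      ∑ x ∈ fractions (Finset.Icc 1 ⌊Y⌋₊), completeSum κ k x.1 x.2 ^ s *
      e (-((x.2 : ℝ) * n / x.1)) * ∫ β in majorPart Y ρ x, h β ^ s * e (-(β * n)) := by
    symm
    refine Finset.sum_subset (Finset.sigma_mono (Finset.Icc_subset_Icc le_rfl hm)
      fun _ => Finset.Subset.refl _) fun x hx hx' => ?_
    -- Fractions with Y < q ≤ m have an empty major part, so the sum over q ≤ m can be used for
    -- bookkeeping.
    have hlarge : Y < x.1 := by
      by_contra hcon
      refine hx' (mem_fractions.2 ⟨Finset.mem_Icc.2 ⟨(Finset.mem_Icc.1 (mem_fractions.1 hx).1).1,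
        Nat.le_floor (not_lt.1 hcon)⟩, (mem_fractions.1 hx).2⟩)
    have : majorPart Y ρ x = ∅ := by
      ext β
      simp only [majorPart, Set.mem_ofPred_eq, Set.mem_empty_iff_false, iff_false, not_and]
      intro h
      linarith
    rw [this]
    simp
  have hD : ∀ x ∈ fractions (Finset.Icc 1 ⌊Y⌋₊), {β : ℝ | x.1 * |β| ≤ ρ} = majorPart Y ρ x := by
    intro x hx
    ext β
    simp [majorPart, hq _ (mem_fractions.1 hx).1]
  have harcs : ∫ α in Set.Ioc t (t + 1) ∩ majorArcs k X Y, expSum a k α X ^ s * e (-(α * n)) =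
      ∑ x ∈ fractions (Finset.Icc 1 ⌊Y⌋₊), ∫ β in majorPart Y ρ x,
        expSum a k (fracPt x + β) X ^ s * e (-((fracPt x + β) * n)) := by
    rw [sum_setIntegral_arcs (F := fun α => expSum a k α X ^ s * e (-(α * n))) hq hsep
      (fun x => measurableSet_majorPart Y ρ x)
      (fun x hx β hβ => abs_le_of_mem_majorPart (hx1 x hx) hβ) (by fun_prop), Set.inter_comm,
      majorArcs_inter_Ioc hX hY ht ht']
    congr 2
    refine Set.iUnion₂_congr fun x hx => ?_
    rw [hD x hx]
  have hcomp : ∀ x ∈ fractions (Finset.Icc 1 ⌊Y⌋₊), majorPart Y ρ x ⊆ Set.Icc (-(ρ / x.1)) (ρ / x.1) := by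
    intro x hx β hβ
    have : (1 : ℝ) ≤ x.1 := by exact_mod_cast hx1 x hx
    refine abs_le.1 ?_
    rw [le_div_iff₀ (by linarith), mul_comm]
    exact hβ.2
  have hint : ∀ x ∈ fractions (Finset.Icc 1 ⌊Y⌋₊), ∀ G : ℝ → ℂ, Continuous G →
      IntegrableOn G (majorPart Y ρ x) := fun x hx G hG =>
    (hG.continuousOn.integrableOn_compact isCompact_Icc).mono_set (hcomp x hx)
  rw [hsub, harcs, ← Finset.sum_sub_distrib]
  have hterm : ∀ x ∈ fractions (Finset.Icc 1 ⌊Y⌋₊),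
      ‖(∫ β in majorPart Y ρ x, expSum a k (fracPt x + β) X ^ s * e (-((fracPt x + β) * n))) -
      completeSum κ k x.1 x.2 ^ s * e (-((x.2 : ℝ) * n / x.1)) *
        ∫ β in majorPart Y ρ x, h β ^ s * e (-(β * n))‖ ≤ δ * (2 * ρ / x.1) := by
    intro x hx
    have hq1 : (1 : ℝ) ≤ x.1 := by exact_mod_cast hx1 x hx
    rw [← integral_const_mul, ← integral_sub (hint x hx _ (by fun_prop)) (hint x hx _ (by fun_prop))]
    have hfin : volume (majorPart Y ρ x) < ⊤ :=
      (measure_mono (hcomp x hx)).trans_lt measure_Icc_lt_top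
    refine (norm_setIntegral_le_of_norm_le_const (C := δ) hfin fun β hβ => ?_).trans ?_
    · have e1 : expSum a k (fracPt x + β) X ^ s * e (-((fracPt x + β) * n)) -
          completeSum κ k x.1 x.2 ^ s * e (-((x.2 : ℝ) * n / x.1)) * (h β ^ s * e (-(β * n))) =
          (expSum a k (fracPt x + β) X ^ s - (completeSum κ k x.1 x.2 * h β) ^ s) *
            e (-((fracPt x + β) * n)) := by
        have : -((fracPt x + β) * n) = -((x.2 : ℝ) * n / x.1) + -(β * n) := by
          simp only [fracPt]; ring
        rw [this, e_add]
        ring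
      rw [e1, norm_mul, norm_e, mul_one]
      exact hδ x hx β hβ
    · refine mul_le_mul_of_nonneg_left ?_ hδ0
      refine (measureReal_mono (hcomp x hx) (by simp)).trans (le_of_eq ?_)
      have : 0 ≤ ρ / x.1 := by positivity
      rw [Real.volume_real_Icc_of_le (by linarith)]
      ring
  refine (norm_sum_le_of_le _ hterm).trans ?_
  rw [sum_fractions _ fun x => δ * (2 * ρ / x.1)]
  have hinner : ∀ q ∈ Finset.Icc 1 ⌊Y⌋₊, ∑ _b ∈ reducedResidues q, δ * (2 * ρ / (q : ℝ)) ≤ 2 * ρ * δ := by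
    intro q hq'
    have hq1 : (1 : ℝ) ≤ q := by exact_mod_cast (Finset.mem_Icc.1 hq').1
    rw [Finset.sum_const, nsmul_eq_mul]
    calc ((reducedResidues q).card : ℝ) * (δ * (2 * ρ / (q : ℝ))) ≤ q * (δ * (2 * ρ / (q : ℝ))) := by
          gcongr
          exact card_reducedResidues_le q
      _ = _ := by field_simp
  refine (Finset.sum_le_sum hinner).trans ?_
  rw [Finset.sum_const, nsmul_eq_mul, Nat.card_Icc, Nat.add_sub_cancel]
  calc (⌊Y⌋₊ : ℝ) * (2 * ρ * δ) ≤ Y * (2 * ρ * δ) := by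
        gcongr
        exact Nat.floor_le hY
    _ = _ := by ring

namespace Regular
variable {a : ℕ → ℝ} {k : ℕ} {κ : (q : ℕ) → ZMod q → ℝ} {t₀ ϱ ω : ℝ}

/-- A point in the gap of a fraction with q ≤ A^{1/3} lies on the minor arcs, and these
neighbourhoods are disjoint. So S(q,b)^s times the transform is charged to the minor arc moment of
f, apart from an approximation error. -/
theorem saves_gap (H : Regular a k κ t₀ ϱ ω) {s : ℕ} (hs : 2 * t₀ + 5 * ω / ϱ < s) :
    Saves a k s fun X => ∑ x ∈ fractions (Finset.Icc 1 ⌊count a X ^ (1 / 3 : ℝ)⌋₊),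
      ‖completeSum κ k x.1 x.2‖ ^ s * ∫ β in gapPart (count a X ^ (1 / 5 : ℝ))
        (count a X ^ (1 / 5 : ℝ) / X ^ k) (3 * (count a X ^ (1 / 5 : ℝ) / X ^ k)) x,
          ‖smoothTransform a k (X ^ k) β‖ ^ s := by
  have hs3 := H.three_le hs
  have hsR : (3 : ℝ) ≤ s := by exact_mod_cast hs3
  obtain ⟨B, -, hB⟩ := H.bound
  obtain ⟨E, hE0, hE⟩ := H.exists_approximation
  obtain ⟨η, C, hη, hC, hmin⟩ := H.exists_minor_saving hs
  have hsav1 : Saves a k s fun X => 2 ^ s * ∫ α in Set.Ioc (3 * (count a X ^ (1 / 5 : ℝ) / X ^ k))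
      (3 * (count a X ^ (1 / 5 : ℝ) / X ^ k) + 1) ∩ minorArcs k X (count a X ^ (1 / 5 : ℝ)),
        ‖expSum a k α X‖ ^ s :=
    Saves.const_mul (by positivity) ⟨η, C, hη, hC, by filter_upwards [hmin] with X h using h _⟩
  -- With N = A^{1/3}: at most N² fractions, error NY in each factor, and intervals of length of
  -- order Y/X^k give A^{8s/15 + 13/15}/X^k, a saving since s ≥ 3.
  have hsav2 : Saves a k s fun X =>
      (6 * (8 * E) ^ s) * (count a X ^ (8 * (s : ℝ) / 15 + 13 / 15) / X ^ k) := by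
    refine Saves.of_exponent (η := 7 * (s : ℝ) / 15 - 13 / 15) (C := 6 * (8 * E) ^ s) (by linarith)
      (by positivity) (Eventually.of_forall fun X => le_of_eq ?_)
    congr 3
    ring
  refine (hsav1.add H.top hsav2).mono ?_
  filter_upwards [hE, H.eventually_scale] with X h1 ⟨hX, hA, hscale⟩
  set A := count a X with hAdef
  have hA0 : 0 < A := by linarith
  have hX0 : 0 < X := by linarith
  have hXk : 0 < X ^ k := by positivity
  set Y := A ^ (1 / 5 : ℝ) with hY
  set N := A ^ (1 / 3 : ℝ) with hN
  set ρ := Y / X ^ k with hρ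
  set h := smoothTransform a k (X ^ k) with hh
  have hpow : ∀ {p : ℝ}, p ≤ 7 / 5 → 100 * A ^ p ≤ X ^ k := fun hp =>
    (mul_le_mul_of_nonneg_left (Real.rpow_le_rpow_of_exponent_le hA hp) (by norm_num)).trans hscale
  have hpow1 : ∀ {p : ℝ}, 0 ≤ p → 1 ≤ A ^ p := fun hp => Real.one_le_rpow hA hp
  have hY1 : 1 ≤ Y := hpow1 (by norm_num)
  have hN1 : 1 ≤ N := hpow1 (by norm_num)
  have hρ0 : 0 < ρ := by positivity
  have hYN2 : Y * N ^ 2 = A ^ (13 / 15 : ℝ) := by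
    rw [hY, hN, ← Real.rpow_natCast (A ^ (1 / 3 : ℝ)), ← Real.rpow_mul hA0.le, ← Real.rpow_add hA0]
    norm_num
  have hρN2 : ρ * N ^ 2 ≤ 1 / 100 := by
    rw [hρ, div_mul_eq_mul_div, hYN2, div_le_iff₀ hXk]
    linarith [hpow (p := 13 / 15) (by norm_num)]
  have hYN : Y ≤ N := Real.rpow_le_rpow_of_exponent_le hA (by norm_num)
  have hqN : ∀ q ∈ Finset.Icc 1 ⌊N⌋₊, (q : ℝ) ≤ N := fun q hq =>
    (Nat.le_floor_iff (by positivity)).1 (Finset.mem_Icc.1 hq).2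
  have hx1 : ∀ x ∈ fractions (Finset.Icc 1 ⌊N⌋₊), 1 ≤ x.1 := fun x hx =>
    (Finset.mem_Icc.1 (mem_fractions.1 hx).1).1
  have hec := continuous_expSum (a := a) (k := k) X
  have hsubset : ∀ x, gapPart Y ρ (3 * ρ) x ⊆ {β : ℝ | |β| < 3 * ρ} := fun x β hβ => hβ.1
  have hgfin : ∀ x, volume (gapPart Y ρ (3 * ρ) x) < ⊤ := fun x =>
    (measure_mono (hsubset x)).trans_lt (volume_near_lt_top _)
  have hgvol : ∀ x, volume.real (gapPart Y ρ (3 * ρ) x) ≤ 6 * ρ := fun x => by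
    refine (measureReal_mono (hsubset x) (volume_near_lt_top _).ne).trans ?_
    rw [volume_near _ (by positivity)]
    linarith
  have hfint : ∀ x, IntegrableOn (fun β => ‖expSum a k (fracPt x + β) X‖ ^ s)
      (gapPart Y ρ (3 * ρ) x) := fun x => by
    refine ((by fun_prop : Continuous fun β => ‖expSum a k (fracPt x + β) X‖ ^ s).continuousOn.integrableOn_compact
      (isCompact_Icc (a := -(3 * ρ)) (b := 3 * ρ))).mono_set fun β hβ => abs_le.1 hβ.1.le
  have hterm : ∀ x ∈ fractions (Finset.Icc 1 ⌊N⌋₊), ‖completeSum κ k x.1 x.2‖ ^ s *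
      ∫ β in gapPart Y ρ (3 * ρ) x, ‖h β‖ ^ s ≤
      2 ^ s * (∫ β in gapPart Y ρ (3 * ρ) x, ‖expSum a k (fracPt x + β) X‖ ^ s) +
        2 ^ s * ((4 * E * (N * Y)) ^ s * (6 * ρ)) := by
    intro x hx
    have hxN := hqN _ (mem_fractions.1 hx).1
    have hcst : IntegrableOn (fun _ : ℝ => (4 * E * (N * Y)) ^ s) (gapPart Y ρ (3 * ρ) x) :=
      integrableOn_const (hgfin x).ne
    rw [← integral_const_mul]
    calc _ ≤ ∫ β in gapPart Y ρ (3 * ρ) x,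
          2 ^ s * (‖expSum a k (fracPt x + β) X‖ ^ s + (4 * E * (N * Y)) ^ s) := by
          refine setIntegral_mono_on
            (((integrable_norm_smoothTransform_pow H.two_le H.nonneg hB hX
              (by omega)).integrableOn).const_mul _) (((hfint x).add hcst).const_mul _)
            (measurableSet_gapPart _ _ _ _) fun β hβ => ?_
          have h2 := h1 x (hx1 x hx) β hβ.1.le
          have h3 : E * (x.1 * (1 + |β| * X ^ k)) ≤ 4 * E * (N * Y) := by
            have h4 : |β| * X ^ k ≤ 3 * Y := by
              calc |β| * X ^ k ≤ 3 * ρ * X ^ k := by gcongr; exact hβ.1.le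
                _ = 3 * Y := by rw [hρ]; field_simp
            calc E * (x.1 * (1 + |β| * X ^ k)) ≤ E * (N * (Y + 3 * Y)) := by gcongr
              _ = _ := by ring
          have h5 := norm_sub_norm_le (completeSum κ k x.1 x.2 * h β)
            (expSum a k (fracPt x + β) X)
          rw [norm_sub_rev] at h5
          rw [← mul_pow, ← norm_mul]
          calc _ ≤ (‖expSum a k (fracPt x + β) X‖ + 4 * E * (N * Y)) ^ s := by
                gcongr; linarith
            _ ≤ _ := add_pow_le_two_pow_mul (norm_nonneg _) (by positivity) s
      _ = 2 ^ s * ((∫ β in gapPart Y ρ (3 * ρ) x, ‖expSum a k (fracPt x + β) X‖ ^ s) +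
          volume.real (gapPart Y ρ (3 * ρ) x) * (4 * E * (N * Y)) ^ s) := by
          rw [integral_const_mul, integral_add (hfint x) hcst, setIntegral_const, smul_eq_mul]
      _ ≤ 2 ^ s * ((∫ β in gapPart Y ρ (3 * ρ) x, ‖expSum a k (fracPt x + β) X‖ ^ s) +
          6 * ρ * (4 * E * (N * Y)) ^ s) := by
          gcongr
          exact hgvol x
      _ = _ := by ring
  refine (Finset.sum_le_sum hterm).trans ?_
  rw [Finset.sum_add_distrib, ← Finset.mul_sum, Finset.sum_const, nsmul_eq_mul]
  refine add_le_add ?_ ?_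
  · refine mul_le_mul_of_nonneg_left ?_ (by positivity)
    refine sum_setIntegral_arcs_le (N := N) (r := 3 * ρ) hqN (by nlinarith)
      (fun x => measurableSet_gapPart _ _ _ x) (fun x _ β hβ => hβ.1.le) (hec.norm.pow s)
      (fun α => pow_nonneg (norm_nonneg _) _) (integrableOn_norm_expSum_pow s _ _ _) ?_
    intro x hx β hβ
    have hbd := fracPt_bounds hx hqN
    have hxN := hqN _ (mem_fractions.1 hx).1
    have hβ' := abs_lt.1 hβ.1
    refine ⟨⟨?_, by linarith⟩, ?_⟩
    · have h2 : 6 * ρ < 1 / N := by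
        rw [lt_div_iff₀ (by linarith)]
        nlinarith
      linarith
    · have := mem_minorArcs_of_near (k := k) (X := X) (Q := Y) (q := x.1) (b := x.2) (β := β)
        (r := 3 * ρ) (hx1 x hx) (mem_fractions.1 hx).2.2.2 (by linarith) hX0 hβ.1.le hβ.2 ?_
      · simpa [fracPt] using this
      · calc (3 * ρ + ρ) * x.1 * Y ≤ (3 * ρ + ρ) * N * N := by gcongr
          _ = 4 * (ρ * N ^ 2) := by ring
          _ < 1 := by linarith
  · have hcard : ((fractions (Finset.Icc 1 ⌊N⌋₊)).card : ℝ) ≤ N ^ 2 := by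
      have h2 := card_fractions_le (t := Finset.Icc 1 ⌊N⌋₊) (N := ⌊N⌋₊)
        fun q hq => (Finset.mem_Icc.1 hq).2
      rw [Nat.card_Icc, Nat.add_sub_cancel] at h2
      have h3 := Nat.floor_le (by linarith : 0 ≤ N)
      calc ((fractions (Finset.Icc 1 ⌊N⌋₊)).card : ℝ) ≤ ((⌊N⌋₊ * ⌊N⌋₊ : ℕ) : ℝ) := by
            exact_mod_cast h2
        _ ≤ N ^ 2 := by push_cast; nlinarith [Nat.cast_nonneg (α := ℝ) ⌊N⌋₊]
    have hNY : (N * Y) ^ s = A ^ (8 * (s : ℝ) / 15) := by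
      rw [hY, hN, ← Real.rpow_add hA0, ← Real.rpow_natCast, ← Real.rpow_mul hA0.le]
      congr 1; ring
    calc _ ≤ N ^ 2 * (2 ^ s * ((4 * E * (N * Y)) ^ s * (6 * ρ))) := by gcongr
      _ = 6 * (8 * E) ^ s * ((N * Y) ^ s * (Y * N ^ 2) / X ^ k) := by
        rw [hρ, mul_pow (4 * E), show 8 * E = 2 * (4 * E) by ring, mul_pow 2 (4 * E)]
        ring
      _ = _ := by rw [hNY, hYN2, ← Real.rpow_add hA0]

/-- Cutting the series at A^{1/3} saves A^{σ/3}. For σ = 1 this beats the trivial loss A^{1/5};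
otherwise σ > 3ω and it beats the mean value loss A^ω. -/
theorem saves_tail_mul_near (H : Regular a k κ t₀ ϱ ω) {s : ℕ} (hs : 2 * t₀ + 5 * ω / ϱ < s) :
    Saves a k s fun X => (∑' q : ℕ, (if q ∈ Finset.Icc 1 ⌊count a X ^ (1 / 3 : ℝ)⌋₊ then 0 else
        ∑ b ∈ reducedResidues q, ‖completeSum κ k q b‖ ^ s)) *
        ∫ β in {β : ℝ | |β| < 3 * (count a X ^ (1 / 5 : ℝ) / X ^ k)},
          ‖smoothTransform a k (X ^ k) β‖ ^ s := by
  have hω := H.ω_nonneg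
  obtain ⟨σ, C, m₀, hσ, hσ', hC, hm₀, htail⟩ := H.tsum_tail_le hs
  obtain ⟨C', hC', hnear⟩ := H.exists_near_le hs
  have hlarge : ∀ᶠ X : ℝ in atTop, (m₀ : ℝ) ≤ count a X ^ (1 / 3 : ℝ) :=
    ((tendsto_rpow_atTop (by norm_num : (0 : ℝ) < 1 / 3)).comp H.top).eventually_ge_atTop _
  have hkey : ∀ p : ℝ, 0 ≤ p → p < σ / 3 → (∀ᶠ X : ℝ in atTop,
      ∫ β in {β : ℝ | |β| < 3 * (count a X ^ (1 / 5 : ℝ) / X ^ k)},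
        ‖smoothTransform a k (X ^ k) β‖ ^ s ≤ C' * (count a X ^ ((s : ℝ) + p) / X ^ k)) →
      Saves a k s fun X => (∑' q : ℕ, (if q ∈ Finset.Icc 1 ⌊count a X ^ (1 / 3 : ℝ)⌋₊ then 0 else
        ∑ b ∈ reducedResidues q, ‖completeSum κ k q b‖ ^ s)) *
        ∫ β in {β : ℝ | |β| < 3 * (count a X ^ (1 / 5 : ℝ) / X ^ k)},
          ‖smoothTransform a k (X ^ k) β‖ ^ s := by
    intro p hp hpσ hb
    refine Saves.of_exponent (η := σ / 3 - p) (C := C * 2 ^ σ * C') (by linarith) (by positivity) ?_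
    filter_upwards [hb, hlarge, H.eventually_scale] with X h1 h2 ⟨hX, hA, _⟩
    set A := count a X with hAdef
    have hA0 : 0 < A := by linarith
    have hX0 : 0 < X := by linarith
    set N := A ^ (1 / 3 : ℝ) with hN
    have hN1 : 1 ≤ N := Real.one_le_rpow hA (by norm_num)
    have h3 := htail ⌊N⌋₊ (Nat.le_floor h2)
    have h4 : N / 2 ≤ (⌊N⌋₊ : ℝ) := by
      have h5 := Nat.lt_floor_add_one N
      have h6 : (1 : ℝ) ≤ ⌊N⌋₊ := by exact_mod_cast Nat.le_floor (by simpa using hN1)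
      linarith
    have h5 : (⌊N⌋₊ : ℝ) ^ (-σ) ≤ 2 ^ σ * A ^ (-(σ / 3)) := by
      calc (⌊N⌋₊ : ℝ) ^ (-σ) ≤ (N / 2) ^ (-σ) :=
            Real.rpow_le_rpow_of_nonpos (by positivity) h4 (by linarith)
        _ = 2 ^ σ * N ^ (-σ) := by
          rw [Real.div_rpow (by positivity) (by norm_num), Real.rpow_neg (by norm_num : (0 : ℝ) ≤ 2)]
          field_simp
        _ = _ := by
          rw [hN, ← Real.rpow_mul hA0.le]
          congr 2; ring
    have h0 : 0 ≤ ∫ β in {β : ℝ | |β| < 3 * (A ^ (1 / 5 : ℝ) / X ^ k)},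
        ‖smoothTransform a k (X ^ k) β‖ ^ s := integral_nonneg fun β => by positivity
    calc _ ≤ C * (2 ^ σ * A ^ (-(σ / 3))) * (C' * (A ^ ((s : ℝ) + p) / X ^ k)) := by
          refine mul_le_mul (h3.trans ?_) h1 h0 (by positivity)
          gcongr
      _ = C * 2 ^ σ * C' * ((A ^ (-(σ / 3)) * A ^ ((s : ℝ) + p)) / X ^ k) := by ring
      _ = _ := by
        rw [← Real.rpow_add hA0]
        congr 3
        ring
  rcases hσ' with h | h
  · refine hkey (1 / 5) (by norm_num) (by rw [h]; norm_num) ?_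
    filter_upwards [hnear] with X h1 using h1.1
  · refine hkey ω hω (by linarith) ?_
    filter_upwards [hnear] with X h1 using h1.2

end Regular

/-! ### The circle method -/

namespace Regular
variable {a : ℕ → ℝ} {k : ℕ} {κ : (q : ℕ) → ZMod q → ℝ} {t₀ ϱ ω : ℝ}

/-- On the major arcs q(1 + |β|X^k) ≤ 2Y, so one factor costs O(Y) and the s-th power O(A^{s-1}Y).
The major arcs have measure O(Y²/X^k), and Y³ = A^{3/5}. -/
theorem exists_major_error (H : Regular a k κ t₀ ϱ ω) {s : ℕ} (hs : 1 ≤ s) :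
    ∃ C : ℝ, 0 ≤ C ∧ ∀ᶠ X : ℝ in atTop, ∀ n : ℕ,
      ‖(∫ α in Set.Ioc (3 * (count a X ^ (1 / 5 : ℝ) / X ^ k))
          (3 * (count a X ^ (1 / 5 : ℝ) / X ^ k) + 1) ∩ majorArcs k X (count a X ^ (1 / 5 : ℝ)),
          expSum a k α X ^ s * e (-(α * n))) -
        ∑ x ∈ fractions (Finset.Icc 1 ⌊count a X ^ (1 / 3 : ℝ)⌋₊), completeSum κ k x.1 x.2 ^ s *
          e (-((x.2 : ℝ) * n / x.1)) *
          ∫ β in majorPart (count a X ^ (1 / 5 : ℝ)) (count a X ^ (1 / 5 : ℝ) / X ^ k) x,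
            smoothTransform a k (X ^ k) β ^ s * e (-(β * n))‖ ≤
        C * (count a X ^ ((s : ℝ) - 2 / 5) / X ^ k) := by
  obtain ⟨B, -, hB⟩ := H.bound
  obtain ⟨D, hD0, hD⟩ := H.disc
  obtain ⟨E, hE0, hE⟩ := H.exists_approximation
  obtain ⟨C₀, -, hΨ⟩ := H.eventually_smoothCount
  obtain ⟨j, rfl⟩ : ∃ j, s = j + 1 := ⟨s - 1, by omega⟩
  refine ⟨4 * (j + 1) * 2 ^ j * E, by positivity, ?_⟩
  filter_upwards [hE, hΨ, H.eventually_scale] with X h1 ⟨_, _, h2⟩ ⟨hX, hA, hscale⟩ n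
  set A := count a X with hAdef
  have hA0 : 0 < A := by linarith
  have hX0 : 0 < X := by linarith
  have hXk : 0 < X ^ k := by positivity
  set Y := A ^ (1 / 5 : ℝ) with hY
  have hY1 : 1 ≤ Y := Real.one_le_rpow hA (by norm_num)
  have hY3 : Y ^ 3 = A ^ (3 / 5 : ℝ) := by
    rw [hY, ← Real.rpow_natCast, ← Real.rpow_mul hA0.le]
    norm_num
  have hsep : Y / X ^ k * Y ^ 2 ≤ 1 / 100 := by
    rw [div_mul_eq_mul_div, ← pow_succ', hY3, div_le_iff₀ hXk]
    linarith [Real.rpow_le_rpow_of_exponent_le hA (by norm_num : (3 / 5 : ℝ) ≤ 7 / 5)]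
  have hρ0 : 0 < Y / X ^ k := by positivity
  have hmaj := norm_integral_major_sub_le (a := a) (κ := κ) (k := k) (s := j + 1) (n := n)
    (m := ⌊A ^ (1 / 3 : ℝ)⌋₊) (X := X) (Y := Y) (t := 3 * (Y / X ^ k))
    (δ := (j + 1) * (2 * A) ^ j * (2 * E * Y)) hX0 (by linarith) (by positivity)
    (Nat.floor_mono (Real.rpow_le_rpow_of_exponent_le hA (by norm_num))) (by linarith)
    (by linarith) (by nlinarith)
    (continuous_smoothTransform H.ne_zero H.nonneg hB (X ^ k)) (fun x hx β hβ => by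
      have hx1 : 1 ≤ x.1 := (Finset.mem_Icc.1 (mem_fractions.1 hx).1).1
      have hβ1 := abs_le_of_mem_majorPart hx1 hβ
      have h3 := h1 x hx1 β (by linarith)
      have h4 : x.1 * (1 + |β| * X ^ k) ≤ 2 * Y := by
        have h5 : (x.1 : ℝ) * |β| * X ^ k ≤ Y := by
          rw [← le_div_iff₀ hXk]; exact hβ.2
        have h6 := hβ.1
        nlinarith
      refine (norm_pow_succ_sub_pow_succ_le (M := 2 * A) ?_ ?_ j).trans ?_
      · linarith [norm_expSum_le (k := k) H.nonneg (fracPt x + β) X]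
      · rw [norm_mul]
        have h5 := norm_completeSum_le_one H.ne_zero H.nonneg hD H.top hx1 x.2
        have h6 := norm_smoothTransform_le H.ne_zero H.nonneg hB hX0.le β
        calc _ ≤ 1 * (2 * A) := mul_le_mul h5 (h6.trans h2) (norm_nonneg _) zero_le_one
          _ = _ := one_mul _
      · refine mul_le_mul_of_nonneg_left (h3.trans ?_) (by positivity)
        calc _ ≤ E * (2 * Y) := by gcongr
          _ = _ := by ring)
  refine hmaj.trans (le_of_eq ?_)
  have e1 : A ^ (((j + 1 : ℕ) : ℝ) - 2 / 5) = A ^ j * Y ^ 3 := by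
    rw [hY3, ← Real.rpow_natCast A j, ← Real.rpow_add hA0]
    congr 1
    push_cast
    ring
  rw [e1, mul_pow]
  ring

theorem norm_transform_mul_e (s n : ℕ) (N β : ℝ) :
    ‖smoothTransform a k N β ^ s * e (-(β * n))‖ = ‖smoothTransform a k N β‖ ^ s := by
  rw [norm_mul, norm_e, mul_one, norm_pow]

/-- The period is started at 3Y/X^k so that no arc is cut. The constants do not depend on n, which
is free until X is tied to it. -/
theorem exists_circle_saving (H : Regular a k κ t₀ ϱ ω) {s : ℕ}
    (hs : 2 * t₀ + 5 * ω / ϱ < s) : ∃ η C : ℝ, 0 < η ∧ 0 ≤ C ∧ ∀ᶠ X : ℝ in atTop, ∀ n : ℕ,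
      ‖(∫ α in (0 : ℝ)..1, expSum a k α X ^ s * e (-(α * n))) -
        singularSeries κ k s n * ∫ β, smoothTransform a k (X ^ k) β ^ s * e (-(β * n))‖ ≤
        C * (count a X ^ (s - η) / X ^ k) := by
  have hs3 := H.three_le hs
  obtain ⟨B, -, hB⟩ := H.bound
  obtain ⟨C₁, hC₁, h₁⟩ := H.exists_major_error (s := s) (by omega)
  obtain ⟨η₂, C₂, hη₂, hC₂, h₂⟩ := H.exists_minor_saving hs
  obtain ⟨η₃, C₃, hη₃, hC₃, h₃⟩ := H.exists_tail_saving hs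
  have hsum := H.summable_completeSum hs
  have hT0 : 0 ≤ ∑' q : ℕ, ∑ b ∈ reducedResidues q, ‖completeSum κ k q b‖ ^ s :=
    tsum_nonneg fun q => Finset.sum_nonneg fun b _ => by positivity
  have hmaj : Saves a k s fun X => C₁ * (count a X ^ ((s : ℝ) - 2 / 5) / X ^ k) :=
    .of_exponent (by norm_num) hC₁ (.of_forall fun X => le_rfl)
  have hmin : Saves a k s fun X => C₂ * (count a X ^ ((s : ℝ) - η₂) / X ^ k) :=
    .of_exponent hη₂ hC₂ (.of_forall fun X => le_rfl)
  have htail : Saves a k s fun X => ∫ β in {β : ℝ | 3 * (count a X ^ (1 / 5 : ℝ) / X ^ k) ≤ |β|},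
        ‖smoothTransform a k (X ^ k) β‖ ^ s := ⟨η₃, C₃, hη₃, hC₃, h₃⟩
  obtain ⟨η, C, hη, hC, h⟩ := (hmaj.add H.top hmin).add H.top
    (((H.saves_gap hs).add H.top (htail.const_mul hT0)).add H.top (H.saves_tail_mul_near hs))
  refine ⟨η, C, hη, hC, ?_⟩
  filter_upwards [h, h₁, h₂, H.eventually_scale] with X hall h4 h5 ⟨hX, hA, _⟩ n
  refine le_trans ?_ hall
  set A := count a X with hAdef
  have hX0 : 0 < X := by linarith
  set Y := A ^ (1 / 5 : ℝ) with hY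
  have hY0 : 0 < Y := by positivity
  have hρ0 : 0 < Y / X ^ k := by positivity
  set t := 3 * (Y / X ^ k) with ht
  set F : ℝ → ℂ := fun β => smoothTransform a k (X ^ k) β ^ s * e (-(β * n)) with hF
  have hec := continuous_e
  have hfc := continuous_expSum (a := a) (k := k) X
  have hhc := continuous_smoothTransform H.ne_zero H.nonneg hB (X ^ k)
  have hFc : Continuous F := by fun_prop
  have hFi : Integrable F := by
    refine (integrable_norm_iff hFc.aestronglyMeasurable).1 ?_
    simp only [hF, norm_transform_mul_e]
    exact integrable_norm_smoothTransform_pow H.two_le H.nonneg hB hX (by omega)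
  have h6 := norm_series_mul_integral_sub_le hsum hFi (n := n) (Y := Y) (r := t)
    (show Y / X ^ k < t by linarith) ⌊A ^ (1 / 3 : ℝ)⌋₊
  simp only [hF, norm_transform_mul_e] at h6
  have hper : Function.Periodic (fun α : ℝ => expSum a k α X ^ s * e (-(α * n))) 1 := fun α => by
    have h7 := periodic_expSum (a := a) (k := k) X α
    simp only at h7 ⊢
    rw [h7]
    congr 1
    exact e_eq_of_sub_int (-(n : ℤ)) (by push_cast; ring)
  have hint : ∫ α in (0 : ℝ)..1, expSum a k α X ^ s * e (-(α * n)) =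
      (∫ α in Set.Ioc t (t + 1) ∩ majorArcs k X Y, expSum a k α X ^ s * e (-(α * n))) +
      ∫ α in Set.Ioc t (t + 1) ∩ minorArcs k X Y, expSum a k α X ^ s * e (-(α * n)) := by
    have h7 := hper.intervalIntegral_add_eq 0 t
    rw [zero_add] at h7
    rw [h7, intervalIntegral.integral_of_le (by linarith),
      ← integral_inter_add_sdiff (measurableSet_majorArcs (k := k) (X := X) (Q := Y))]
    · rfl
    · exact (Continuous.integrableOn_Icc (by fun_prop)).mono_set Set.Ioc_subset_Icc_self
  have h7 : ‖∫ α in Set.Ioc t (t + 1) ∩ minorArcs k X Y, expSum a k α X ^ s * e (-(α * n))‖ ≤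
      C₂ * (A ^ ((s : ℝ) - η₂) / X ^ k) := by
    refine (norm_integral_le_integral_norm _).trans ?_
    simp only [norm_mul, norm_e, mul_one, norm_pow]
    exact h5 t
  rw [hint]
  have e1 : ∀ u v w z : ℂ, u + v - w = (u - z) + v - (w - z) := fun u v w z => by ring
  rw [e1 _ _ _ (∑ x ∈ fractions (Finset.Icc 1 ⌊A ^ (1 / 3 : ℝ)⌋₊),
    completeSum κ k x.1 x.2 ^ s * e (-((x.2 : ℝ) * n / x.1)) *
      ∫ β in majorPart Y (Y / X ^ k) x, F β)]
  refine (norm_sub_le _ _).trans (add_le_add ((norm_add_le _ _).trans ?_) h6)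
  exact add_le_add (h4 n) h7

end Regular

/-! ### The singular integral -/

theorem singularIntegral_smoothCount {a : ℕ → ℝ} {k : ℕ} {B : ℝ} (hk : k ≠ 0)
    (ha : ∀ n, 0 ≤ a n) (hB : ∀ n, 1 ≤ n → a n ≤ B) (s : ℕ) {n : ℕ} (hn : 1 ≤ n) :
    singularIntegral (smoothCount a k) k s n =
      n * (∫ β, smoothTransform a k n β ^ s * e (-(β * n))) /
        (smoothCount a k ((n : ℝ) ^ (1 / k : ℝ)) : ℂ) ^ s := by
  have hn0 : (n : ℝ) ≠ 0 := by positivity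
  have h := Measure.integral_comp_div (fun β => smoothTransform a k n β ^ s * e (-(β * n))) (n : ℝ)
  simp only [div_mul_cancel₀ _ hn0] at h
  rw [singularIntegral]
  simp only [singularIntegrand_smoothCount hk ha hB, div_pow]
  rw [abs_of_nonneg (Nat.cast_nonneg n), Complex.real_smul, Complex.ofReal_natCast] at h
  rw [← h, ← integral_div]
  refine integral_congr_ae (ae_of_all _ fun γ => ?_)
  simp only
  ring

namespace Regular
variable {a : ℕ → ℝ} {k : ℕ} {κ : (q : ℕ) → ZMod q → ℝ} {t₀ ϱ ω : ℝ}

/-- A crude bound with loss A^{1/5}; it suffices because it is only multiplied by the relative error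
O(1/A) of replacing Ψ by A. -/
theorem exists_integral_le (H : Regular a k κ t₀ ϱ ω) {s : ℕ} (hs : 2 * t₀ + 5 * ω / ϱ < s) :
    ∃ C : ℝ, 0 ≤ C ∧ ∀ᶠ X : ℝ in atTop, ∀ n : ℕ,
      ‖∫ β, smoothTransform a k (X ^ k) β ^ s * e (-(β * n))‖ ≤
        C * (count a X ^ ((s : ℝ) + 1 / 5) / X ^ k) := by
  have hs3 := H.three_le hs
  obtain ⟨B, -, hB⟩ := H.bound
  obtain ⟨C₁, hC₁, h₁⟩ := H.exists_near_le hs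
  obtain ⟨η, C₂, hη, hC₂, h₂⟩ := H.exists_tail_saving hs
  refine ⟨C₁ + C₂, by positivity, ?_⟩
  filter_upwards [h₁, h₂, H.eventually_scale] with X ⟨h3, _⟩ h4 ⟨hX, hA, _⟩ n
  have hX0 : 0 < X := by linarith
  refine (norm_integral_le_integral_norm _).trans ?_
  simp only [norm_transform_mul_e]
  rw [← integral_add_compl (measurableSet_near (3 * (count a X ^ (1 / 5 : ℝ) / X ^ k)))
    (integrable_norm_smoothTransform_pow H.two_le H.nonneg hB hX (by omega)), add_mul]
  refine add_le_add h3 ?_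
  have e1 : {β : ℝ | |β| < 3 * (count a X ^ (1 / 5 : ℝ) / X ^ k)}ᶜ =
      {β : ℝ | 3 * (count a X ^ (1 / 5 : ℝ) / X ^ k) ≤ |β|} := by
    ext β
    simp
  rw [e1]
  refine h4.trans ?_
  gcongr
  linarith

/-- With X = n^{1/k} the substitution γ = nβ identifies the completed integral with Ψ(X)^s n^{-1}
times the singular integral. Passing from Ψ^s to A^s costs A^{-1} relative to a term of size
A^{s+1/5}/n. -/
theorem exists_asymptotic_saving (H : Regular a k κ t₀ ϱ ω) {s : ℕ}
    (hs : 2 * t₀ + 5 * ω / ϱ < s) : ∃ η C : ℝ, 0 < η ∧ 0 ≤ C ∧ ∀ᶠ n : ℕ in atTop,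
      ‖(repCount a k s n : ℂ) - mainScale a k s n *
        (singularSeries κ k s n * singularIntegral (smoothCount a k) k s n)‖ ≤
        C * (count a ((n : ℝ) ^ (1 / k : ℝ)) ^ (s - η) / n) := by
  have hs3 := H.three_le hs
  obtain ⟨B, -, hB⟩ := H.bound
  obtain ⟨η, C, hη, hC, h⟩ := H.exists_circle_saving hs
  obtain ⟨C₁, hC₁, h₁⟩ := H.exists_integral_le hs
  obtain ⟨C₂, hC₂, h₂⟩ := H.eventually_smoothCount
  obtain ⟨j, rfl⟩ : ∃ j, s = j + 1 := ⟨s - 1, by omega⟩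
  have hsum := H.summable_completeSum hs
  set T := ∑' q : ℕ, ∑ b ∈ reducedResidues q, ‖completeSum κ k q b‖ ^ (j + 1) with hT
  have hT0 : 0 ≤ T := tsum_nonneg fun q => Finset.sum_nonneg fun b _ => by positivity
  have hSle : ∀ n, ‖singularSeries κ k (j + 1) n‖ ≤ T := fun n =>
    tsum_of_norm_bounded hsum.hasSum (norm_phase_le κ k (j + 1) n)
  have hroot : Tendsto (fun n : ℕ => (n : ℝ) ^ (1 / k : ℝ)) atTop atTop := by
    have hk0 : (0 : ℝ) < k := by exact_mod_cast Nat.pos_of_ne_zero H.ne_zero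
    exact (tendsto_rpow_atTop (by positivity)).comp tendsto_natCast_atTop_atTop
  refine ⟨min η (4 / 5), C + (2 ^ (j + 1) * ((j + 1) * 2 ^ j * C₂)) * (T * C₁),
    lt_min hη (by norm_num), by positivity, ?_⟩
  filter_upwards [hroot.eventually h, hroot.eventually h₁, hroot.eventually h₂,
    hroot.eventually H.eventually_scale, eventually_ge_atTop 1]
    with n h3 h4 ⟨h5, h6, h7⟩ ⟨hX, hA, _⟩ hn
  have hXk : ((n : ℝ) ^ (1 / k : ℝ)) ^ k = n := by
    rw [one_div, Real.rpow_inv_natCast_pow (Nat.cast_nonneg n) H.ne_zero]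
  rw [hXk] at h3 h4
  replace h3 := h3 n
  replace h4 := h4 n
  rw [← repCount_eq_integral H.ne_zero] at h3
  rw [singularIntegral_smoothCount H.ne_zero H.nonneg hB (j + 1) hn, mainScale]
  set A := count a ((n : ℝ) ^ (1 / k : ℝ)) with hAdef
  set P := smoothCount a k ((n : ℝ) ^ (1 / k : ℝ)) with hP
  set K := ∫ β, smoothTransform a k n β ^ (j + 1) * e (-(β * n)) with hK
  set S := singularSeries κ k (j + 1) n with hS
  have hA0 : 0 < A := by linarith
  have hP0 : 0 < P := by linarith
  have hn0 : (0 : ℝ) < n := by exact_mod_cast hn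
  have hPc : (P : ℂ) ≠ 0 := by exact_mod_cast hP0.ne'
  have hnc : (n : ℂ) ≠ 0 := by exact_mod_cast hn0.ne'
  have e1 : (repCount a k (j + 1) n : ℂ) - ((A ^ (j + 1) / n : ℝ) : ℂ) *
      (S * (n * K / (P : ℂ) ^ (j + 1))) =
      ((repCount a k (j + 1) n : ℂ) - S * K) +
        ((P : ℂ) ^ (j + 1) - (A : ℂ) ^ (j + 1)) / (P : ℂ) ^ (j + 1) * (S * K) := by
    push_cast
    field_simp
    ring
  have h8 : ‖((P : ℂ) ^ (j + 1) - (A : ℂ) ^ (j + 1)) / (P : ℂ) ^ (j + 1)‖ ≤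
      2 ^ (j + 1) * ((j + 1) * 2 ^ j * C₂) / A := by
    have h9 := norm_pow_succ_sub_pow_succ_le (z := (P : ℂ)) (w := (A : ℂ)) (M := 2 * A)
      (by rwa [Complex.norm_real, Real.norm_of_nonneg hP0.le])
      (by rw [Complex.norm_real, Real.norm_of_nonneg hA0.le]; linarith) j
    rw [← Complex.ofReal_sub, Complex.norm_real, Real.norm_eq_abs] at h9
    rw [norm_div, norm_pow, Complex.norm_real, Real.norm_of_nonneg hP0.le]
    calc _ ≤ (j + 1) * (2 * A) ^ j * C₂ / (A / 2) ^ (j + 1) := by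
          gcongr
          exact h9.trans (by gcongr)
      _ = _ := by
        rw [div_pow, mul_pow, pow_succ A]
        field_simp
  rw [e1]
  refine (norm_add_le _ _).trans ?_
  rw [add_mul]
  refine add_le_add (h3.trans ?_) ?_
  · gcongr
    exact min_le_left _ _
  · rw [norm_mul, norm_mul]
    calc _ ≤ (2 ^ (j + 1) * ((j + 1) * 2 ^ j * C₂) / A) *
          (T * (C₁ * (A ^ (((j + 1 : ℕ) : ℝ) + 1 / 5) / n))) := by
          gcongr
          exact hSle n
      _ = (2 ^ (j + 1) * ((j + 1) * 2 ^ j * C₂)) * (T * C₁) *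
          (A ^ (((j + 1 : ℕ) : ℝ) + 1 / 5) / A / n) := by ring
      _ ≤ _ := by
        rw [div_eq_mul_inv (A ^ _) A, ← Real.rpow_neg_one A, ← Real.rpow_add hA0]
        gcongr
        have := min_le_right η (4 / 5)
        linarith

theorem asymptoticFormula (H : Regular a k κ t₀ ϱ ω) {s : ℕ} (hs : 2 * t₀ + 5 * ω / ϱ < s) :
    AsymptoticFormula a κ (smoothCount a k) k s := by
  have hs3 := H.three_le hs
  obtain ⟨B, -, hB⟩ := H.bound
  obtain ⟨η, C, hη, hC, h⟩ := H.exists_asymptotic_saving hs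
  refine ⟨H.summable_completeSum hs, fun n hn =>
    integrable_singularIntegrand H.two_le H.nonneg hB (by omega) hn,
    fun n => (singularSeries κ k s n * singularIntegral (smoothCount a k) k s n).re, ?_, ?_⟩
  · intro n hn
    obtain ⟨r, hr, hr'⟩ := mul_mem_nonnegReals (H.singularSeries_mem_nonnegReals hs n)
      (singularIntegral_mem_nonnegReals H.two_le H.nonneg hB (by omega : 2 ≤ s) hn)
    dsimp only
    rw [← hr', Complex.ofReal_re]
    exact ⟨hr, rfl⟩
  · have hroot : Tendsto (fun n : ℕ => count a ((n : ℝ) ^ (1 / k : ℝ))) atTop atTop := by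
      have hk0 : (0 : ℝ) < k := by exact_mod_cast Nat.pos_of_ne_zero H.ne_zero
      exact H.top.comp ((tendsto_rpow_atTop (by positivity)).comp tendsto_natCast_atTop_atTop)
    have hdecay := (((tendsto_rpow_neg_atTop hη).comp hroot).const_mul C)
    rw [mul_zero] at hdecay
    refine isLittleO_iff.2 fun c hc => ?_
    filter_upwards [h, hroot.eventually_ge_atTop 1, hdecay.eventually_le_const hc,
      eventually_ge_atTop 1] with n h1 h2 h3 hn
    simp only [Function.comp_apply] at h3
    rw [mainScale] at h1 ⊢
    set A := count a ((n : ℝ) ^ (1 / k : ℝ)) with hA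
    have hA0 : 0 < A := by linarith
    have hre := (Complex.abs_re_le_norm _).trans h1
    rw [Complex.sub_re, Complex.ofReal_re, Complex.re_ofReal_mul] at hre
    refine hre.trans ?_
    rw [Real.norm_of_nonneg (by positivity), sub_eq_add_neg, Real.rpow_add hA0, Real.rpow_natCast]
    calc C * (A ^ s * A ^ (-η) / n) = C * A ^ (-η) * (A ^ s / n) := by ring
      _ ≤ _ := by gcongr

end Regular

end ThinWaring

end

theorem mainTheorem7
    (k : ℕ) (hk : 2 ≤ k)
    (a : ℕ → ℝ) (ha : ∀ n, 0 ≤ a n) (ha_top : Tendsto (ThinWaring.count a) atTop atTop)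
    (hdens : 0 < ThinWaring.logLowerDensity a)
    (κ : (q : ℕ) → ZMod q → ℝ) (QD QW E Δ L : ℝ → ℝ) (t₀ ϱ ω : ℝ)
    (ht₀ : 0 ≤ t₀) (hϱ : 0 < ϱ) (hω : 0 ≤ ω) (hEpos : ∀ X, 0 < E X)
    (hD : ThinWaring.Distributed a κ QD E)
    (hV : ThinWaring.MeanValueHyp a k t₀ Δ)
    (hW : ThinWaring.WeylHyp a k ϱ QW L)
    (hL : ∃ δ : ℝ, 0 < δ ∧
      L =O[atTop] (fun X : ℝ => ThinWaring.levelY a QD QW E X ^ (ϱ - δ)))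
    (hE : E =O[atTop] (fun _ : ℝ => (1 : ℝ)))
    (hQD : ThinWaring.ComparableToId QD) (hQW : ThinWaring.ComparableToId QW)
    (hΔ : Δ =O[atTop] (fun X : ℝ => min X (ThinWaring.count a X) ^ ω)) :
    ∃ Ψ : ℝ → ℝ, ThinWaring.Approximates Ψ a ∧
      (∀ σ₀ : ℝ, 5 * ω / ϱ ≤ σ₀ → ∀ s : ℕ, 2 * t₀ + σ₀ < (s : ℝ) →
        ThinWaring.AsymptoticFormula a κ Ψ k s) ∧
      (ω < ϱ / 5 → ∀ s : ℕ, (s : ℝ) = 2 * t₀ + 1 →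
        ThinWaring.AsymptoticFormula a κ Ψ k s) := by
  have H := ThinWaring.regular_of_hypotheses hk ha ha_top hdens ht₀ hϱ hω hD hV hW hE hQD hQW hΔ
  obtain ⟨B, -, hB⟩ := H.bound
  refine ⟨ThinWaring.smoothCount a k, ThinWaring.approximates_smoothCount hk ha hB,
    fun σ₀ hσ₀ s hs => H.asymptoticFormula (by linarith), fun hlt s hs => H.asymptoticFormula ?_⟩
  -- The case s = 2t₀ + 1 is the general condition on s with an increment 1 that exceeds 5ω/ϱ.
  have : 5 * ω / ϱ < 1 := by
    rw [div_lt_one hϱ]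
    linarith
  linarith
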